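/- Let $\lambda,\mu,\rho>0$, put $a_N=(\mu/\rho)^N e^{-\mu/\rho}/N!$ and $\gamma_N(\underline v)=\prod_{i=1}^N e^{-\pi v_i^2}$ for $N\ge 0$, and let $\mathcal H$ be the real Hilbert space of sequences $\mathbf h=(h_N)_{N\ge 0}$ of functions $h_N:\mathbb R^N\to\mathbb R$, symmetric under permutations of the variables, with scalar product $(\mathbf h,\mathbf j)=\sum_{N\ge 0}a_N\int_{\mathbb R^N}h_N\,j_N\,\gamma_N\,d\underline v$ and $(\mathbf h,\mathbf h)<\infty$. Put $$(\mathcal P^+\mathbf h)_N(\underline v)=\sum_{i=1}^N h_{N-1}(v_1,\dots,v_{i-1},v_{i+1},\dots,v_N),$$ $$(\mathcal P^-\mathbf h)_N(\underline v)=\frac1{N+1}\sum_{i=1}^{N+1}\int_{\mathbb R} e^{-\pi w^2}h_{N+1}(v_1,\dots,v_{i-1},w,v_i,\dots,v_N)\,dw,$$ $(\mathcal N\mathbf h)_N=N h_N$, and $(\mathcal K\mathbf h)_N=\sum_{1\le i<j\le N}(R_{i,j}h_N-h_N)$, where $R_{i,j}h_N$ is the average of $h_N$ over all rotations in the $(v_i,v_j)$-plane.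 Let $$\widetilde{\mathcal L}\mathbf h=\rho(\mathcal P^+\mathbf h-\mathcal N\mathbf h)+\mu(\mathcal P^-\mathbf h-\mathbf h)+\lambda\frac{\rho}{\mu}\mathcal K\mathbf h,$$ with domain $D^2=\{\mathbf h\in\mathcal H:\widetilde{\mathcal L}\mathbf h\in\mathcal H\}$. Let $\mathbf e^0$ be the state with all components equal to $1$, let $\mathbf E_0=\mathrm{span}\{\mathbf e^0\}$ and $\mathbf E_1=\mathrm{span}\{\mathbf e_1,\mathbf e_{(0,0,1)}\}$, where $\mathbf e_1=\sqrt{\rho/\mu}\,\mathcal P^+\mathbf e^0-\sqrt{\mu/\rho}\,\mathbf e^0$ and $(\mathbf e_{(0,0,1)})_N(\underline v)=\sqrt{\rho/(2\mu)}\sum_{i=1}^N(2\pi v_i^2-1)$. Define the second gap $$\Delta_2=\sup\{(\mathbf h,\widetilde{\mathcal L}\mathbf h)\;:\;\mathbf h\in D^2,\ (\mathbf h,\mathbf h)=1,\ \mathbf h\perp\mathbf E_0\oplus\mathbf E_1\}.$$ **Theorem.** If $\rho>\frac{\lambda}{4}+2\lambda\sqrt{\rho/\mu}$ and $\mu/\rho>256$,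 then $$-\rho-\frac{\lambda}{4}\le\Delta_2<-\rho-\frac{\lambda}{4}+2\lambda\sqrt{\frac{\rho}{\mu}}.$$ Moreover $\Delta_2$ is an eigenvalue of $\widetilde{\mathcal L}$, and every $\mathbf h\in D^2$ with $\widetilde{\mathcal L}\mathbf h=\Delta_2\mathbf h$ has, for every $N$, a component $h_N$ that is (almost everywhere) a polynomial, even in each of the variables $v_1,\dots,v_N$, and either zero or of degree exactly $4$. -/

import Mathlib

namespace KacReservoir

open MeasureTheory

noncomputable section

/-- The phase space `⋃_N ℝ^N`: a number of particles together with their velocities. -/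
abbrev Phase : Type := Σ N : ℕ, (Fin N → ℝ)

/-- The one-particle Maxwellian `γ(v) dv = e^{-π v²} dv` at temperature `1/(2π)`. -/
def maxwellian : Measure ℝ :=
  volume.withDensity fun v => ENNReal.ofReal (Real.exp (-(Real.pi * v ^ 2)))

/-- The `N`-particle Maxwellian `γ_N = ∏ i, γ(v_i)`. -/
def maxwellianN (N : ℕ) : Measure (Fin N → ℝ) := Measure.pi fun _ => maxwellian

/-- The Poisson weights `a_N = (μ/ρ)^N e^{-μ/ρ} / N!`. -/
def weight (μ ρ : ℝ) (N : ℕ) : ℝ := (μ / ρ) ^ N * Real.exp (-(μ / ρ)) / (N.factorial : ℝ)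

/-- The steady state, as a measure on the phase space: it is `a_N γ_N` on the component `ℝ^N`. -/
def steady (μ ρ : ℝ) : Measure Phase :=
  Measure.sum fun N : ℕ =>
    ENNReal.ofReal (weight μ ρ N) • (maxwellianN N).map (fun v => (⟨N, v⟩ : Phase))

/-- The real Hilbert space `⨁_N L²(ℝ^N, a_N γ_N)`. -/
abbrev L2 (μ ρ : ℝ) : Type := Lp ℝ 2 (steady μ ρ)

/-- Invariance of every component under permutations of the velocities (almost everywhere). -/
def IsSymmetric (h : Phase → ℝ) : Prop :=
  ∀ (N : ℕ) (σ : Equiv.Perm (Fin N)),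
    ∀ᵐ v : Fin N → ℝ ∂volume, h ⟨N, fun i => v (σ i)⟩ = h ⟨N, v⟩

/-- `(P⁺ h)_N (v) = ∑ i, h_{N-1} (v with v_i removed)`, and `(P⁺ h)_0 = 0`. -/
def creation (h : Phase → ℝ) : Phase → ℝ
  | ⟨0, _⟩ => 0
  | ⟨N + 1, v⟩ => ∑ i : Fin (N + 1), h ⟨N, i.removeNth v⟩

/-- `(P⁻ h)_N (v) = (N+1)⁻¹ ∑ i, ∫ e^{-π w²} h_{N+1} (v with w inserted at place i) dw`. -/
def annihilation (h : Phase → ℝ) : Phase → ℝ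
  | ⟨N, v⟩ => (1 / ((N : ℝ) + 1)) * ∑ i : Fin (N + 1),
      ∫ w : ℝ, Real.exp (-(Real.pi * w ^ 2)) * h ⟨N + 1, i.insertNth w v⟩

/-- Rotation by `θ` in the plane of the coordinates `i` and `j`. -/
def rotate {N : ℕ} (i j : Fin N) (θ : ℝ) (v : Fin N → ℝ) : Fin N → ℝ :=
  Function.update (Function.update v i (v i * Real.cos θ - v j * Real.sin θ)) j
    (v i * Real.sin θ + v j * Real.cos θ)

/-- `R_{i,j}`: the average over all rotations in the plane of the coordinates `i` and `j`. -/
def collide {N : ℕ} (i j : Fin N) (f : (Fin N → ℝ) → ℝ) (v : Fin N → ℝ) : ℝ :=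
  (1 / (2 * Real.pi)) * ∫ θ in (0 : ℝ)..(2 * Real.pi), f (rotate i j θ v)

/-- The Kac collision operator, `K_N = ∑_{i<j} (R_{i,j} - Id)` on the component `ℝ^N`. -/
def kac (h : Phase → ℝ) : Phase → ℝ
  | ⟨N, v⟩ => ∑ i : Fin N, ∑ j ∈ Finset.Ioi i,
      (collide i j (fun u => h ⟨N, u⟩) v - h ⟨N, v⟩)

/-- The generator after the ground state transformation,
`ρ (P⁺ - N) + μ (P⁻ - Id) + (lam ρ / μ) K`, as an operation on functions on the phase space. -/
def generator (lam μ ρ : ℝ) (h : Phase → ℝ) (x : Phase) : ℝ :=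
  ρ * (creation h x - (x.1 : ℝ) * h x) + μ * (annihilation h x - h x)
    + lam * ρ / μ * kac h x

/-- The domain `D²` of the generator in the symmetric subspace. -/
def domain (lam μ ρ : ℝ) : Set (L2 μ ρ) :=
  {h | IsSymmetric h ∧ MemLp (generator lam μ ρ h) 2 (steady μ ρ)}

/-- The quadratic form `(h, L h)` of the generator `L`. -/
def form (lam μ ρ : ℝ) (h : L2 μ ρ) : ℝ :=
  ∫ x, h x * generator lam μ ρ h x ∂(steady μ ρ)

/-- The eigenvectors of the generator for `c`, together with `0`. -/
def eigenspace (lam μ ρ c : ℝ) : Set (L2 μ ρ) :=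
  {h | h ∈ domain lam μ ρ ∧ generator lam μ ρ h =ᵐ[steady μ ρ] fun x => c * h x}

/-- The function representing `e⁰`. -/
def e0Fun : Phase → ℝ := fun _ => 1

/-- The function representing `e₁ = √(ρ/μ) P⁺ e⁰ - √(μ/ρ) e⁰`. -/
def e1Fun (μ ρ : ℝ) : Phase → ℝ := fun x =>
  Real.sqrt (ρ / μ) * creation e0Fun x - Real.sqrt (μ / ρ) * e0Fun x

/-- The function representing `e_{(0,0,1)}`, `v ↦ √(ρ/(2μ)) ∑ i, (2π v_i² - 1)`. -/
def e2Fun (μ ρ : ℝ) : Phase → ℝ := fun x =>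
  Real.sqrt (ρ / (2 * μ)) * ∑ i : Fin x.1, (2 * Real.pi * x.2 i ^ 2 - 1)

/-! Square integrability of the three states above. -/

theorem maxwellian_eq :
    maxwellian = ProbabilityTheory.gaussianReal 0 (Real.toNNReal (1 / (2 * Real.pi))) := by
  have hp := Real.pi_pos
  have h0 : (0 : ℝ) < 1 / (2 * Real.pi) := by positivity
  have hne : Real.toNNReal (1 / (2 * Real.pi)) ≠ 0 := by
    simpa using hp
  rw [ProbabilityTheory.gaussianReal_of_var_ne_zero _ hne, maxwellian]
  congr 1
  funext v
  rw [ProbabilityTheory.gaussianPDF, ProbabilityTheory.gaussianPDFReal,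
    Real.coe_toNNReal _ h0.le]
  have h1 : 2 * Real.pi * (1 / (2 * Real.pi)) = 1 := by field_simp
  rw [h1]
  congr 1
  simp only [Real.sqrt_one, inv_one, one_mul, sub_zero]
  congr 1
  field_simp

instance : IsProbabilityMeasure maxwellian := by
  rw [maxwellian_eq]; infer_instance

instance (N : ℕ) : IsProbabilityMeasure (maxwellianN N) := by
  unfold maxwellianN; infer_instance

theorem measurable_mk (N : ℕ) : Measurable (fun v : Fin N → ℝ => (⟨N, v⟩ : Phase)) :=
  fun _ hs => MeasurableSpace.measurableSet_iInf.mp hs N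

theorem lintegral_steady (μ ρ : ℝ) (f : Phase → ENNReal) (hf : Measurable f) :
    ∫⁻ x, f x ∂(steady μ ρ)
      = ∑' N, ENNReal.ofReal (weight μ ρ N) * ∫⁻ v, f ⟨N, v⟩ ∂(maxwellianN N) := by
  rw [steady, lintegral_sum_measure]
  congr 1
  funext N
  rw [lintegral_smul_measure, lintegral_map hf (measurable_mk N), smul_eq_mul]

theorem memLp_of_bound (μ ρ : ℝ) (f : Phase → ℝ) (hf : Measurable f) (C : ℝ)
    (hb : ∀ N, ∫⁻ v, ‖f ⟨N, v⟩‖ₑ ^ 2 ∂(maxwellianN N) ≤ ENNReal.ofReal (C * 4 ^ N)) :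
    MemLp f 2 (steady μ ρ) := by
  refine ⟨hf.aestronglyMeasurable, ?_⟩
  rw [eLpNorm_lt_top_iff_lintegral_rpow_enorm_lt_top (by norm_num) (by norm_num)]
  simp only [ENNReal.toReal_ofNat, ENNReal.rpow_ofNat]
  rw [lintegral_steady μ ρ (fun x => ‖f x‖ₑ ^ 2) (by fun_prop)]
  have hs : Summable fun N : ℕ =>
      C * Real.exp (-(μ / ρ)) * ((4 * |μ / ρ|) ^ N / (N.factorial : ℝ)) :=
    (Real.summable_pow_div_factorial _).mul_left _
  refine lt_of_le_of_lt (ENNReal.tsum_le_tsum fun N => ?_) hs.tsum_ofReal_lt_top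
  refine (mul_le_mul_right (hb N) _).trans ?_
  have hw : weight μ ρ N ≤ |μ / ρ| ^ N * Real.exp (-(μ / ρ)) / (N.factorial : ℝ) := by
    unfold weight
    rw [← abs_pow]
    gcongr
    exact le_abs_self _
  have h0 : 0 ≤ |μ / ρ| ^ N * Real.exp (-(μ / ρ)) / (N.factorial : ℝ) := by positivity
  calc ENNReal.ofReal (weight μ ρ N) * ENNReal.ofReal (C * 4 ^ N)
      ≤ ENNReal.ofReal (|μ / ρ| ^ N * Real.exp (-(μ / ρ)) / (N.factorial : ℝ))
          * ENNReal.ofReal (C * 4 ^ N) := by gcongr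
    _ = ENNReal.ofReal (C * Real.exp (-(μ / ρ)) *
          ((4 * |μ / ρ|) ^ N / (N.factorial : ℝ))) := by
        rw [← ENNReal.ofReal_mul h0]
        congr 1
        rw [mul_pow]
        ring

theorem sq_le_four_pow (N : ℕ) : (N : ℝ) ^ 2 ≤ 4 ^ N := by
  have h : (N : ℝ) ≤ 2 ^ N := by exact_mod_cast N.lt_two_pow_self.le
  calc (N : ℝ) ^ 2 ≤ (2 ^ N) ^ 2 := by gcongr
    _ = 4 ^ N := by rw [← pow_mul, mul_comm, pow_mul]; norm_num

theorem lintegral_const_le (N : ℕ) (c C : ℝ) (h : c ^ 2 ≤ C) :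
    ∫⁻ _ : Fin N → ℝ, ‖c‖ₑ ^ 2 ∂(maxwellianN N) ≤ ENNReal.ofReal C := by
  rw [lintegral_const, measure_univ, mul_one, Real.enorm_eq_ofReal_abs,
    ← ENNReal.ofReal_pow (abs_nonneg c), sq_abs]
  exact ENNReal.ofReal_le_ofReal h

theorem creation_e0Fun (x : Phase) : creation e0Fun x = x.1 := by
  obtain ⟨N, v⟩ := x
  cases N with
  | zero => simp [creation]
  | succ n => simp [creation, e0Fun]

theorem memLp_e0Fun (μ ρ : ℝ) : MemLp e0Fun 2 (steady μ ρ) := by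
  refine memLp_of_bound μ ρ _ measurable_const 1 fun N => ?_
  refine lintegral_const_le N 1 _ ?_
  have : (1 : ℝ) ≤ 4 ^ N := one_le_pow₀ (by norm_num)
  linarith

theorem measurable_of_components (f : Phase → ℝ)
    (h : ∀ N, Measurable fun v : Fin N → ℝ => f ⟨N, v⟩) : Measurable f := by
  intro s hs
  rw [MeasurableSpace.measurableSet_iInf]
  intro N
  exact h N hs

theorem memLp_e1Fun (μ ρ : ℝ) : MemLp (e1Fun μ ρ) 2 (steady μ ρ) := by
  have hE : e1Fun μ ρ = fun x : Phase =>
      Real.sqrt (ρ / μ) * (x.1 : ℝ) - Real.sqrt (μ / ρ) := by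
    funext x
    simp only [e1Fun, creation_e0Fun]
    simp [e0Fun]
  rw [hE]
  refine memLp_of_bound μ ρ _ (measurable_of_components _ fun N =>
    (measurable_const : Measurable fun _ : Fin N → ℝ =>
      Real.sqrt (ρ / μ) * (N : ℝ) - Real.sqrt (μ / ρ)))
    (2 * Real.sqrt (ρ / μ) ^ 2 + 2 * Real.sqrt (μ / ρ) ^ 2) fun N => ?_
  refine lintegral_const_le N (Real.sqrt (ρ / μ) * (N : ℝ) - Real.sqrt (μ / ρ)) _ ?_
  have h1 : (1 : ℝ) ≤ 4 ^ N := one_le_pow₀ (by norm_num)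
  have h2 := sq_le_four_pow N
  have h3 := mul_le_mul_of_nonneg_left h1 (sq_nonneg (Real.sqrt (μ / ρ)))
  have h4 := mul_le_mul_of_nonneg_left h2 (sq_nonneg (Real.sqrt (ρ / μ)))
  nlinarith [sq_nonneg (Real.sqrt (ρ / μ) * (N : ℝ) + Real.sqrt (μ / ρ))]

theorem integrable_poly : Integrable (fun v : ℝ => (2 * Real.pi * v ^ 2 - 1) ^ 2) maxwellian := by
  have h4 : Integrable (fun v : ℝ => v ^ 4) maxwellian := by
    rw [maxwellian_eq]
    have := (ProbabilityTheory.memLp_id_gaussianReal (μ := 0)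
      (v := Real.toNNReal (1 / (2 * Real.pi))) 4).integrable_norm_pow (by norm_num)
    refine this.congr (Filter.Eventually.of_forall fun v => ?_)
    simp [Even.pow_abs (by decide : Even 4)]
  have h2 : Integrable (fun v : ℝ => v ^ 2) maxwellian := by
    rw [maxwellian_eq]
    have := (ProbabilityTheory.memLp_id_gaussianReal (μ := 0)
      (v := Real.toNNReal (1 / (2 * Real.pi))) 2).integrable_norm_pow (by norm_num)
    refine this.congr (Filter.Eventually.of_forall fun v => ?_)
    simp
  have := ((h4.const_mul (4 * Real.pi ^ 2)).sub (h2.const_mul (4 * Real.pi))).add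
    (integrable_const (1 : ℝ))
  refine this.congr (Filter.Eventually.of_forall fun v => ?_)
  simp only [Pi.add_apply, Pi.sub_apply]
  ring

theorem memLp_e2Fun (μ ρ : ℝ) : MemLp (e2Fun μ ρ) 2 (steady μ ρ) := by
  set C : ℝ := ∫ v, (2 * Real.pi * v ^ 2 - 1) ^ 2 ∂maxwellian with hC
  have hC0 : 0 ≤ C := integral_nonneg fun v => sq_nonneg _
  refine memLp_of_bound μ ρ _ (measurable_of_components _ fun N => ?_)
    (Real.sqrt (ρ / (2 * μ)) ^ 2 * C) fun N => ?_
  · simp only [e2Fun]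
    have h : ∀ i ∈ (Finset.univ : Finset (Fin N)),
        Measurable fun v : Fin N → ℝ => 2 * Real.pi * v i ^ 2 - 1 := fun i _ => by fun_prop
    exact (Finset.measurable_fun_sum _ h).const_mul _
  set s : ℝ := Real.sqrt (ρ / (2 * μ))
  have hmp : ∀ i : Fin N, MeasurePreserving (Function.eval i) (maxwellianN N) maxwellian :=
    fun i => measurePreserving_eval (fun _ : Fin N => maxwellian) i
  have hint : ∀ i : Fin N,
      Integrable (fun v : Fin N → ℝ => (2 * Real.pi * v i ^ 2 - 1) ^ 2) (maxwellianN N) :=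
    fun i => (hmp i).integrable_comp_of_integrable integrable_poly
  have hval : ∀ i : Fin N,
      ∫ v : Fin N → ℝ, (2 * Real.pi * v i ^ 2 - 1) ^ 2 ∂(maxwellianN N) = C := by
    intro i
    rw [hC, ← (hmp i).map_eq, integral_map (hmp i).measurable.aemeasurable (by fun_prop)]
  have hsum : Integrable (fun v : Fin N → ℝ =>
      s ^ 2 * ((N : ℝ) * ∑ i, (2 * Real.pi * v i ^ 2 - 1) ^ 2)) (maxwellianN N) :=
    ((integrable_finsetSum _ fun i _ => hint i).const_mul _).const_mul _
  calc ∫⁻ v, ‖e2Fun μ ρ ⟨N, v⟩‖ₑ ^ 2 ∂(maxwellianN N)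
      ≤ ∫⁻ v : Fin N → ℝ, ENNReal.ofReal
          (s ^ 2 * ((N : ℝ) * ∑ i, (2 * Real.pi * v i ^ 2 - 1) ^ 2)) ∂(maxwellianN N) := by
        refine lintegral_mono fun v => ?_
        rw [Real.enorm_eq_ofReal_abs, ← ENNReal.ofReal_pow (abs_nonneg _), sq_abs]
        refine ENNReal.ofReal_le_ofReal ?_
        simp only [e2Fun, mul_pow]
        refine mul_le_mul_of_nonneg_left ?_ (sq_nonneg _)
        have h := sq_sum_le_card_mul_sum_sq (s := (Finset.univ : Finset (Fin N)))
          (f := fun i => 2 * Real.pi * v i ^ 2 - 1)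
        rwa [Finset.card_univ, Fintype.card_fin] at h
    _ = ENNReal.ofReal (s ^ 2 * ((N : ℝ) * (N * C))) := by
        rw [← ofReal_integral_eq_lintegral_ofReal hsum
          (Filter.Eventually.of_forall fun v => by positivity), integral_const_mul,
          integral_const_mul, integral_finsetSum _ fun i _ => hint i]
        simp [hval]
    _ ≤ ENNReal.ofReal (s ^ 2 * C * 4 ^ N) := by
        refine ENNReal.ofReal_le_ofReal ?_
        have h := mul_le_mul_of_nonneg_left (sq_le_four_pow N)
          (mul_nonneg (sq_nonneg s) hC0)
        nlinarith

/-- The state `e⁰`, all of whose components are `1`. -/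
def e0 (μ ρ : ℝ) : L2 μ ρ := (memLp_e0Fun μ ρ).toLp _

/-- The state `e₁`. -/
def e1 (μ ρ : ℝ) : L2 μ ρ := (memLp_e1Fun μ ρ).toLp _

/-- The state `e_{(0,0,1)}`. -/
def e2 (μ ρ : ℝ) : L2 μ ρ := (memLp_e2Fun μ ρ).toLp _

/-- `E₀`, the span of `e⁰`. -/
def E0 (μ ρ : ℝ) : Submodule ℝ (L2 μ ρ) := Submodule.span ℝ {e0 μ ρ}

/-- `E₁`, the span of `e₁` and `e_{(0,0,1)}`. -/
def E1 (μ ρ : ℝ) : Submodule ℝ (L2 μ ρ) := Submodule.span ℝ {e1 μ ρ, e2 μ ρ}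

/-- The values of the quadratic form at the unit vectors of the domain orthogonal to
`E₀ ⊕ E₁`. -/
def gapSet (lam μ ρ : ℝ) : Set ℝ :=
  {q | ∃ h ∈ domain lam μ ρ, ‖h‖ = 1 ∧ h ∈ (E0 μ ρ ⊔ E1 μ ρ)ᗮ ∧ q = form lam μ ρ h}

/-- The second gap `Δ₂`. -/
def secondGap (lam μ ρ : ℝ) : ℝ := sSup (gapSet lam μ ρ)

/-- `f` agrees almost everywhere with a polynomial that is even in each variable and that is of
degree four, or zero. -/
def IsEvenQuartic {N : ℕ} (f : (Fin N → ℝ) → ℝ) : Prop :=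
  ∃ p : MvPolynomial (Fin N) ℝ,
    (p = 0 ∨ p.totalDegree = 4) ∧
    (∀ (v : Fin N → ℝ) (i : Fin N),
      MvPolynomial.eval (Function.update v i (-v i)) p = MvPolynomial.eval v p) ∧
    ∀ᵐ v : Fin N → ℝ ∂volume, f v = MvPolynomial.eval v p

end

end KacReservoir

/-! Write t = μ/ρ and ε = √(ρ/μ), so that ε² = 1/t. The Poisson weights satisfy the detailed balance
ρ(N+1)a_{N+1} = μ a_N. It makes the generator symmetric, even on its maximal domain
(`genSeq_symmetric`), and splits the quadratic form into minus an exchange energy and the Kac part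
(λ/t)K.

The exchange part behaves like -ρ times a number operator: its value is 0 on `e0`, it is -ρ on `e1`
and on the sums ∑ f(v_i) with f centred and independent of N, and it is at most -2ρ on the rest.
`exchange_sum_lower_bound` proves this as an inequality. In the particle labels it uses the
decomposition of a function into its mean, its one-particle parts and a remainder; in the variable N
it uses two Poincaré inequalities for the Poisson law. Off E₀ ⊕ E₁ the only part above -2ρ is
therefore ∑ f(v_i) with f orthogonal to 1 and to H₂. On such sums K acts to leading order as -t
times the one-particle operator `oneKac`, which is triangular on monomials with diagonal entries 1 -
mean(cos^m + sin^m) for m > 0. These are 0 for m = 2, 1/4 for m = 4 and at least 3/8 for all other m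
> 0. This singles out ∑ H₄(v_i) and the value -ρ - λ/4.

The coupling of ∑ f(v_i) to its complement through K is controlled by K ≤ 0 and a weighted
Cauchy-Schwarz inequality with a free parameter s (`kac_lower_bound`, `form_upper_bound`). The
choice s = 4ε gives the bound -ρ - λ/4 + λε. The choice s = 1/4 gives -ρ - λ/4 - λε/2 up to a
rank-one term along u = ∑ H₄(v_i). Both are collected in `form_bounds`.

The operator K couples ∑ H₄(v_i) only to ∑_{i<j} H₂(v_i)H₂(v_j), and the states with components in
the span of these two are invariant under the generator. In this sector truncations of u have
Rayleigh quotients arbitrarily close to -ρ - λ/4, so the suprema of the form over finite-dimensional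
subspaces reach at least that value. The rank-one bound then keeps the weak limit of the maximizers
from being orthogonal to u (`exists_weak_eigenvector`). The limit is an eigenvector h, with quartic
components, for some E ≥ -ρ - λ/4.

Finally, every domain vector off E₀ ⊕ E₁ splits as w + c h with w orthogonal to u, and the form of w
is at most (E - λε/2)‖w‖². Hence E is the maximum of the form, and its eigenspace is the line
through h (`exists_isGreatest`). -/

namespace KacReservoir

open MeasureTheory Filter Topology
open scoped InnerProductSpace RealInnerProductSpace ENNReal

noncomputable section

/-! ### Pullbacks and averages on `L²` -/

section Averages

variable {A B C : Type*} [MeasurableSpace A] [MeasurableSpace B] [MeasurableSpace C]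
  {α : Measure A} {β : Measure B} {γ : Measure C}

/-- Composition with a measure preserving map, as a bounded operator on `L²`. -/
def pull {p : A → B} (hp : MeasurePreserving p α β) : Lp ℝ 2 β →L[ℝ] Lp ℝ 2 α :=
  (Lp.compMeasurePreservingₗᵢ ℝ p hp).toContinuousLinearMap

theorem coeFn_pull {p : A → B} (hp : MeasurePreserving p α β) (f : Lp ℝ 2 β) :
    pull hp f =ᵐ[α] fun a => f (p a) :=
  Lp.coeFn_compMeasurePreserving f hp

theorem norm_pull {p : A → B} (hp : MeasurePreserving p α β) (f : Lp ℝ 2 β) :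
    ‖pull hp f‖ = ‖f‖ :=
  Lp.norm_compMeasurePreserving f hp

theorem inner_pull_pull {p : A → B} (hp : MeasurePreserving p α β) (f g : Lp ℝ 2 β) :
    ⟪pull hp f, pull hp g⟫ = ⟪f, g⟫ :=
  (Lp.compMeasurePreservingₗᵢ ℝ p hp).inner_map_map f g

theorem ae_of_pull {p : A → B} (hp : MeasurePreserving p α β) {P : B → Prop}
    (h : ∀ᵐ b ∂β, P b) : ∀ᵐ a ∂α, P (p a) :=
  hp.quasiMeasurePreserving.ae h

theorem pull_eq_of_ae {p : A → B} (hp : MeasurePreserving p α β) {f : Lp ℝ 2 β}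
    {g : Lp ℝ 2 α} {f' : B → ℝ} (hf : f =ᵐ[β] f') (hg : g =ᵐ[α] fun a => f' (p a)) :
    pull hp f = g := by
  refine Lp.ext ?_
  filter_upwards [coeFn_pull hp f, ae_of_pull hp hf, hg] with a h1 h2 h3
  rw [h1, h2, h3]

theorem pull_pull {p : A → B} (hp : MeasurePreserving p α β) {q : B → C}
    (hq : MeasurePreserving q β γ) {r : A → C} (hr : MeasurePreserving r α γ)
    (h : ∀ a, r a = q (p a)) (f : Lp ℝ 2 γ) :
    pull hp (pull hq f) = pull hr f := by
  refine pull_eq_of_ae hp (coeFn_pull hq f) ?_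
  filter_upwards [coeFn_pull hr f] with a h1
  rw [h1, h]

theorem integral_pull {p : A → B} (hp : MeasurePreserving p α β) {f : B → ℝ}
    (hf : AEStronglyMeasurable f β) : ∫ a, f (p a) ∂α = ∫ b, f b ∂β := by
  rw [← hp.map_eq] at hf ⊢
  exact (integral_map hp.measurable.aemeasurable hf).symm

theorem Lp_integrable [IsFiniteMeasure α] (f : Lp ℝ 2 α) : Integrable f α :=
  (Lp.memLp f).integrable (by norm_num)

/-- Two integrable functions agree once their integrals over all measurable sets agree. The adjoint
turns the indicator of s into that of A × s, and Fubini does the rest. -/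
theorem coeFn_adjoint_pull_snd [IsProbabilityMeasure α] [IsProbabilityMeasure β]
    (f : Lp ℝ 2 (α.prod β)) :
    ((pull (measurePreserving_snd (μ := α) (ν := β))).adjoint f : B → ℝ)
      =ᵐ[β] fun b => ∫ a, f (a, b) ∂α := by
  have hint : Integrable f (α.prod β) := Lp_integrable f
  refine Integrable.ae_eq_of_forall_setIntegral_eq _ _ (Lp_integrable _)
    hint.integral_prod_right fun s hs _ => ?_
  have h1 : ∫ b in s, ((pull (measurePreserving_snd (μ := α) (ν := β))).adjoint f : B → ℝ) b ∂β
      = ⟪indicatorConstLp 2 hs (measure_ne_top β s) (1 : ℝ),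
        (pull (measurePreserving_snd (μ := α) (ν := β))).adjoint f⟫ := by
    rw [L2.inner_indicatorConstLp_one]
  rw [h1, ContinuousLinearMap.adjoint_inner_right]
  have hs' : MeasurableSet (Prod.snd ⁻¹' s : Set (A × B)) := measurable_snd hs
  have h2 : pull (measurePreserving_snd (μ := α) (ν := β))
      (indicatorConstLp 2 hs (measure_ne_top β s) (1 : ℝ))
      = indicatorConstLp 2 hs' (measure_ne_top _ _) (1 : ℝ) :=
    Lp.indicatorConstLp_compMeasurePreserving hs (measure_ne_top β s) 1 measurePreserving_snd
  rw [h2, L2.inner_indicatorConstLp_one]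
  have h3 : (Prod.snd ⁻¹' s : Set (A × B)) = Set.univ ×ˢ s := by ext; simp
  have h4 : (α.prod β).restrict (Set.univ ×ˢ s) = α.prod (β.restrict s) := by
    rw [← Measure.prod_restrict, Measure.restrict_univ]
  have h5 : Integrable f (α.prod (β.restrict s)) := h4 ▸ hint.integrableOn
  rw [h3, h4, integral_prod_symm _ h5]

/-- The averaging operator `f ↦ ∫ f (φ (a, b)) dα(a)` for a measure preserving `φ`. -/
def avg [IsProbabilityMeasure α] [SFinite β] {φ : A × B → C}
    (hφ : MeasurePreserving φ (α.prod β) γ) : Lp ℝ 2 γ →L[ℝ] Lp ℝ 2 β :=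
  (pull (measurePreserving_snd (μ := α) (ν := β))).adjoint ∘L pull hφ

theorem coeFn_avg [IsProbabilityMeasure α] [IsProbabilityMeasure β] {φ : A × B → C}
    (hφ : MeasurePreserving φ (α.prod β) γ) (f : Lp ℝ 2 γ) :
    avg hφ f =ᵐ[β] fun b => ∫ a, f (φ (a, b)) ∂α := by
  refine (coeFn_adjoint_pull_snd (pull hφ f)).trans ?_
  have h : ∀ᵐ z ∂(β.prod α), pull hφ f z.swap = f (φ z.swap) :=
    ae_of_pull (Measure.measurePreserving_swap (μ := β) (ν := α)) (coeFn_pull hφ f)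
  filter_upwards [Measure.ae_ae_of_ae_prod h] with b hb
  exact integral_congr_ae hb

theorem coeFn_avg_of_ae [IsProbabilityMeasure α] [IsProbabilityMeasure β] {φ : A × B → C}
    (hφ : MeasurePreserving φ (α.prod β) γ) (f : Lp ℝ 2 γ) {f' : C → ℝ} (hf : f =ᵐ[γ] f') :
    avg hφ f =ᵐ[β] fun b => ∫ a, f' (φ (a, b)) ∂α := by
  refine (coeFn_avg hφ f).trans ?_
  have h : ∀ᵐ z ∂(β.prod α), f (φ z.swap) = f' (φ z.swap) :=
    ae_of_pull (Measure.measurePreserving_swap (μ := β) (ν := α)) (ae_of_pull hφ hf)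
  filter_upwards [Measure.ae_ae_of_ae_prod h] with b hb
  exact integral_congr_ae hb

theorem inner_avg_left [IsProbabilityMeasure α] [SFinite β] {φ : A × B → C}
    (hφ : MeasurePreserving φ (α.prod β) γ) (f : Lp ℝ 2 γ) (g : Lp ℝ 2 β) :
    ⟪avg hφ f, g⟫ = ⟪pull hφ f, pull (measurePreserving_snd (μ := α) (ν := β)) g⟫ := by
  simp only [avg, ContinuousLinearMap.comp_apply, ContinuousLinearMap.adjoint_inner_left]

/-- The map φ resamples a point of C with its image under p held fixed, so the adjoint of
composition with p is a conditional expectation given p. -/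
theorem adjoint_pull_eq_avg [IsProbabilityMeasure α] [SFinite β] {φ : A × B → C}
    (hφ : MeasurePreserving φ (α.prod β) γ) {p : C → B} (hp : MeasurePreserving p γ β)
    (h : ∀ a b, p (φ (a, b)) = b) : (pull hp).adjoint = avg hφ := by
  ext1 f
  refine ext_inner_right ℝ fun g => ?_
  rw [inner_avg_left, ContinuousLinearMap.adjoint_inner_left, ← inner_pull_pull hφ f,
    pull_pull hφ hp measurePreserving_snd (fun a => (h a.1 a.2).symm)]

/-- Reversibility: Ψ exchanges the state before the random move with the state after it and
preserves the joint law. -/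
theorem avg_symmetric [IsProbabilityMeasure α] [SFinite β] {φ : A × B → B}
    (hφ : MeasurePreserving φ (α.prod β) β) {Ψ : A × B → A × B}
    (hΨ : MeasurePreserving Ψ (α.prod β) (α.prod β)) (h1 : ∀ z, φ (Ψ z) = z.2)
    (h2 : ∀ z, (Ψ z).2 = φ z) (f g : Lp ℝ 2 β) : ⟪avg hφ f, g⟫ = ⟪f, avg hφ g⟫ := by
  rw [inner_avg_left, real_inner_comm, real_inner_comm (avg hφ g), inner_avg_left,
    ← inner_pull_pull hΨ, pull_pull hΨ hφ measurePreserving_snd fun z => (h1 z).symm,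
    pull_pull hΨ measurePreserving_snd hφ fun z => (h2 z).symm, real_inner_comm]

end Averages

/-! ### Cylinder functions on Gaussian product spaces -/

section Cylinder

set_option linter.unusedSectionVars false

variable {ι κ α β : Type} [Fintype ι] [Fintype κ] [Fintype α] [Fintype β]

/-- The Maxwellian of a system of particles labelled by `ι`. -/
abbrev gauss (ι : Type) [Fintype ι] : Measure (ι → ℝ) := Measure.pi fun _ => maxwellian

/-- The one-component Hilbert space `L²(γ_ι)`. -/
abbrev X (ι : Type) [Fintype ι] : Type := Lp ℝ 2 (gauss ι)

theorem measurePreserving_comp {e : α → ι} (he : Function.Injective e) :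
    MeasurePreserving (fun (v : ι → ℝ) (j : α) => v (e j)) (gauss ι) (gauss α) := by
  classical
  have hm : Measurable fun (v : ι → ℝ) (j : α) => v (e j) := by fun_prop
  refine ⟨hm, (Measure.pi_eq fun s hs => ?_).symm⟩
  rw [Measure.map_apply hm (MeasurableSet.univ_pi hs)]
  -- The fibre of `e` over `k` has at most one element, so the intersection is either one factor of
  -- the box or the whole line; this avoids an inverse of `e`.
  have h1 : (fun (v : ι → ℝ) (j : α) => v (e j)) ⁻¹' Set.univ.pi s
      = Set.univ.pi fun k : ι => ⋂ j : {j : α // e j = k}, s j := by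
    ext v
    simp only [Set.mem_preimage, Set.mem_pi, Set.mem_univ, true_imp_iff, Set.mem_iInter]
    exact ⟨fun h k j => by obtain ⟨j, rfl⟩ := j; exact h j, fun h j => h (e j) ⟨j, rfl⟩⟩
  rw [h1, Measure.pi_pi]
  have h2 : ∀ j, maxwellian (⋂ j' : {j' : α // e j' = e j}, s j') = maxwellian (s j) := by
    intro j
    congr 1
    ext x
    simp only [Set.mem_iInter, Subtype.forall]
    exact ⟨fun h => h j rfl, fun h j' hj' => he hj' ▸ h⟩
  rw [← Finset.prod_subset (Finset.subset_univ (Finset.univ.image e)),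
    Finset.prod_image he.injOn]
  · exact Finset.prod_congr rfl fun j _ => h2 j
  · intro k _ hk
    have : IsEmpty {j : α // e j = k} :=
      ⟨fun j => hk (Finset.mem_image.2 ⟨j.1, Finset.mem_univ _, j.2⟩)⟩
    rw [Set.iInter_of_empty, measure_univ]

theorem measurable_extend {e : α → ι} (he : Function.Injective e) :
    Measurable fun z : (ι → ℝ) × (α → ℝ) => Function.extend e z.2 z.1 := by
  refine measurable_pi_iff.2 fun k => ?_
  by_cases hk : ∃ j, e j = k
  · obtain ⟨j, rfl⟩ := hk
    simp only [he.extend_apply]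
    fun_prop
  · simp only [Function.extend_apply' _ _ _ hk]
    fun_prop

/-- Overwriting the coordinates in the range of `e` by fresh independent velocities does not change
the law. This is the resampling map that expresses the adjoint of `lift` as an integral. -/
theorem measurePreserving_extend {e : α → ι} (he : Function.Injective e) :
    MeasurePreserving (fun z : (ι → ℝ) × (α → ℝ) => Function.extend e z.2 z.1)
      ((gauss ι).prod (gauss α)) (gauss ι) := by
  classical
  refine ⟨measurable_extend he, (Measure.pi_eq fun s hs => ?_).symm⟩
  rw [Measure.map_apply (measurable_extend he) (MeasurableSet.univ_pi hs)]
  have h1 : (fun z : (ι → ℝ) × (α → ℝ) => Function.extend e z.2 z.1) ⁻¹' Set.univ.pi s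
      = (Set.univ.pi fun k : ι => if ∃ j, e j = k then Set.univ else s k)
        ×ˢ (Set.univ.pi fun j : α => s (e j)) := by
    ext ⟨w, u⟩
    simp only [Set.mem_preimage, Set.mem_pi, Set.mem_univ, true_imp_iff, Set.mem_prod]
    refine ⟨fun h => ⟨fun k => ?_, fun j => ?_⟩, fun h k => ?_⟩
    · split_ifs with hk
      · trivial
      · simpa [Function.extend_apply' _ _ _ hk] using h k
    · simpa [he.extend_apply] using h (e j)
    · by_cases hk : ∃ j, e j = k
      · obtain ⟨j, rfl⟩ := hk
        simpa [he.extend_apply] using h.2 j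
      · simpa [Function.extend_apply' _ _ _ hk, hk] using h.1 k
  rw [h1, Measure.prod_prod, Measure.pi_pi, Measure.pi_pi]
  have h2 : ∏ j, maxwellian (s (e j)) = ∏ k ∈ Finset.univ.image e, maxwellian (s k) := by
    rw [Finset.prod_image he.injOn]
  have h3 : (∏ k, maxwellian (if ∃ j, e j = k then Set.univ else s k))
      = ∏ k ∈ (Finset.univ.image e)ᶜ, maxwellian (s k) := by
    rw [← Finset.prod_subset (Finset.subset_univ (Finset.univ.image e)ᶜ)]
    · refine Finset.prod_congr rfl fun k hk => ?_
      rw [if_neg]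
      simpa using hk
    · intro k _ hk
      rw [if_pos (by simpa using hk), measure_univ]
  rw [h2, h3, mul_comm, Finset.prod_mul_prod_compl]

/-- `f ↦ f ∘ (v ↦ v ∘ e)` for an injection `e` of labels. -/
def lift {e : α → ι} (he : Function.Injective e) : X α →L[ℝ] X ι :=
  pull (measurePreserving_comp he)

theorem coeFn_lift {e : α → ι} (he : Function.Injective e) (f : X α) :
    lift he f =ᵐ[gauss ι] fun v => f fun j => v (e j) :=
  coeFn_pull _ f

theorem inner_lift_lift {e : α → ι} (he : Function.Injective e) (f g : X α) :
    ⟪lift he f, lift he g⟫ = ⟪f, g⟫ :=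
  inner_pull_pull _ f g

theorem norm_lift {e : α → ι} (he : Function.Injective e) (f : X α) : ‖lift he f‖ = ‖f‖ :=
  norm_pull _ f

theorem lift_lift {e : α → ι} (he : Function.Injective e) {e' : β → α}
    (he' : Function.Injective e') {e'' : β → ι} (he'' : Function.Injective e'')
    (h : ∀ j, e'' j = e (e' j)) (f : X β) : lift he (lift he' f) = lift he'' f :=
  pull_pull _ _ _ (fun v => by simp only [h]) f

theorem adjoint_lift_lift_self {e : α → ι} (he : Function.Injective e) (f : X α) :
    (lift he).adjoint (lift he f) = f := by
  refine ext_inner_right ℝ fun g => ?_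
  rw [ContinuousLinearMap.adjoint_inner_left, inner_lift_lift]

theorem adjoint_lift_adjoint_lift {e : α → ι} (he : Function.Injective e) {e' : β → α}
    (he' : Function.Injective e') {e'' : β → ι} (he'' : Function.Injective e'')
    (h : ∀ j, e'' j = e (e' j)) (f : X ι) :
    (lift he').adjoint ((lift he).adjoint f) = (lift he'').adjoint f := by
  refine ext_inner_right ℝ fun g => ?_
  rw [ContinuousLinearMap.adjoint_inner_left, ContinuousLinearMap.adjoint_inner_left,
    ContinuousLinearMap.adjoint_inner_left, lift_lift he he' he'' h]

theorem norm_adjoint_lift_le {e : α → ι} (he : Function.Injective e) (f : X ι) :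
    ‖(lift he).adjoint f‖ ≤ ‖f‖ := by
  have h : ‖lift he‖ ≤ 1 :=
    ContinuousLinearMap.opNorm_le_bound _ zero_le_one fun g => by rw [norm_lift, one_mul]
  calc ‖(lift he).adjoint f‖ ≤ ‖(lift he).adjoint‖ * ‖f‖ := ContinuousLinearMap.le_opNorm _ _
    _ ≤ 1 * ‖f‖ := by
      gcongr
      rwa [LinearIsometryEquiv.norm_map]
    _ = ‖f‖ := one_mul _

theorem coeFn_adjoint_lift {e : α → ι} (he : Function.Injective e) (f : X ι) :
    (lift he).adjoint f
      =ᵐ[gauss α] fun u => ∫ w : ι → ℝ, f (Function.extend e u w) ∂gauss ι := by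
  rw [lift, adjoint_pull_eq_avg (measurePreserving_extend he) (measurePreserving_comp he)
    fun w u => by funext j; exact he.extend_apply _ _ _]
  exact coeFn_avg _ f

theorem coeFn_adjoint_lift_of_ae {e : α → ι} (he : Function.Injective e) (f : X ι)
    {f' : (ι → ℝ) → ℝ} (hf : f =ᵐ[gauss ι] f') :
    (lift he).adjoint f
      =ᵐ[gauss α] fun u => ∫ w : ι → ℝ, f' (Function.extend e u w) ∂gauss ι := by
  rw [lift, adjoint_pull_eq_avg (measurePreserving_extend he) (measurePreserving_comp he)
    fun w u => by funext j; exact he.extend_apply _ _ _]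
  exact coeFn_avg_of_ae _ f hf

/-- For a pullback square of injections of labels, integrating out and lifting commute. -/
theorem adjoint_lift_lift {e : α → ι} (he : Function.Injective e) {e' : β → ι}
    (he' : Function.Injective e') {a : κ → α} (ha : Function.Injective a) {b : κ → β}
    (hb : Function.Injective b) (hab : ∀ k, e (a k) = e' (b k))
    (hpull : ∀ i j, e i = e' j → ∃ k, b k = j) (f : X β) :
    (lift he).adjoint (lift he' f) = lift ha ((lift hb).adjoint f) := by
  refine Lp.ext ?_
  have h1 := coeFn_adjoint_lift_of_ae he _ (coeFn_lift he' f)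
  have h2 := ae_of_pull (measurePreserving_comp ha) (coeFn_adjoint_lift hb f)
  filter_upwards [h1, h2, coeFn_lift ha ((lift hb).adjoint f)] with u h1 h2 h3
  rw [h1, h3, h2]
  -- By `hpull`, the labels of β whose coordinates get overwritten are exactly those that come from
  -- κ; all others still read the integration variable.
  have h4 : ∀ w : ι → ℝ, (fun j => Function.extend e u w (e' j))
      = Function.extend b (fun k => u (a k)) fun j => w (e' j) := by
    intro w
    funext j
    by_cases hj : ∃ k, b k = j
    · obtain ⟨k, rfl⟩ := hj
      rw [hb.extend_apply, ← hab, he.extend_apply]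
    · rw [Function.extend_apply' _ _ _ hj, Function.extend_apply']
      rintro ⟨i, hi⟩
      exact hj (hpull i j hi)
  simp only [h4]
  refine integral_pull (measurePreserving_comp he') (f := fun w : β → ℝ =>
    f (Function.extend b (fun k => u (a k)) w)) ?_
  have hm : Measurable fun w : β → ℝ => Function.extend b (fun k => u (a k)) w :=
    (measurable_extend hb).comp
      (measurable_id.prodMk (measurable_const (a := fun k => u (a k))))
  exact ((Lp.stronglyMeasurable f).comp_measurable hm).aestronglyMeasurable

/-! ### The projections that integrate out a set of particles -/

/-- The projection onto the functions of `v ∘ e`. -/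
def cyl {e : α → ι} (he : Function.Injective e) : X ι →L[ℝ] X ι := lift he ∘L (lift he).adjoint

theorem cyl_apply {e : α → ι} (he : Function.Injective e) (f : X ι) :
    cyl he f = lift he ((lift he).adjoint f) := rfl

theorem inner_cyl_left {e : α → ι} (he : Function.Injective e) (f g : X ι) :
    ⟪cyl he f, g⟫ = ⟪f, cyl he g⟫ := by
  rw [cyl_apply, cyl_apply, ← ContinuousLinearMap.adjoint_inner_left,
    ← ContinuousLinearMap.adjoint_inner_right]

theorem cyl_cyl {e : α → ι} (he : Function.Injective e) {e' : β → ι}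
    (he' : Function.Injective e') {a : κ → α} (ha : Function.Injective a) {b : κ → β}
    (hb : Function.Injective b) (hab : ∀ k, e (a k) = e' (b k))
    (hpull : ∀ i j, e i = e' j → ∃ k, b k = j) {c : κ → ι} (hc : Function.Injective c)
    (hca : ∀ k, c k = e (a k)) (f : X ι) : cyl he (cyl he' f) = cyl hc f := by
  rw [cyl_apply, cyl_apply, cyl_apply, adjoint_lift_lift he he' ha hb hab hpull,
    lift_lift he ha hc hca, adjoint_lift_adjoint_lift he' hb hc fun k => by rw [hca, hab]]

/-- Each label set factors through the other, so `cyl_cyl` evaluates the product of the two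
projections once as the first and once as the second. -/
theorem cyl_eq_of_range {e : α → ι} (he : Function.Injective e) {e' : β → ι}
    (he' : Function.Injective e') (h : Set.range e = Set.range e') : cyl he = cyl he' := by
  have h1 : ∀ i, ∃ j, e' j = e i := fun i => by
    rw [← Set.mem_range, ← h]; exact Set.mem_range_self i
  have h2 : ∀ j, ∃ i, e i = e' j := fun j => by
    rw [← Set.mem_range, h]; exact Set.mem_range_self j
  choose b hb using h1
  choose a ha using h2
  have hbi : Function.Injective b := fun i j hij => he (by rw [← hb, ← hb, hij])
  have hai : Function.Injective a := fun i j hij => he' (by rw [← ha, ← ha, hij])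
  ext1 f
  rw [← cyl_cyl he' he hbi Function.injective_id hb (fun _ j _ => ⟨j, rfl⟩) he
    (fun k => (hb k).symm) f]
  exact cyl_cyl he' he Function.injective_id hai (fun k => (ha k).symm)
    (fun i j hij => ⟨i, he (by rw [ha, hij])⟩) he' (fun _ => rfl) f

end Cylinder

/-! ### Commuting projections -/

section Projections

variable {ι H : Type*} [DecidableEq ι] [NormedAddCommGroup H] [InnerProductSpace ℝ H]
  {E : Finset ι → H →L[ℝ] H}

theorem norm_sq_add_of_proj (hE : ∀ s t x, E s (E t x) = E (s ∪ t) x)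
    (hs : ∀ s x y, ⟪E s x, y⟫ = ⟪x, E s y⟫) (s : Finset ι) (x : H) :
    ‖x‖ ^ 2 = ‖E s x‖ ^ 2 + ‖x - E s x‖ ^ 2 := by
  have h : ⟪E s x, x - E s x⟫ = 0 := by
    rw [hs, map_sub, hE, Finset.union_self, sub_self, inner_zero_right]
  have h2 := norm_add_sq_real (E s x) (x - E s x)
  rw [add_sub_cancel, h] at h2
  linarith

/-- The projections commute, so `E t` splits `x - E s x` orthogonally. The inductions below run on
this splitting. -/
theorem norm_sub_proj_sq (hE : ∀ s t x, E s (E t x) = E (s ∪ t) x)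
    (hs : ∀ s x y, ⟪E s x, y⟫ = ⟪x, E s y⟫) (s t : Finset ι) (x : H) :
    ‖x - E s x‖ ^ 2 = ‖E t x - E s (E t x)‖ ^ 2
      + ‖(x - E t x) - E s (x - E t x)‖ ^ 2 := by
  rw [norm_sq_add_of_proj hE hs t (x - E s x)]
  have h1 : E t (x - E s x) = E t x - E s (E t x) := by
    rw [map_sub, hE, hE, Finset.union_comm]
  rw [h1, map_sub]
  congr 3
  abel

/-- An Efron-Stein inequality. Think of x as a sum of orthogonal pieces x_A, with x_A killed by `E
s` when A meets s and fixed otherwise. The sum on the right counts x_A with weight |A ∩ s|, and the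
pieces with |A ∩ s| = 0 are supplied by `E s x`. -/
theorem norm_sub_proj_sq_le_sum (hE : ∀ s t x, E s (E t x) = E (s ∪ t) x)
    (hs : ∀ s x y, ⟪E s x, y⟫ = ⟪x, E s y⟫) (h0 : ∀ x, E ∅ x = x) (s : Finset ι) (x : H) :
    ‖x‖ ^ 2 ≤ ‖E s x‖ ^ 2 + ∑ i ∈ s, ‖x - E {i} x‖ ^ 2 := by
  induction s using Finset.induction_on generalizing x with
  | empty => simp [h0]
  | insert j s hj ih =>
    have h1 := ih (E {j} x)
    have h2 := norm_sq_add_of_proj hE hs {j} x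
    have h3 : ∑ i ∈ s, ‖x - E {i} x‖ ^ 2 ≥ ∑ i ∈ s, ‖E {j} x - E {i} (E {j} x)‖ ^ 2 :=
      Finset.sum_le_sum fun i _ => by
        rw [norm_sub_proj_sq hE hs {i} {j} x]
        have := sq_nonneg ‖(x - E {j} x) - E {i} (x - E {j} x)‖
        linarith
    rw [Finset.sum_insert hj, Finset.insert_eq, Finset.union_comm, ← hE]
    linarith

/-- The second-order version. In the same picture the middle sum is the mass of the pieces with |A ∩
s| = 1. A piece with |A ∩ s| = 0, 1 or k ≥ 2 is thus counted 2, 1 + 1 or k times, always at least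
twice. -/
theorem two_mul_norm_sq_le_sum (hE : ∀ s t x, E s (E t x) = E (s ∪ t) x)
    (hs : ∀ s x y, ⟪E s x, y⟫ = ⟪x, E s y⟫) (h0 : ∀ x, E ∅ x = x) (s : Finset ι) (x : H) :
    2 * ‖x‖ ^ 2 ≤ 2 * ‖E s x‖ ^ 2 + ∑ i ∈ s, ‖E (s.erase i) x - E s x‖ ^ 2
      + ∑ i ∈ s, ‖x - E {i} x‖ ^ 2 := by
  induction s using Finset.induction_on generalizing x with
  | empty => simp [h0]
  | insert j s hj ih =>
    have h1 := ih (E {j} x)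
    have h2 := norm_sq_add_of_proj hE hs {j} x
    -- All pieces of `x - E {j} x` contain the label `j` and are counted once for it, so one further
    -- count from the first-order inequality suffices.
    have h3 := norm_sub_proj_sq_le_sum hE hs h0 s (x - E {j} x)
    have h4 : ∑ i ∈ s, ‖x - E {i} x‖ ^ 2 = ∑ i ∈ s, ‖E {j} x - E {i} (E {j} x)‖ ^ 2
        + ∑ i ∈ s, ‖(x - E {j} x) - E {i} (x - E {j} x)‖ ^ 2 := by
      rw [← Finset.sum_add_distrib]
      exact Finset.sum_congr rfl fun i _ => norm_sub_proj_sq hE hs {i} {j} x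
    have h5 : E (insert j s) x = E s (E {j} x) := by
      rw [hE, Finset.insert_eq, Finset.union_comm]
    have h6 : ∑ i ∈ s, ‖E ((insert j s).erase i) x - E (insert j s) x‖ ^ 2
        = ∑ i ∈ s, ‖E (s.erase i) (E {j} x) - E s (E {j} x)‖ ^ 2 := by
      refine Finset.sum_congr rfl fun i hi => ?_
      have : j ≠ i := fun h => hj (h ▸ hi)
      rw [h5, Finset.erase_insert_of_ne this, Finset.insert_eq, Finset.union_comm, ← hE]
    have h7 : E s (x - E {j} x) = E s x - E s (E {j} x) := map_sub _ _ _
    rw [Finset.sum_insert hj, Finset.sum_insert hj, h6, h5, Finset.erase_insert hj, ← h7]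
    linarith

/-- Bessel's inequality for the pieces that involve no label or exactly one label of `s`. -/
theorem sum_norm_sq_le_norm_sq (hE : ∀ s t x, E s (E t x) = E (s ∪ t) x)
    (hs : ∀ s x y, ⟪E s x, y⟫ = ⟪x, E s y⟫) (h0 : ∀ x, E ∅ x = x) (s : Finset ι) (x : H) :
    ‖E s x‖ ^ 2 + ∑ i ∈ s, ‖E (s.erase i) x - E s x‖ ^ 2 ≤ ‖x‖ ^ 2 := by
  induction s using Finset.induction_on generalizing x with
  | empty => simp [h0]
  | insert j s hj ih =>
    have h1 := ih (E {j} x)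
    have h2 := norm_sq_add_of_proj hE hs {j} x
    have h3 := norm_sq_add_of_proj hE hs s (x - E {j} x)
    have h5 : E (insert j s) x = E s (E {j} x) := by
      rw [hE, Finset.insert_eq, Finset.union_comm]
    have h6 : ∑ i ∈ s, ‖E ((insert j s).erase i) x - E (insert j s) x‖ ^ 2
        = ∑ i ∈ s, ‖E (s.erase i) (E {j} x) - E s (E {j} x)‖ ^ 2 := by
      refine Finset.sum_congr rfl fun i hi => ?_
      have : j ≠ i := fun h => hj (h ▸ hi)
      rw [h5, Finset.erase_insert_of_ne this, Finset.insert_eq, Finset.union_comm, ← hE]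
    have h7 : E s (x - E {j} x) = E s x - E s (E {j} x) := map_sub _ _ _
    rw [Finset.sum_insert hj, h6, h5, Finset.erase_insert hj, ← h7]
    have := sq_nonneg ‖(x - E {j} x) - E s (x - E {j} x)‖
    linarith

end Projections

/-! ### Poincaré inequalities for truncated Poisson weights -/

section Poisson

variable {H : Type*} [NormedAddCommGroup H] [InnerProductSpace ℝ H]
  {a : ℕ → ℝ} {t : ℝ}

/-- The partial means of a sequence, divided by the weights. -/
def partialMean (a : ℕ → ℝ) (g : ℕ → H) (n : ℕ) : H :=
  (a n)⁻¹ • ∑ k ∈ Finset.range (n + 1), a k • g k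

theorem smul_partialMean (ha : ∀ n, 0 < a n) (g : ℕ → H) (n : ℕ) :
    a n • partialMean a g n = ∑ k ∈ Finset.range (n + 1), a k • g k := by
  rw [partialMean, smul_smul, mul_inv_cancel₀ (ha n).ne', one_smul]

/-- For Poisson weights this says that g = -D*G, where G are the partial means and D* is the adjoint
of the forward difference D in the weighted ℓ². -/
theorem eq_partialMean_sub (ha : ∀ n, 0 < a n) (ht : 0 < t)
    (hrec : ∀ n : ℕ, a (n + 1) * (n + 1) = t * a n) (g : ℕ → H) (n : ℕ) :
    g (n + 1) = partialMean a g (n + 1) - (((n : ℝ) + 1) / t) • partialMean a g n := by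
  have h1 : ((n : ℝ) + 1) / t = (a (n + 1))⁻¹ * a n := by
    have h2 := hrec n
    have h3 := (ha (n + 1)).ne'
    field_simp
    linarith
  rw [h1, mul_smul, smul_partialMean ha, partialMean, ← smul_sub, Finset.sum_range_succ _ (n + 1),
    add_sub_cancel_left, smul_smul, inv_mul_cancel₀ (ha (n + 1)).ne', one_smul]

/-- The commutation relation DD* - D*D = 1/t gives ‖D*G‖² = ‖DG‖² + ‖G‖²/t. The last term is the
price of cutting at n; it disappears when the mean of g up to n vanishes. -/
theorem sum_norm_sq_eq_partialMean (ha : ∀ n, 0 < a n) (ht : 0 < t)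
    (hrec : ∀ n : ℕ, a (n + 1) * (n + 1) = t * a n) (g : ℕ → H) (n : ℕ) :
    ∑ k ∈ Finset.range (n + 1), a k * ‖g k‖ ^ 2
      = t⁻¹ * ∑ k ∈ Finset.range n, a k * ‖partialMean a g k‖ ^ 2
        + ∑ k ∈ Finset.range n, a k * ‖partialMean a g (k + 1) - partialMean a g k‖ ^ 2
        + a n * (1 - n / t) * ‖partialMean a g n‖ ^ 2 := by
  induction n with
  | zero => simp [partialMean, smul_smul, inv_mul_cancel₀ (ha 0).ne']
  | succ n ih =>
    rw [Finset.sum_range_succ, ih, Finset.sum_range_succ _ n, Finset.sum_range_succ _ n,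
      eq_partialMean_sub ha ht hrec g n, norm_sub_sq_real, norm_sub_sq_real, norm_smul,
      inner_smul_right, Real.norm_eq_abs, mul_pow, sq_abs]
    have h1 : a n = a (n + 1) * (n + 1) / t := by
      rw [hrec]; field_simp
    push_cast
    rw [h1]
    field_simp
    ring

/-- Summation by parts, the partial means being the weighted primitive of g. -/
theorem sum_norm_sq_eq_inner_partialMean (ha : ∀ n, 0 < a n) (g : ℕ → H) (n : ℕ) :
    ∑ k ∈ Finset.range (n + 1), a k * ‖g k‖ ^ 2
      = a n * ⟪g n, partialMean a g n⟫
        - ∑ k ∈ Finset.range n, a k * ⟪g (k + 1) - g k, partialMean a g k⟫ := by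
  induction n with
  | zero =>
    simp [partialMean, smul_smul, inv_mul_cancel₀ (ha 0).ne']
  | succ n ih =>
    rw [Finset.sum_range_succ, ih, Finset.sum_range_succ _ n]
    have h1 : a (n + 1) * ⟪g (n + 1), partialMean a g (n + 1)⟫
        = a n * ⟪g (n + 1), partialMean a g n⟫ + a (n + 1) * ‖g (n + 1)‖ ^ 2 := by
      rw [← inner_smul_right, smul_partialMean ha, Finset.sum_range_succ, inner_add_right,
        ← smul_partialMean ha, inner_smul_right, inner_smul_right, real_inner_self_eq_norm_sq]
    rw [h1, inner_sub_left]
    ring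

theorem two_mul_abs_inner_le {c : ℝ} (hc : 0 < c) (x y : H) :
    2 * |⟪x, y⟫| ≤ c * ‖x‖ ^ 2 + c⁻¹ * ‖y‖ ^ 2 := by
  have h1 := abs_real_inner_le_norm x y
  have h2 : 2 * (‖x‖ * ‖y‖) ≤ c * ‖x‖ ^ 2 + c⁻¹ * ‖y‖ ^ 2 := by
    have h3 := mul_nonneg (inv_pos.2 hc).le (sq_nonneg (c * ‖x‖ - ‖y‖))
    have h4 : c⁻¹ * (c * ‖x‖ - ‖y‖) ^ 2 = c * ‖x‖ ^ 2 + c⁻¹ * ‖y‖ ^ 2 - 2 * (‖x‖ * ‖y‖) := by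
      field_simp
      ring
    linarith
  linarith

theorem sum_norm_sq_le_half (ha : ∀ n, 0 < a n) {c : ℝ} (hc : 0 < c) (g : ℕ → H) (n : ℕ)
    (h0 : ∑ k ∈ Finset.range (n + 1), a k • g k = 0) :
    2 * ∑ k ∈ Finset.range (n + 1), a k * ‖g k‖ ^ 2
      ≤ c * ∑ k ∈ Finset.range n, a k * ‖g (k + 1) - g k‖ ^ 2
        + c⁻¹ * ∑ k ∈ Finset.range n, a k * ‖partialMean a g k‖ ^ 2 := by
  have hn : partialMean a g n = 0 := by rw [partialMean, h0, smul_zero]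
  rw [sum_norm_sq_eq_inner_partialMean ha, hn, inner_zero_right, mul_zero, zero_sub,
    ← Finset.sum_neg_distrib, Finset.mul_sum, Finset.mul_sum, Finset.mul_sum,
    ← Finset.sum_add_distrib]
  refine Finset.sum_le_sum fun k _ => ?_
  have h1 := two_mul_abs_inner_le hc (g (k + 1) - g k) (partialMean a g k)
  have h2 := neg_abs_le ⟪g (k + 1) - g k, partialMean a g k⟫
  have h3 := mul_le_mul_of_nonneg_left
    (show -(2 * ⟪g (k + 1) - g k, partialMean a g k⟫)
      ≤ c * ‖g (k + 1) - g k‖ ^ 2 + c⁻¹ * ‖partialMean a g k‖ ^ 2 by linarith) (ha k).le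
  linarith

/-- With ‖·‖ the weighted norm, summation by parts gives 2‖g‖² ≤ t‖Dg‖² + ‖G‖²/t, and the
commutation identity gives ‖G‖²/t ≤ ‖g‖². -/
theorem poincare_truncated (ha : ∀ n, 0 < a n) (ht : 0 < t)
    (hrec : ∀ n : ℕ, a (n + 1) * (n + 1) = t * a n) (g : ℕ → H) (n : ℕ)
    (h0 : ∑ k ∈ Finset.range (n + 1), a k • g k = 0) :
    ∑ k ∈ Finset.range (n + 1), a k * ‖g k‖ ^ 2
      ≤ t * ∑ k ∈ Finset.range n, a k * ‖g (k + 1) - g k‖ ^ 2 := by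
  have hn : partialMean a g n = 0 := by rw [partialMean, h0, smul_zero]
  have h1 := sum_norm_sq_eq_partialMean ha ht hrec g n
  have h2 := sum_norm_sq_le_half ha ht g n h0
  have h3 : 0 ≤ ∑ k ∈ Finset.range n, a k * ‖partialMean a g (k + 1) - partialMean a g k‖ ^ 2 :=
    Finset.sum_nonneg fun k _ => mul_nonneg (ha k).le (sq_nonneg _)
  simp only [hn, norm_zero] at h1
  linarith

/-- The term of index k occurs in n - k partial means. The vanishing of the mean and of the first
moment of g thus makes G itself centred. -/
theorem sum_smul_partialMean (ha : ∀ n, 0 < a n) (g : ℕ → H) (n : ℕ) :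
    ∑ k ∈ Finset.range n, a k • partialMean a g k
      = ∑ k ∈ Finset.range n, ((n : ℝ) - k) • a k • g k := by
  induction n with
  | zero => simp
  | succ n ih =>
    rw [Finset.sum_range_succ, ih, smul_partialMean ha, Finset.sum_range_succ,
      Finset.sum_range_succ, ← add_assoc, ← Finset.sum_add_distrib]
    congr 1
    · refine Finset.sum_congr rfl fun k _ => ?_
      push_cast
      module
    · push_cast
      module

/-- Now G is centred too, so the Poincaré inequality bounds ‖DG‖² below by ‖G‖²/t. The commutation
identity then improves to 2‖G‖²/t ≤ ‖g‖². -/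
theorem second_poincare_truncated (ha : ∀ n, 0 < a n) (ht : 0 < t)
    (hrec : ∀ n : ℕ, a (n + 1) * (n + 1) = t * a n) (g : ℕ → H) (n : ℕ)
    (h0 : ∑ k ∈ Finset.range (n + 1), a k • g k = 0)
    (h1 : ∑ k ∈ Finset.range (n + 1), (k : ℝ) • a k • g k = 0) :
    2 * ∑ k ∈ Finset.range (n + 1), a k * ‖g k‖ ^ 2
      ≤ t * ∑ k ∈ Finset.range n, a k * ‖g (k + 1) - g k‖ ^ 2 := by
  have hn : partialMean a g n = 0 := by rw [partialMean, h0, smul_zero]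
  have h2 : ∑ k ∈ Finset.range (n + 1), a k • partialMean a g k = 0 := by
    have h3 : ∑ k ∈ Finset.range (n + 1), (((n : ℝ) - k) • a k • g k) = 0 := by
      simp only [sub_smul, Finset.sum_sub_distrib, ← Finset.smul_sum, h0, h1, smul_zero, sub_zero]
    rw [Finset.sum_range_succ, sub_self, zero_smul, add_zero] at h3
    rw [Finset.sum_range_succ, hn, smul_zero, add_zero, sum_smul_partialMean ha, h3]
  have h3 := poincare_truncated ha ht hrec (partialMean a g) n h2
  have h4 := sum_norm_sq_eq_partialMean ha ht hrec g n
  -- The parameter t/2 makes the coefficient of ‖G‖² equal to 2/t, the amount that the improved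
  -- identity can absorb into one copy of ‖g‖².
  have h5 := sum_norm_sq_le_half ha (half_pos ht) g n h0
  rw [Finset.sum_range_succ, hn] at h3
  simp only [hn, norm_zero] at h3 h4
  have h6 : (t / 2)⁻¹ * ∑ k ∈ Finset.range n, a k * ‖partialMean a g k‖ ^ 2
      ≤ ∑ k ∈ Finset.range (n + 1), a k * ‖g k‖ ^ 2 := by
    have h7 : t⁻¹ * ∑ k ∈ Finset.range n, a k * ‖partialMean a g k‖ ^ 2
        ≤ ∑ k ∈ Finset.range n, a k * ‖partialMean a g (k + 1) - partialMean a g k‖ ^ 2 := by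
      rw [inv_mul_le_iff₀ ht]
      linarith
    rw [inv_div, div_eq_mul_inv, mul_assoc]
    linarith
  linarith

end Poisson

/-! ### Rotations -/

section Rotations

variable {N : ℕ} {i j : Fin N}

theorem rotate_left (hij : i ≠ j) (θ : ℝ) (v : Fin N → ℝ) :
    rotate i j θ v i = v i * Real.cos θ - v j * Real.sin θ := by
  rw [rotate, Function.update_of_ne hij, Function.update_self]

theorem rotate_right (θ : ℝ) (v : Fin N → ℝ) :
    rotate i j θ v j = v i * Real.sin θ + v j * Real.cos θ := by
  rw [rotate, Function.update_self]

theorem rotate_of_ne {k : Fin N} (hi : k ≠ i) (hj : k ≠ j) (θ : ℝ) (v : Fin N → ℝ) :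
    rotate i j θ v k = v k := by
  rw [rotate, Function.update_of_ne hj, Function.update_of_ne hi]

theorem rotate_rotate (hij : i ≠ j) (θ φ : ℝ) (v : Fin N → ℝ) :
    rotate i j φ (rotate i j θ v) = rotate i j (θ + φ) v := by
  funext k
  by_cases hi : k = i
  · subst hi
    rw [rotate_left hij, rotate_left hij, rotate_left hij, rotate_right, Real.cos_add,
      Real.sin_add]
    ring
  by_cases hj : k = j
  · subst hj
    rw [rotate_right, rotate_right, rotate_left hij, rotate_right, Real.cos_add, Real.sin_add]
    ring
  · simp only [rotate_of_ne hi hj]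

theorem rotate_two_pi (hij : i ≠ j) (v : Fin N → ℝ) : rotate i j (2 * Real.pi) v = v := by
  funext k
  by_cases hi : k = i
  · subst hi; simp [rotate_left hij]
  by_cases hj : k = j
  · subst hj; simp [rotate_right]
  · exact rotate_of_ne hi hj _ _

theorem sum_rotate {M : Type*} [AddCommGroup M] (hij : i ≠ j) (F : Fin N → ℝ → M) (θ : ℝ)
    (v : Fin N → ℝ) :
    ∑ k, F k (rotate i j θ v k) = ∑ k, F k (v k)
      + ((F i (v i * Real.cos θ - v j * Real.sin θ) - F i (v i))
        + (F j (v i * Real.sin θ + v j * Real.cos θ) - F j (v j))) := by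
  rw [← sub_eq_iff_eq_add', ← Finset.sum_sub_distrib,
    ← Finset.sum_subset (Finset.subset_univ {i, j}), Finset.sum_pair hij, rotate_left hij,
    rotate_right]
  intro k _ hk
  rw [Finset.mem_insert, Finset.mem_singleton, not_or] at hk
  rw [rotate_of_ne hk.1 hk.2, sub_self]

theorem measurable_rotate (i j : Fin N) :
    Measurable fun z : ℝ × (Fin N → ℝ) => rotate i j z.1 z.2 := by
  unfold rotate
  refine measurable_pi_iff.2 fun k => ?_
  by_cases hj : k = j
  · subst hj
    simp only [Function.update_self]
    fun_prop
  · by_cases hi : k = i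
    · subst hi
      simp only [Function.update_of_ne hj, Function.update_self]
      fun_prop
    · simp only [Function.update_of_ne hj, Function.update_of_ne hi]
      fun_prop

theorem charFun_gauss (t : EuclideanSpace ℝ (Fin N)) :
    charFun ((gauss (Fin N)).map (WithLp.toLp 2)) t
      = Complex.exp (-(((1 / (2 * Real.pi)).toNNReal : ℝ) * (∑ k, t k ^ 2) / 2 : ℝ)) := by
  rw [charFun_pi]
  simp only [maxwellian_eq, ProbabilityTheory.charFun_gaussianReal]
  rw [← Complex.exp_sum]
  congr 1
  push_cast
  rw [Finset.mul_sum, Finset.sum_div, ← Finset.sum_neg_distrib]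
  exact Finset.sum_congr rfl fun k _ => by ring

/-- The characteristic function of the Gaussian depends only on the Euclidean length of its
argument, and a rotation by θ of the variable is a rotation by -θ of the argument. -/
theorem measurePreserving_rotate (hij : i ≠ j) (θ : ℝ) :
    MeasurePreserving (rotate i j θ) (gauss (Fin N)) (gauss (Fin N)) := by
  have hm : Measurable (rotate i j θ) :=
    (measurable_rotate i j).comp (measurable_const.prodMk measurable_id)
  refine ⟨hm, ?_⟩
  have : IsProbabilityMeasure ((gauss (Fin N)).map (rotate i j θ)) :=
    Measure.isProbabilityMeasure_map hm.aemeasurable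
  refine (charFun_eq_pi_iff).1 fun t => ?_
  have h1 : ∏ k, charFun maxwellian (t k)
      = charFun ((gauss (Fin N)).map (WithLp.toLp 2)) t := by rw [charFun_pi]
  have h2 : charFun (((gauss (Fin N)).map (rotate i j θ)).map (WithLp.toLp 2)) t
      = charFun ((gauss (Fin N)).map (WithLp.toLp 2))
        (WithLp.toLp 2 (rotate i j (-θ) t.ofLp)) := by
    rw [charFun_apply, charFun_apply, integral_map (by fun_prop) (by fun_prop),
      integral_map hm.aemeasurable (by fun_prop),
      integral_map (μ := gauss (Fin N)) (by fun_prop) (by fun_prop)]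
    congr 1
    funext v
    congr 3
    simp only [PiLp.inner_apply, RCLike.inner_apply, conj_trivial]
    have h3 := sum_rotate hij (fun k x => t k * x) θ v
    have h4 := sum_rotate hij (fun k x => x * v k) (-θ) t.ofLp
    rw [h3, h4]
    simp only [Real.cos_neg, Real.sin_neg]
    ring
  rw [h1, h2, charFun_gauss, charFun_gauss]
  have h5 := sum_rotate hij (fun _ x => x ^ 2) (-θ) t.ofLp
  simp only at h5 ⊢
  rw [h5]
  congr 5
  simp only [Real.cos_neg, Real.sin_neg]
  have := Real.sin_sq_add_cos_sq θ
  linear_combination (t i ^ 2 + t j ^ 2) * this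

/-- The uniform distribution on the angles. -/
def angle : Measure ℝ :=
  ENNReal.ofReal (1 / (2 * Real.pi)) • volume.restrict (Set.Ioc 0 (2 * Real.pi))

instance : IsProbabilityMeasure angle := by
  refine ⟨?_⟩
  have h : (0 : ℝ) < 2 * Real.pi := by positivity
  rw [angle, Measure.smul_apply, Measure.restrict_apply_univ, Real.volume_Ioc, sub_zero,
    smul_eq_mul, ← ENNReal.ofReal_mul (by positivity), one_div, inv_mul_cancel₀ h.ne',
    ENNReal.ofReal_one]

theorem integral_angle (f : ℝ → ℝ) :
    ∫ θ, f θ ∂angle = (1 / (2 * Real.pi)) * ∫ θ in (0 : ℝ)..(2 * Real.pi), f θ := by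
  rw [angle, integral_smul_measure, intervalIntegral.integral_of_le (by positivity),
    ENNReal.toReal_ofReal (by positivity), smul_eq_mul]

theorem measurePreserving_reflect_angle :
    MeasurePreserving (fun θ : ℝ => 2 * Real.pi - θ) angle angle := by
  have h := (Measure.measurePreserving_sub_left volume (2 * Real.pi)).restrict_preimage
    (measurableSet_Ioc (a := (0 : ℝ)) (b := 2 * Real.pi))
  have h2 : (fun θ : ℝ => 2 * Real.pi - θ) ⁻¹' Set.Ioc 0 (2 * Real.pi)
      = Set.Ico 0 (2 * Real.pi) := by
    ext θ
    simp only [Set.mem_preimage, Set.mem_Ioc, Set.mem_Ico]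
    constructor <;> rintro ⟨h1, h2⟩ <;> constructor <;> linarith
  -- Reflection exchanges which endpoint belongs to the interval; endpoints are null.
  rw [h2, Measure.restrict_congr_set (Ico_ae_eq_Ioc (μ := volume))] at h
  exact h.smul_measure _

theorem measurePreserving_rotate_prod (hij : i ≠ j) :
    MeasurePreserving (fun z : ℝ × (Fin N → ℝ) => rotate i j z.1 z.2)
      (angle.prod (gauss (Fin N))) (gauss (Fin N)) :=
  measurePreserving_snd.comp ((MeasurePreserving.id angle).skew_product (measurable_rotate i j)
    (Eventually.of_forall fun θ => (measurePreserving_rotate hij θ).map_eq))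

/-- `R_{i,j}` as a bounded operator on `L²(γ_N)`. -/
def rot (hij : i ≠ j) : X (Fin N) →L[ℝ] X (Fin N) := avg (measurePreserving_rotate_prod hij)

theorem coeFn_rot_of_ae (hij : i ≠ j) (f : X (Fin N)) {f' : (Fin N → ℝ) → ℝ}
    (hf : f =ᵐ[gauss (Fin N)] f') : rot hij f =ᵐ[gauss (Fin N)] collide i j f' := by
  filter_upwards [coeFn_avg_of_ae (measurePreserving_rotate_prod hij) f hf] with v hv
  rw [rot, hv, integral_angle]
  rfl

theorem inner_rot_left (hij : i ≠ j) (f g : X (Fin N)) : ⟪rot hij f, g⟫ = ⟪f, rot hij g⟫ := by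
  -- The reverse of the move by θ is the move by 2π - θ from the rotated velocity.
  refine avg_symmetric (measurePreserving_rotate_prod hij)
    (Ψ := fun z => (2 * Real.pi - z.1, rotate i j z.1 z.2)) ?_ (fun z => ?_) (fun z => rfl) f g
  · exact measurePreserving_reflect_angle.skew_product (measurable_rotate i j)
      (Eventually.of_forall fun θ => (measurePreserving_rotate hij θ).map_eq)
  · simp only [rotate_rotate hij, add_sub_cancel]
    exact rotate_two_pi hij _

theorem collide_rotate (hij : i ≠ j) (f : (Fin N → ℝ) → ℝ) (φ : ℝ) (v : Fin N → ℝ) :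
    collide i j f (rotate i j φ v) = collide i j f v := by
  have hper : Function.Periodic (fun θ => f (rotate i j θ v)) (2 * Real.pi) := fun θ => by
    simp only
    rw [add_comm θ, ← rotate_rotate hij, rotate_two_pi hij]
  unfold collide
  congr 1
  simp only [rotate_rotate hij]
  have h := intervalIntegral.integral_comp_add_left (a := 0) (b := 2 * Real.pi)
    (fun θ => f (rotate i j θ v)) φ
  rw [h, add_zero]
  exact (hper.intervalIntegral_add_eq φ 0).trans (by rw [zero_add])

theorem collide_const_of_rotate {f : (Fin N → ℝ) → ℝ} {v : Fin N → ℝ} {c : ℝ}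
    (h : ∀ θ, f (rotate i j θ v) = c) : collide i j f v = c := by
  unfold collide
  simp only [h, intervalIntegral.integral_const, sub_zero, smul_eq_mul]
  field_simp

theorem rot_rot (hij : i ≠ j) (f : X (Fin N)) : rot hij (rot hij f) = rot hij f := by
  have h1 := coeFn_rot_of_ae hij f (EventuallyEq.refl _ _)
  refine Lp.ext ((coeFn_rot_of_ae hij _ h1).trans ?_)
  filter_upwards [h1] with v hv
  rw [hv]
  exact collide_const_of_rotate fun θ => collide_rotate hij _ θ v

/-- Being symmetric and idempotent, `rot` is an orthogonal projection, and the pairing is the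
squared norm of the complementary part. -/
theorem inner_sub_rot_nonneg (hij : i ≠ j) (f : X (Fin N)) : 0 ≤ ⟪f, f - rot hij f⟫ := by
  have h : ⟪f, f - rot hij f⟫ = ‖f - rot hij f‖ ^ 2 := by
    rw [← real_inner_self_eq_norm_sq, inner_sub_left, inner_rot_left, map_sub, rot_rot, sub_self,
      inner_zero_right, sub_zero]
  rw [h]
  positivity

theorem rot_lift_of_ne (hij : i ≠ j) {α : Type} [Fintype α] {e : α → Fin N}
    (he : Function.Injective e) (h : ∀ k, e k ≠ i ∧ e k ≠ j) (f : X α) :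
    rot hij (lift he f) = lift he f := by
  refine Lp.ext ((coeFn_rot_of_ae hij _ (coeFn_lift he f)).trans ?_)
  filter_upwards [coeFn_lift he f] with v hv
  rw [hv]
  refine collide_const_of_rotate fun θ => ?_
  congr 1
  funext k
  exact rotate_of_ne (h k).1 (h k).2 _ _

theorem rot_lift {M : ℕ} {i' j' : Fin M} (hij' : i' ≠ j') {e : Fin M → Fin N}
    (he : Function.Injective e) (hij : e i' ≠ e j') (f : X (Fin M)) :
    rot hij (lift he f) = lift he (rot hij' f) := by
  refine Lp.ext ((coeFn_rot_of_ae hij _ (coeFn_lift he f)).trans ?_)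
  filter_upwards [coeFn_lift he (rot hij' f), ae_of_pull (measurePreserving_comp he)
    (coeFn_rot_of_ae hij' f (EventuallyEq.refl _ _))] with v h1 h2
  rw [h1, h2]
  unfold collide
  congr 2
  funext θ
  simp only
  congr 1
  funext k
  by_cases hi : k = i'
  · subst hi
    rw [rotate_left hij, rotate_left hij']
  by_cases hj : k = j'
  · subst hj
    rw [rotate_right, rotate_right]
  rw [rotate_of_ne hi hj, rotate_of_ne (he.ne hi) (he.ne hj)]

end Rotations

/-! ### The operators of the generator on the components -/

section Operators

variable {N : ℕ}

/-- The Kac operator on `L²(γ_N)`. -/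
def kacOp (N : ℕ) : X (Fin N) →L[ℝ] X (Fin N) :=
  ∑ i : Fin N, ∑ j ∈ Finset.Ioi i,
    if hij : i ≠ j then rot hij - ContinuousLinearMap.id ℝ _ else 0

/-- `P⁺` from `L²(γ_N)` to `L²(γ_{N+1})`. -/
def createOp (N : ℕ) : X (Fin N) →L[ℝ] X (Fin (N + 1)) :=
  ∑ i : Fin (N + 1), lift (Fin.succAbove_right_injective (p := i))

/-- `P⁻` from `L²(γ_{N+1})` to `L²(γ_N)`. -/
def annihOp (N : ℕ) : X (Fin (N + 1)) →L[ℝ] X (Fin N) :=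
  (1 / ((N : ℝ) + 1)) • ∑ i : Fin (N + 1), (lift (Fin.succAbove_right_injective (p := i))).adjoint

theorem kacOp_apply (f : X (Fin N)) : kacOp N f = ∑ i : Fin N, ∑ j ∈ Finset.Ioi i,
    if hij : i ≠ j then rot hij f - f else 0 := by
  simp only [kacOp, sum_apply]
  refine Finset.sum_congr rfl fun i _ => Finset.sum_congr rfl fun j _ => ?_
  split_ifs <;> simp

theorem createOp_apply (f : X (Fin N)) :
    createOp N f = ∑ i : Fin (N + 1), lift (Fin.succAbove_right_injective (p := i)) f := by
  simp only [createOp, sum_apply]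

theorem annihOp_apply (f : X (Fin (N + 1))) :
    annihOp N f = (1 / ((N : ℝ) + 1)) •
      ∑ i : Fin (N + 1), (lift (Fin.succAbove_right_injective (p := i))).adjoint f := by
  simp only [annihOp, smul_apply, sum_apply]

/-- The factor N + 1 arises because `createOp` is a sum over labels while `annihOp` is a mean. It is
the factor in the detailed balance of the weights. -/
theorem inner_createOp_left (f : X (Fin N)) (g : X (Fin (N + 1))) :
    ⟪createOp N f, g⟫ = ((N : ℝ) + 1) * ⟪f, annihOp N g⟫ := by
  have h : (N : ℝ) + 1 ≠ 0 := by positivity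
  rw [createOp_apply, annihOp_apply, inner_smul_right, sum_inner, inner_sum, ← mul_assoc,
    mul_one_div_cancel h, one_mul]
  exact Finset.sum_congr rfl fun i _ => (ContinuousLinearMap.adjoint_inner_right _ _ _).symm

theorem inner_kacOp_left (f g : X (Fin N)) : ⟪kacOp N f, g⟫ = ⟪f, kacOp N g⟫ := by
  rw [kacOp_apply, kacOp_apply, sum_inner, inner_sum]
  refine Finset.sum_congr rfl fun i _ => ?_
  rw [sum_inner, inner_sum]
  refine Finset.sum_congr rfl fun j _ => ?_
  split_ifs with hij
  · rw [inner_sub_left, inner_sub_right, inner_rot_left]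
  · rw [inner_zero_left, inner_zero_right]

theorem inner_kacOp_nonpos (f : X (Fin N)) : ⟪f, kacOp N f⟫ ≤ 0 := by
  rw [kacOp_apply, inner_sum]
  refine Finset.sum_nonpos fun i _ => ?_
  rw [inner_sum]
  refine Finset.sum_nonpos fun j _ => ?_
  split_ifs with hij
  · have := inner_sub_rot_nonneg hij f
    rw [inner_sub_right] at this ⊢
    linarith
  · rw [inner_zero_right]

theorem coeFn_kacOp (f : X (Fin N)) {h : Phase → ℝ}
    (hf : f =ᵐ[gauss (Fin N)] fun v => h ⟨N, v⟩) :
    kacOp N f =ᵐ[gauss (Fin N)] fun v => kac h ⟨N, v⟩ := by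
  have h1 : ∀ᵐ v ∂gauss (Fin N), ∀ i j : Fin N, ∀ hij : i ≠ j,
      rot hij f v = collide i j (fun u => h ⟨N, u⟩) v := by
    simp only [ae_all_iff]
    exact fun i j hij => coeFn_rot_of_ae hij f hf
  have h2 : ∀ᵐ v ∂gauss (Fin N), ∀ i j : Fin N, ∀ hij : i ≠ j,
      (rot hij f - f : X (Fin N)) v = rot hij f v - f v := by
    simp only [ae_all_iff]
    exact fun i j hij => Lp.coeFn_sub _ _
  rw [kacOp_apply]
  have h3 : ∀ᵐ v ∂gauss (Fin N), ∀ i : Fin N,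
      ((∑ j ∈ Finset.Ioi i, if hij : i ≠ j then rot hij f - f else 0 : X (Fin N)) : _ → ℝ) v
        = ∑ j ∈ Finset.Ioi i, ((if hij : i ≠ j then rot hij f - f else 0 : X (Fin N)) : _ → ℝ) v := by
    rw [ae_all_iff]
    intro i
    filter_upwards [Lp.coeFn_finsetSum (Finset.Ioi i)
      (fun j => (if hij : i ≠ j then rot hij f - f else 0 : X (Fin N)))] with v hv
    rw [hv, Finset.sum_apply]
  filter_upwards [h1, h2, h3, hf, Lp.coeFn_finsetSum Finset.univ (fun i : Fin N =>
    ∑ j ∈ Finset.Ioi i, (if hij : i ≠ j then rot hij f - f else 0 : X (Fin N)))]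
    with v h1 h2 h3 h4 h5
  rw [h5, Finset.sum_apply]
  simp only [kac, h3]
  refine Finset.sum_congr rfl fun i _ => Finset.sum_congr rfl fun j hj => ?_
  have hij : i ≠ j := (Finset.mem_Ioi.1 hj).ne
  rw [dif_pos hij, h2 i j hij, h1 i j hij, h4]

theorem coeFn_createOp (f : X (Fin N)) {h : Phase → ℝ}
    (hf : f =ᵐ[gauss (Fin N)] fun v => h ⟨N, v⟩) :
    createOp N f =ᵐ[gauss (Fin (N + 1))] fun v => creation h ⟨N + 1, v⟩ := by
  have h1 : ∀ᵐ v ∂gauss (Fin (N + 1)), ∀ i : Fin (N + 1),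
      lift (Fin.succAbove_right_injective (p := i)) f v = h ⟨N, i.removeNth v⟩ := by
    rw [ae_all_iff]
    intro i
    have he := Fin.succAbove_right_injective (p := i)
    filter_upwards [coeFn_lift he f, ae_of_pull (measurePreserving_comp he) hf] with v h1 h2
    rw [h1, h2]
    rfl
  rw [createOp_apply]
  filter_upwards [h1, Lp.coeFn_finsetSum Finset.univ (fun i : Fin (N + 1) =>
    lift (Fin.succAbove_right_injective (p := i)) f)] with v h1 h2
  rw [h2, Finset.sum_apply]
  exact Finset.sum_congr rfl fun i _ => h1 i

theorem integral_maxwellian (f : ℝ → ℝ) :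
    ∫ w, f w ∂maxwellian = ∫ w : ℝ, Real.exp (-(Real.pi * w ^ 2)) * f w := by
  rw [maxwellian, integral_withDensity_eq_integral_toReal_smul (by fun_prop)
    (Eventually.of_forall fun _ => ENNReal.ofReal_lt_top)]
  congr 1
  funext w
  rw [ENNReal.toReal_ofReal (Real.exp_pos _).le, smul_eq_mul]

theorem measurePreserving_insertNth (i : Fin (N + 1)) :
    MeasurePreserving (fun z : ℝ × (Fin N → ℝ) => (i.insertNth z.1 z.2 : Fin (N + 1) → ℝ))
      (maxwellian.prod (gauss (Fin N))) (gauss (Fin (N + 1))) :=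
  (measurePreserving_piFinSuccAbove (fun _ : Fin (N + 1) => maxwellian) i).symm

theorem coeFn_annihOp (f : X (Fin (N + 1))) {h : Phase → ℝ}
    (hf : f =ᵐ[gauss (Fin (N + 1))] fun v => h ⟨N + 1, v⟩) :
    annihOp N f =ᵐ[gauss (Fin N)] fun v => annihilation h ⟨N, v⟩ := by
  have h1 : ∀ᵐ v ∂gauss (Fin N), ∀ i : Fin (N + 1),
      (lift (Fin.succAbove_right_injective (p := i))).adjoint f v
        = ∫ w : ℝ, Real.exp (-(Real.pi * w ^ 2)) * h ⟨N + 1, i.insertNth w v⟩ := by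
    rw [ae_all_iff]
    intro i
    -- Here the resampling map inserts a single velocity, so the adjoint becomes an integral over
    -- the line, as in `annihilation`.
    rw [lift, adjoint_pull_eq_avg (measurePreserving_insertNth i)
      (measurePreserving_comp (Fin.succAbove_right_injective (p := i)))
      fun w v => by funext k; exact Fin.insertNth_apply_succAbove (α := fun _ => ℝ) i w v k]
    filter_upwards [coeFn_avg_of_ae (measurePreserving_insertNth i) f hf] with v hv
    rw [hv, integral_maxwellian]
  rw [annihOp_apply]
  filter_upwards [h1, Lp.coeFn_finsetSum Finset.univ (fun i : Fin (N + 1) =>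
    (lift (Fin.succAbove_right_injective (p := i))).adjoint f), Lp.coeFn_smul (1 / ((N : ℝ) + 1))
    (∑ i : Fin (N + 1), (lift (Fin.succAbove_right_injective (p := i))).adjoint f)] with v h1 h2 h3
  rw [h3, Pi.smul_apply, h2, Finset.sum_apply, smul_eq_mul, annihilation]
  congr 1
  exact Finset.sum_congr rfl fun i _ => h1 i

end Operators

/-! ### Means and one-particle marginals -/

section Marginals

variable {N : ℕ}

/-- Functions of the velocity of the particle `i`. -/
def single (i : Fin N) : X (Fin 1) →L[ℝ] X (Fin N) :=
  lift (e := fun _ : Fin 1 => i) (Function.injective_of_subsingleton _)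

/-- Constant functions. -/
def const (N : ℕ) : X (Fin 0) →L[ℝ] X (Fin N) :=
  lift (e := Fin.elim0) (Function.injective_of_subsingleton _)

/-- The mean of a function, as a function of no variables. -/
def mean : X (Fin N) →L[ℝ] X (Fin 0) := (const N).adjoint

/-- The centred marginal of a function for the particle `i`. -/
def marg (i : Fin N) : X (Fin N) →L[ℝ] X (Fin 1) := (single i).adjoint - const 1 ∘L mean

theorem marg_apply (i : Fin N) (f : X (Fin N)) :
    marg i f = (single i).adjoint f - const 1 (mean f) := rfl

theorem norm_single (i : Fin N) (f : X (Fin 1)) : ‖single i f‖ = ‖f‖ := norm_lift _ f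

theorem norm_const (f : X (Fin 0)) : ‖const N f‖ = ‖f‖ := norm_lift _ f

theorem single_const (i : Fin N) (f : X (Fin 0)) : single i (const 1 f) = const N f :=
  lift_lift _ _ _ (fun j => j.elim0) f

theorem mean_const (f : X (Fin 0)) : mean (const N f) = f := adjoint_lift_lift_self _ f

theorem adjoint_single_single (i : Fin N) (f : X (Fin 1)) :
    (single i).adjoint (single i f) = f := adjoint_lift_lift_self _ f

theorem adjoint_single_single_of_ne {i j : Fin N} (hij : i ≠ j) (f : X (Fin 1)) :
    (single i).adjoint (single j f) = const 1 (mean f) :=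
  adjoint_lift_lift _ _ (Function.injective_of_subsingleton _)
    (Function.injective_of_subsingleton _) (fun k => k.elim0) (fun _ _ h => absurd h hij) f

theorem mean_single (i : Fin N) (f : X (Fin 1)) : mean (single i f) = mean f := by
  refine ext_inner_right ℝ fun g => ?_
  rw [mean, mean, ContinuousLinearMap.adjoint_inner_left, ContinuousLinearMap.adjoint_inner_left,
    ← single_const i, ← ContinuousLinearMap.adjoint_inner_right, adjoint_single_single]

theorem mean_adjoint_single (i : Fin N) (f : X (Fin N)) :
    mean ((single i).adjoint f) = mean f :=
  adjoint_lift_adjoint_lift _ _ _ (fun j => j.elim0) f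

theorem mean_marg (i : Fin N) (f : X (Fin N)) : mean (marg i f) = 0 := by
  rw [marg_apply, map_sub, mean_adjoint_single, mean_const, sub_self]

/-- The projection that integrates out the particles of `s`. -/
def integrateOut (s : Finset (Fin N)) : X (Fin N) →L[ℝ] X (Fin N) :=
  cyl (e := (Subtype.val : {i : Fin N // i ∉ s} → Fin N)) Subtype.val_injective

theorem integrateOut_integrateOut (s t : Finset (Fin N)) (f : X (Fin N)) :
    integrateOut s (integrateOut t f) = integrateOut (s ∪ t) f := by
  have ha : Function.Injective fun k : {i : Fin N // i ∉ s ∪ t} =>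
      (⟨k.1, fun h => k.2 (Finset.mem_union_left t h)⟩ : {i : Fin N // i ∉ s}) :=
    fun i j h => Subtype.ext (by simpa using h)
  have hb : Function.Injective fun k : {i : Fin N // i ∉ s ∪ t} =>
      (⟨k.1, fun h => k.2 (Finset.mem_union_right s h)⟩ : {i : Fin N // i ∉ t}) :=
    fun i j h => Subtype.ext (by simpa using h)
  refine cyl_cyl Subtype.val_injective Subtype.val_injective ha hb (fun k => rfl) ?_
    Subtype.val_injective (fun k => rfl) f
  rintro ⟨i, hi⟩ ⟨j, hj⟩ h
  obtain rfl : i = j := h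
  exact ⟨⟨i, by rw [Finset.mem_union, not_or]; exact ⟨hi, hj⟩⟩, rfl⟩

theorem inner_integrateOut_left (s : Finset (Fin N)) (f g : X (Fin N)) :
    ⟪integrateOut s f, g⟫ = ⟪f, integrateOut s g⟫ := inner_cyl_left _ f g

theorem integrateOut_eq {α : Type} [Fintype α] {e : α → Fin N} (he : Function.Injective e)
    (s : Finset (Fin N)) (h : ∀ i, i ∉ s ↔ ∃ j, e j = i) (f : X (Fin N)) :
    integrateOut s f = lift he ((lift he).adjoint f) := by
  rw [integrateOut, cyl_eq_of_range _ he, cyl_apply]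
  ext i
  simp [h]

theorem integrateOut_empty (f : X (Fin N)) : integrateOut ∅ f = f := by
  rw [integrateOut_eq (e := id) Function.injective_id ∅ (by simp)]
  have h : ∀ g : X (Fin N), lift (e := id) Function.injective_id g = g := fun g =>
    Lp.ext (coeFn_lift (e := id) Function.injective_id g)
  rw [h]
  refine ext_inner_right ℝ fun g => ?_
  rw [ContinuousLinearMap.adjoint_inner_left, h]

theorem integrateOut_univ (f : X (Fin N)) : integrateOut Finset.univ f = const N (mean f) :=
  integrateOut_eq _ _ (fun i => by simp) f

theorem integrateOut_erase (i : Fin N) (f : X (Fin N)) :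
    integrateOut (Finset.univ.erase i) f = single i ((single i).adjoint f) :=
  integrateOut_eq _ _ (fun j => by simp [eq_comm]) f

theorem norm_integrateOut_erase_sub (i : Fin N) (f : X (Fin N)) :
    ‖integrateOut (Finset.univ.erase i) f - const N (mean f)‖ = ‖marg i f‖ := by
  rw [integrateOut_erase, ← single_const i, ← map_sub, norm_single, marg_apply]

theorem norm_integrateOut_singleton (i : Fin (N + 1)) (f : X (Fin (N + 1))) :
    ‖integrateOut {i} f‖ = ‖(lift (Fin.succAbove_right_injective (p := i))).adjoint f‖ := by
  rw [integrateOut_eq (Fin.succAbove_right_injective (p := i)) {i}, norm_lift]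
  intro j
  rw [Finset.mem_singleton]
  exact Fin.exists_succAbove_eq_iff.symm

/-- Bessel's inequality for the mean and the centred one-particle marginals. -/
theorem norm_mean_sq_add_le (f : X (Fin N)) :
    ‖mean f‖ ^ 2 + ∑ i, ‖marg i f‖ ^ 2 ≤ ‖f‖ ^ 2 := by
  have h := sum_norm_sq_le_norm_sq integrateOut_integrateOut inner_integrateOut_left
    integrateOut_empty Finset.univ f
  simp only [integrateOut_univ, norm_integrateOut_erase_sub, norm_const] at h
  exact h

theorem norm_sq_sum_le {ι H : Type*} [NormedAddCommGroup H] (s : Finset ι)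
    (x : ι → H) : ‖∑ i ∈ s, x i‖ ^ 2 ≤ s.card * ∑ i ∈ s, ‖x i‖ ^ 2 :=
  (pow_le_pow_left₀ (norm_nonneg _) (norm_sum_le _ _) 2).trans sq_sum_le_card_mul_sum_sq

theorem norm_annihOp_sq_le (f : X (Fin (N + 1))) :
    ((N : ℝ) + 1) * ‖annihOp N f‖ ^ 2
      ≤ ∑ i : Fin (N + 1), ‖(lift (Fin.succAbove_right_injective (p := i))).adjoint f‖ ^ 2 := by
  have h := norm_sq_sum_le Finset.univ (fun i : Fin (N + 1) =>
    (lift (Fin.succAbove_right_injective (p := i))).adjoint f)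
  rw [Finset.card_univ, Fintype.card_fin] at h
  have h0 : (0 : ℝ) < (N : ℝ) + 1 := by positivity
  rw [annihOp_apply, norm_smul, mul_pow, Real.norm_eq_abs, sq_abs]
  push_cast at h
  calc ((N : ℝ) + 1) * ((1 / ((N : ℝ) + 1)) ^ 2 * ‖∑ i : Fin (N + 1),
        (lift (Fin.succAbove_right_injective (p := i))).adjoint f‖ ^ 2)
      = (1 / ((N : ℝ) + 1)) * ‖∑ i : Fin (N + 1),
        (lift (Fin.succAbove_right_injective (p := i))).adjoint f‖ ^ 2 := by field_simp
    _ ≤ (1 / ((N : ℝ) + 1)) * (((N : ℝ) + 1) * ∑ i : Fin (N + 1),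
        ‖(lift (Fin.succAbove_right_injective (p := i))).adjoint f‖ ^ 2) := by gcongr
    _ = _ := by field_simp

theorem norm_annihOp_le (f : X (Fin (N + 1))) : ‖annihOp N f‖ ≤ ‖f‖ := by
  have h := norm_annihOp_sq_le f
  have h2 : ∑ i : Fin (N + 1), ‖(lift (Fin.succAbove_right_injective (p := i))).adjoint f‖ ^ 2
      ≤ ∑ _i : Fin (N + 1), ‖f‖ ^ 2 :=
    Finset.sum_le_sum fun i _ => pow_le_pow_left₀ (norm_nonneg _) (norm_adjoint_lift_le _ f) 2
  rw [Finset.sum_const, Finset.card_univ, Fintype.card_fin, nsmul_eq_mul] at h2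
  push_cast at h2
  have h0 : (0 : ℝ) < (N : ℝ) + 1 := by positivity
  exact (sq_le_sq₀ (norm_nonneg _) (norm_nonneg _)).1 (le_of_mul_le_mul_left (h.trans h2) h0)

/-- The part of f that involves at least two particles loses at least twice as much as a
one-particle part when one particle is integrated out. This is `two_mul_norm_sq_le_sum` for all
labels, with Cauchy-Schwarz to pass from the separate integrations to their mean. -/
theorem two_mul_norm_sq_le_annihOp (f : X (Fin (N + 1))) :
    2 * ‖f‖ ^ 2 ≤ 2 * ‖mean f‖ ^ 2 + ∑ i, ‖marg i f‖ ^ 2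
      + ((N : ℝ) + 1) * (‖f‖ ^ 2 - ‖annihOp N f‖ ^ 2) := by
  have h := two_mul_norm_sq_le_sum integrateOut_integrateOut inner_integrateOut_left
    integrateOut_empty Finset.univ f
  simp only [integrateOut_univ, norm_integrateOut_erase_sub, norm_const] at h
  have h2 : ∀ i : Fin (N + 1), ‖f - integrateOut {i} f‖ ^ 2
      = ‖f‖ ^ 2 - ‖(lift (Fin.succAbove_right_injective (p := i))).adjoint f‖ ^ 2 := fun i => by
    rw [norm_sq_add_of_proj integrateOut_integrateOut inner_integrateOut_left {i} f,
      norm_integrateOut_singleton]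
    ring
  simp only [h2, Finset.sum_sub_distrib, Finset.sum_const, Finset.card_univ, Fintype.card_fin,
    nsmul_eq_mul] at h
  push_cast at h
  have h3 := norm_annihOp_sq_le f
  linarith

theorem mean_annihOp (f : X (Fin (N + 1))) : mean (annihOp N f) = mean f := by
  have h : ∀ i : Fin (N + 1), (const N).adjoint
      ((lift (Fin.succAbove_right_injective (p := i))).adjoint f) = mean f := fun i =>
    adjoint_lift_adjoint_lift _ _ _ (fun j => j.elim0) f
  have h0 : (N : ℝ) + 1 ≠ 0 := by positivity
  rw [annihOp_apply, mean, map_smul, map_sum]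
  simp only [h, Finset.sum_const, Finset.card_univ, Fintype.card_fin]
  rw [← Nat.cast_smul_eq_nsmul ℝ, smul_smul]
  push_cast
  rw [one_div_mul_cancel h0, one_smul]

/-- Integrating out the particle k turns the marginal of i into that of `k.succAbove i`; all of
these are equal, so averaging over k changes nothing. -/
theorem marg_annihOp {f : X (Fin (N + 1))} {q : X (Fin 1)} (hf : ∀ i, marg i f = q) (i : Fin N) :
    marg i (annihOp N f) = q := by
  have h : ∀ k : Fin (N + 1), (single i).adjoint
      ((lift (Fin.succAbove_right_injective (p := k))).adjoint f) = q + const 1 (mean f) :=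
    fun k => by
      rw [← hf (k.succAbove i), marg_apply, sub_add_cancel]
      exact adjoint_lift_adjoint_lift (Fin.succAbove_right_injective (p := k))
        (e' := fun _ : Fin 1 => i) (Function.injective_of_subsingleton _)
        (e'' := fun _ : Fin 1 => k.succAbove i) (Function.injective_of_subsingleton _)
        (fun j => rfl) f
  have h0 : (N : ℝ) + 1 ≠ 0 := by positivity
  rw [marg_apply, mean_annihOp, annihOp_apply, map_smul, map_sum]
  simp only [h, Finset.sum_const, Finset.card_univ, Fintype.card_fin]
  rw [← Nat.cast_smul_eq_nsmul ℝ, smul_smul]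
  push_cast
  rw [one_div_mul_cancel h0, one_smul, add_sub_cancel_right]

/-- The local lower bound for the energy of the exchange of one particle with the reservoir. -/
theorem exchange_lower_bound {f : X (Fin N)} {g : X (Fin (N + 1))} {p q : X (Fin 1)}
    (hf : ∀ i, marg i f = p) (hg : ∀ i, marg i g = q) :
    ‖mean g - mean f‖ ^ 2 + N * ‖q - p‖ ^ 2
        + (2 * ‖g‖ ^ 2 - 2 * ‖mean g‖ ^ 2 - ((N : ℝ) + 1) * ‖q‖ ^ 2) / ((N : ℝ) + 1)
      ≤ ‖f‖ ^ 2 - 2 * ⟪f, annihOp N g⟫ + ‖g‖ ^ 2 := by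
  -- The right side is ‖P⁻g - f‖² + (‖g‖² - ‖P⁻g‖²). Bessel's inequality bounds the first summand,
  -- the second-order inequality the other.
  have h1 := norm_mean_sq_add_le (annihOp N g - f)
  have h2 := two_mul_norm_sq_le_annihOp g
  have h0 : (0 : ℝ) < (N : ℝ) + 1 := by positivity
  simp only [map_sub, mean_annihOp, marg_annihOp hg, hf, hg, Finset.sum_const,
    Finset.card_univ, Fintype.card_fin, nsmul_eq_mul] at h1 h2
  push_cast at h2
  have h3 : (2 * ‖g‖ ^ 2 - 2 * ‖mean g‖ ^ 2 - ((N : ℝ) + 1) * ‖q‖ ^ 2) / ((N : ℝ) + 1)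
      ≤ ‖g‖ ^ 2 - ‖annihOp N g‖ ^ 2 := by
    rw [div_le_iff₀ h0]
    linarith
  have h4 := norm_sub_sq_real (annihOp N g) f
  rw [real_inner_comm] at h4
  linarith

end Marginals

/-! ### The Kac operator on sums of one-particle functions -/

section TwoBody

variable {N : ℕ}

theorem collide_swap {i j : Fin N} (hij : i ≠ j) (f : (Fin N → ℝ) → ℝ) (v : Fin N → ℝ) :
    collide i j f v = collide j i f v := by
  unfold collide
  congr 1
  have h := intervalIntegral.integral_comp_sub_left (a := 0) (b := 2 * Real.pi)
    (fun θ => f (rotate i j θ v)) (2 * Real.pi)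
  rw [sub_self, sub_zero] at h
  rw [← h]
  congr 1
  funext θ
  congr 1
  funext k
  by_cases hi : k = i
  · subst hi
    rw [rotate_left hij, rotate_right, Real.cos_two_pi_sub, Real.sin_two_pi_sub]
    ring
  by_cases hj : k = j
  · subst hj
    rw [rotate_right, rotate_left hij.symm, Real.cos_two_pi_sub, Real.sin_two_pi_sub]
    ring
  rw [rotate_of_ne hi hj, rotate_of_ne hj hi]

theorem rot_swap {i j : Fin N} (hij : i ≠ j) (f : X (Fin N)) : rot hij f = rot hij.symm f := by
  refine Lp.ext ?_
  filter_upwards [coeFn_rot_of_ae hij f (EventuallyEq.refl _ _),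
    coeFn_rot_of_ae hij.symm f (EventuallyEq.refl _ _)] with v h1 h2
  rw [h1, h2, collide_swap hij]

theorem pair_injective {i j : Fin N} (hij : i ≠ j) : Function.Injective ![i, j] := by
  intro a b h
  fin_cases a <;> fin_cases b <;> simp_all

/-- Functions of the velocities of the particles `i` and `j`. -/
def pair {i j : Fin N} (hij : i ≠ j) : X (Fin 2) →L[ℝ] X (Fin N) := lift (pair_injective hij)

theorem pair_single_zero {i j : Fin N} (hij : i ≠ j) (f : X (Fin 1)) :
    pair hij (single 0 f) = single i f :=
  lift_lift (pair_injective hij) (e' := fun _ : Fin 1 => (0 : Fin 2))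
    (Function.injective_of_subsingleton _) (e'' := fun _ : Fin 1 => i)
    (Function.injective_of_subsingleton _) (fun _ => rfl) f

theorem pair_single_one {i j : Fin N} (hij : i ≠ j) (f : X (Fin 1)) :
    pair hij (single 1 f) = single j f :=
  lift_lift (pair_injective hij) (e' := fun _ : Fin 1 => (1 : Fin 2))
    (Function.injective_of_subsingleton _) (e'' := fun _ : Fin 1 => j)
    (Function.injective_of_subsingleton _) (fun _ => rfl) f

theorem zero_ne_one_fin_two : (0 : Fin 2) ≠ 1 := by decide

theorem rot_pair {i j : Fin N} (hij : i ≠ j) (f : X (Fin 2)) :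
    rot hij (pair hij f) = pair hij (rot zero_ne_one_fin_two f) :=
  rot_lift zero_ne_one_fin_two (pair_injective hij) hij f

/-- If `e` misses `i` or `j`, then projecting onto functions of `v ∘ e` integrates out a variable of
x and leaves a marginal or the mean of x, which vanishes. The cases are the possible intersections
of {i, j} with the range of `e`. -/
theorem inner_pair_lift_eq_zero {i j : Fin N} (hij : i ≠ j) {x : X (Fin 2)}
    (h0 : (single 0).adjoint x = 0) (h1 : (single 1).adjoint x = 0) {α : Type} [Fintype α]
    {e : α → Fin N} (he : Function.Injective e) (h : ¬ ((∃ a, e a = i) ∧ ∃ a, e a = j))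
    (y : X α) : ⟪pair hij x, lift he y⟫ = 0 := by
  rw [← ContinuousLinearMap.adjoint_inner_left]
  suffices hs : (lift he).adjoint (pair hij x) = 0 by rw [hs, inner_zero_left]
  by_cases hi : ∃ a, e a = i
  · have hj : ¬ ∃ a, e a = j := fun hj => h ⟨hi, hj⟩
    obtain ⟨a, ha⟩ := hi
    rw [pair, adjoint_lift_lift he (pair_injective hij) (a := fun _ : Fin 1 => a)
      (Function.injective_of_subsingleton _) (b := fun _ : Fin 1 => (0 : Fin 2))
      (Function.injective_of_subsingleton _) (fun _ => by simpa using ha)]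
    · exact (congrArg _ h0).trans (map_zero _)
    · intro a' b hb
      fin_cases b
      · exact ⟨0, rfl⟩
      · exact absurd ⟨a', by simpa using hb⟩ hj
  by_cases hj : ∃ a, e a = j
  · obtain ⟨a, ha⟩ := hj
    rw [pair, adjoint_lift_lift he (pair_injective hij) (a := fun _ : Fin 1 => a)
      (Function.injective_of_subsingleton _) (b := fun _ : Fin 1 => (1 : Fin 2))
      (Function.injective_of_subsingleton _) (fun _ => by simpa using ha)]
    · exact (congrArg _ h1).trans (map_zero _)
    · intro a' b hb
      fin_cases b
      · exact absurd ⟨a', by simpa using hb⟩ hi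
      · exact ⟨0, rfl⟩
  · have hm : mean x = 0 := by rw [← mean_adjoint_single 0, h0, map_zero]
    rw [pair, adjoint_lift_lift he (pair_injective hij) (a := (Fin.elim0 : Fin 0 → α))
      (Function.injective_of_subsingleton _) (b := (Fin.elim0 : Fin 0 → Fin 2))
      (Function.injective_of_subsingleton _) (fun k => k.elim0)]
    · exact (congrArg _ hm).trans (map_zero _)
    · intro a' b hb
      fin_cases b
      · exact absurd ⟨a', by simpa using hb⟩ hi
      · exact absurd ⟨a', by simpa using hb⟩ hj

/-- The sum of a one-particle function over the particles. -/
def sumSingle (N : ℕ) : X (Fin 1) →L[ℝ] X (Fin N) := ∑ i : Fin N, single i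

theorem sumSingle_apply (f : X (Fin 1)) : sumSingle N f = ∑ i : Fin N, single i f := by
  simp only [sumSingle, sum_apply]

theorem inner_const_left (c : X (Fin 0)) (f : X (Fin N)) : ⟪const N c, f⟫ = ⟪c, mean f⟫ := by
  rw [mean, ContinuousLinearMap.adjoint_inner_right]

theorem inner_single_right (i : Fin N) (f : X (Fin N)) {g : X (Fin 1)} (hg : mean g = 0) :
    ⟪f, single i g⟫ = ⟪marg i f, g⟫ := by
  rw [marg_apply, inner_sub_left, inner_const_left, hg, inner_zero_right, sub_zero,
    ContinuousLinearMap.adjoint_inner_left]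

theorem inner_sumSingle_right {f : X (Fin N)} {p : X (Fin 1)} (hf : ∀ i, marg i f = p)
    {g : X (Fin 1)} (hg : mean g = 0) : ⟪f, sumSingle N g⟫ = N * ⟪p, g⟫ := by
  rw [sumSingle_apply, inner_sum]
  simp only [inner_single_right _ _ hg, hf, Finset.sum_const, Finset.card_univ, Fintype.card_fin,
    nsmul_eq_mul]

theorem marg_sumSingle {f : X (Fin 1)} (hf : mean f = 0) (i : Fin N) :
    marg i (sumSingle N f) = f := by
  have h : mean (sumSingle N f) = 0 := by
    rw [sumSingle_apply, map_sum]
    simp only [mean_single, hf, Finset.sum_const_zero]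
  rw [marg_apply, h, map_zero, sub_zero, sumSingle_apply, map_sum,
    Finset.sum_eq_single_of_mem i (Finset.mem_univ i), adjoint_single_single]
  intro j _ hj
  rw [adjoint_single_single_of_ne hj.symm, hf, map_zero]

theorem inner_sumSingle_sumSingle {f : X (Fin 1)} (hf : mean f = 0) {g : X (Fin 1)}
    (hg : mean g = 0) : ⟪sumSingle N f, sumSingle N g⟫ = N * ⟪f, g⟫ :=
  inner_sumSingle_right (marg_sumSingle hf) hg

theorem norm_sumSingle_sq {f : X (Fin 1)} (hf : mean f = 0) :
    ‖sumSingle N f‖ ^ 2 = N * ‖f‖ ^ 2 := by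
  rw [← real_inner_self_eq_norm_sq, inner_sumSingle_sumSingle hf hf, real_inner_self_eq_norm_sq]

/-- The sum of a one-particle function over two particles. -/
def double : X (Fin 1) →L[ℝ] X (Fin 2) := single 0 + single 1

theorem double_apply (f : X (Fin 1)) : double f = single 0 f + single 1 f := rfl

/-- `R - 1` on sums of one-particle functions of two particles. -/
def doubleKac : X (Fin 1) →L[ℝ] X (Fin 2) := rot zero_ne_one_fin_two ∘L double - double

theorem doubleKac_apply (f : X (Fin 1)) :
    doubleKac f = rot zero_ne_one_fin_two (double f) - double f := rfl

/-- The one-particle operator that is the leading part of `-K`. -/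
def oneKac : X (Fin 1) →L[ℝ] X (Fin 1) := -((single 0).adjoint ∘L doubleKac)

theorem oneKac_apply (f : X (Fin 1)) : oneKac f = -(single 0).adjoint (doubleKac f) := rfl

theorem mean_rot {i j : Fin N} (hij : i ≠ j) (f : X (Fin N)) : mean (rot hij f) = mean f := by
  refine ext_inner_left ℝ fun c => ?_
  rw [← inner_const_left, ← inner_const_left, ← inner_rot_left]
  congr 1
  exact rot_lift_of_ne hij _ (fun k => k.elim0) c

theorem mean_oneKac (f : X (Fin 1)) : mean (oneKac f) = 0 := by
  rw [oneKac_apply, map_neg, mean_adjoint_single, doubleKac_apply, map_sub, mean_rot, sub_self,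
    neg_zero]

/-- The two-particle function is invariant under exchange of its variables, so its two marginals
coincide. -/
theorem adjoint_single_one_doubleKac (f : X (Fin 1)) :
    (single 1).adjoint (doubleKac f) = (single 0).adjoint (doubleKac f) := by
  have hs : pair zero_ne_one_fin_two.symm (doubleKac f) = doubleKac f := by
    have h1 : pair zero_ne_one_fin_two.symm (double f) = double f := by
      rw [double_apply, map_add, pair_single_zero, pair_single_one, add_comm]
    rw [doubleKac_apply, map_sub, h1]
    congr 1
    rw [← rot_pair, h1, rot_swap]
  refine ext_inner_right ℝ fun g => ?_
  rw [ContinuousLinearMap.adjoint_inner_left, ContinuousLinearMap.adjoint_inner_left,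
    ← pair_single_zero zero_ne_one_fin_two.symm g]
  conv_lhs => rw [← hs]
  exact inner_lift_lift _ _ _

/-- The part of `doubleKac f` with vanishing marginals. -/
def doubleKacCentred (f : X (Fin 1)) : X (Fin 2) :=
  doubleKac f + single 0 (oneKac f) + single 1 (oneKac f)

theorem adjoint_single_zero_doubleKacCentred (f : X (Fin 1)) :
    (single 0).adjoint (doubleKacCentred f) = 0 := by
  rw [doubleKacCentred, map_add, map_add, adjoint_single_single,
    adjoint_single_single_of_ne zero_ne_one_fin_two, mean_oneKac, map_zero, add_zero, oneKac_apply,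
    add_neg_cancel]

theorem adjoint_single_one_doubleKacCentred (f : X (Fin 1)) :
    (single 1).adjoint (doubleKacCentred f) = 0 := by
  rw [doubleKacCentred, map_add, map_add, adjoint_single_single,
    adjoint_single_single_of_ne zero_ne_one_fin_two.symm, mean_oneKac, map_zero, add_zero,
    oneKac_apply, adjoint_single_one_doubleKac, add_neg_cancel]

/-- Since the rotation average R is a projection, ‖(R - 1)F‖² = -⟨F, (R - 1)F⟩; the two variables
contribute equally to the pairing. -/
theorem norm_doubleKac_sq (f : X (Fin 1)) : ‖doubleKac f‖ ^ 2 = 2 * ⟪f, oneKac f⟫ := by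
  have h1 : ‖doubleKac f‖ ^ 2 = -⟪double f, doubleKac f⟫ := by
    rw [← real_inner_self_eq_norm_sq]
    nth_rewrite 1 [doubleKac_apply]
    rw [inner_sub_left, inner_rot_left, doubleKac_apply, map_sub, rot_rot, sub_self,
      inner_zero_right, zero_sub]
  rw [h1, double_apply, inner_add_left, ← ContinuousLinearMap.adjoint_inner_right,
    ← ContinuousLinearMap.adjoint_inner_right, adjoint_single_one_doubleKac, oneKac_apply,
    inner_neg_right]
  ring

/-- Pythagoras: the centred part is orthogonal to the sum of one-particle functions that was
removed. -/
theorem norm_doubleKacCentred_sq (f : X (Fin 1)) :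
    ‖doubleKacCentred f‖ ^ 2 = 2 * ⟪f, oneKac f⟫ - 2 * ‖oneKac f‖ ^ 2 := by
  have h1 : ∀ x : X (Fin 2), (single 0).adjoint x = 0 → (single 1).adjoint x = 0 → ∀ y,
      ⟪x, single 0 y + single 1 y⟫ = 0 := fun x h0 h1 y => by
    rw [inner_add_right, ← ContinuousLinearMap.adjoint_inner_left,
      ← ContinuousLinearMap.adjoint_inner_left, h0, h1, inner_zero_left, add_zero]
  have h2 := h1 _ (adjoint_single_zero_doubleKacCentred f)
    (adjoint_single_one_doubleKacCentred f) (oneKac f)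
  have h3 : doubleKac f = doubleKacCentred f - sumSingle 2 (oneKac f) := by
    rw [doubleKacCentred, sumSingle_apply, Fin.sum_univ_two]
    abel
  have h4 := norm_sub_sq_real (doubleKacCentred f) (sumSingle 2 (oneKac f))
  rw [← h3, norm_sumSingle_sq (mean_oneKac f), norm_doubleKac_sq, sumSingle_apply,
    Fin.sum_univ_two, h2] at h4
  push_cast at h4
  linarith

theorem sum_Ioi_add {M : Type*} [AddCommGroup M] [Module ℝ M] (F : Fin N → M) :
    ∑ i : Fin N, ∑ j ∈ Finset.Ioi i, (F i + F j) = ((N : ℝ) - 1) • ∑ i, F i := by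
  have h1 : ∑ i : Fin N, ∑ j ∈ Finset.Ioi i, F j = ∑ j : Fin N, ∑ _i ∈ Finset.Iio j, F j :=
    Finset.sum_comm' (by simp)
  simp only [Finset.sum_add_distrib]
  rw [h1, ← Finset.sum_add_distrib, Finset.smul_sum]
  refine Finset.sum_congr rfl fun i _ => ?_
  rw [Finset.sum_const, Finset.sum_const, Fin.card_Ioi, Fin.card_Iio, ← add_smul,
    ← Nat.cast_smul_eq_nsmul ℝ]
  congr 1
  have : N - 1 - (i : ℕ) + i + 1 = N := by omega
  have h2 : ((N - 1 - (i : ℕ) + i + 1 : ℕ) : ℝ) = N := by rw [this]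
  push_cast at h2 ⊢
  linarith

theorem sum_Ioi_one : ∑ i : Fin N, ∑ _j ∈ Finset.Ioi i, (1 : ℝ) = N * ((N : ℝ) - 1) / 2 := by
  have h := sum_Ioi_add (fun _ : Fin N => (1 / 2 : ℝ))
  simp only [add_halves, Finset.sum_const, Finset.card_univ, Fintype.card_fin, nsmul_eq_mul,
    smul_eq_mul] at h ⊢
  rw [h]
  ring

/-- The sum over the pairs of particles of a two-particle function. -/
def sumPair (N : ℕ) (x : X (Fin 2)) : X (Fin N) :=
  ∑ i : Fin N, ∑ j ∈ Finset.Ioi i, if hij : i ≠ j then pair hij x else 0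

theorem inner_sumPair_sumSingle {x : X (Fin 2)} (h0 : (single 0).adjoint x = 0)
    (h1 : (single 1).adjoint x = 0) (g : X (Fin 1)) : ⟪sumPair N x, sumSingle N g⟫ = 0 := by
  rw [sumPair, sum_inner]
  refine Finset.sum_eq_zero fun i _ => ?_
  rw [sum_inner]
  refine Finset.sum_eq_zero fun j _ => ?_
  split_ifs with hij
  · rw [sumSingle_apply, inner_sum]
    refine Finset.sum_eq_zero fun k _ => inner_pair_lift_eq_zero hij h0 h1 _ ?_ g
    rintro ⟨⟨_, h⟩, ⟨_, h'⟩⟩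
    exact hij (h.symm.trans h')
  · rw [inner_zero_left]

/-- Copies of a function with vanishing marginals placed on different pairs are orthogonal, since
the other pair misses a label of the first. Only the N(N-1)/2 diagonal terms survive. -/
theorem norm_sumPair_sq {x : X (Fin 2)} (h0 : (single 0).adjoint x = 0)
    (h1 : (single 1).adjoint x = 0) :
    ‖sumPair N x‖ ^ 2 = N * ((N : ℝ) - 1) / 2 * ‖x‖ ^ 2 := by
  have h : ∀ i : Fin N, ∀ j ∈ Finset.Ioi i,
      ⟪(if hij : i ≠ j then pair hij x else 0 : X (Fin N)), sumPair N x⟫ = ‖x‖ ^ 2 := by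
    intro i j hj
    have hlt := Finset.mem_Ioi.1 hj
    rw [dif_pos hlt.ne, sumPair, inner_sum, Finset.sum_eq_single_of_mem i (Finset.mem_univ i),
      inner_sum, Finset.sum_eq_single_of_mem j hj, dif_pos hlt.ne, pair, inner_lift_lift,
      real_inner_self_eq_norm_sq]
    · intro l hl hlj
      have hil := Finset.mem_Ioi.1 hl
      rw [dif_pos hil.ne]
      refine inner_pair_lift_eq_zero hlt.ne h0 h1 _ ?_ x
      rintro ⟨-, ⟨a, ha⟩⟩
      fin_cases a
      · exact hlt.ne ha
      · exact hlj ha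
    · intro k _ hki
      rw [inner_sum]
      refine Finset.sum_eq_zero fun l hl => ?_
      have hkl := Finset.mem_Ioi.1 hl
      rw [dif_pos hkl.ne]
      refine inner_pair_lift_eq_zero hlt.ne h0 h1 _ ?_ x
      rintro ⟨⟨a, ha⟩, ⟨b, hb⟩⟩
      fin_cases a
      · exact hki ha
      · fin_cases b
        · have h2 : l = i := ha
          have h3 : k = j := hb
          omega
        · exact hlt.ne (ha.symm.trans hb)
  rw [← real_inner_self_eq_norm_sq]
  nth_rewrite 1 [sumPair]
  rw [sum_inner, ← sum_Ioi_one, Finset.sum_mul]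
  refine Finset.sum_congr rfl fun i _ => ?_
  rw [sum_inner, Finset.sum_mul]
  exact Finset.sum_congr rfl fun j hj => by rw [h i j hj, one_mul]

theorem rot_sumSingle_sub {i j : Fin N} (hij : i ≠ j) (f : X (Fin 1)) :
    rot hij (sumSingle N f) - sumSingle N f = pair hij (doubleKac f) := by
  have h1 : rot hij (sumSingle N f) - sumSingle N f
      = ∑ k : Fin N, (rot hij (single k f) - single k f) := by
    rw [sumSingle_apply, map_sum, Finset.sum_sub_distrib]
  rw [h1, ← Finset.sum_subset (Finset.subset_univ {i, j}), Finset.sum_pair hij]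
  · rw [doubleKac_apply, map_sub, ← rot_pair, double_apply, map_add, pair_single_zero, pair_single_one, map_add]
    abel
  · intro k _ hk
    rw [Finset.mem_insert, Finset.mem_singleton, not_or] at hk
    rw [sub_eq_zero]
    exact rot_lift_of_ne hij _ (fun _ => hk) f

/-- A collision of i and j changes only the terms i and j of the sum. Splitting the change into
centred part and marginals yields the pair sum and, each particle being in N - 1 pairs, the factor N
- 1. -/
theorem kacOp_sumSingle (f : X (Fin 1)) :
    kacOp N (sumSingle N f)
      = sumPair N (doubleKacCentred f) - ((N : ℝ) - 1) • sumSingle N (oneKac f) := by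
  rw [kacOp_apply, sumSingle_apply (N := N) (oneKac f), ← sum_Ioi_add, sumPair,
    ← Finset.sum_sub_distrib]
  refine Finset.sum_congr rfl fun i _ => ?_
  rw [← Finset.sum_sub_distrib]
  refine Finset.sum_congr rfl fun j hj => ?_
  have hij := (Finset.mem_Ioi.1 hj).ne
  rw [dif_pos hij, dif_pos hij, rot_sumSingle_sub, doubleKacCentred, map_add, map_add,
    pair_single_zero, pair_single_one]
  abel

theorem inner_kacOp_sumSingle {f : X (Fin 1)} (hf : mean f = 0) :
    ⟪sumSingle N f, kacOp N (sumSingle N f)⟫ = -(N * ((N : ℝ) - 1) * ⟪f, oneKac f⟫) := by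
  rw [kacOp_sumSingle, inner_sub_right, real_inner_comm,
    inner_sumPair_sumSingle (adjoint_single_zero_doubleKacCentred f)
      (adjoint_single_one_doubleKacCentred f), inner_smul_right,
    inner_sumSingle_sumSingle hf (mean_oneKac f)]
  ring

/-- The norm of the part of `K` applied to a sum of one-particle functions that is orthogonal to
the sums of one-particle functions after averaging over the number of particles. -/
theorem norm_kacOp_sumSingle_add_sq (t : ℝ) (f : X (Fin 1)) :
    ‖kacOp N (sumSingle N f) + t • sumSingle N (oneKac f)‖ ^ 2
      = N * ((N : ℝ) - 1) * (⟪f, oneKac f⟫ - ‖oneKac f‖ ^ 2)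
        + N * ((N : ℝ) - 1 - t) ^ 2 * ‖oneKac f‖ ^ 2 := by
  have h1 : kacOp N (sumSingle N f) + t • sumSingle N (oneKac f)
      = sumPair N (doubleKacCentred f) - ((N : ℝ) - 1 - t) • sumSingle N (oneKac f) := by
    rw [kacOp_sumSingle]
    module
  rw [h1, norm_sub_sq_real, inner_smul_right,
    inner_sumPair_sumSingle (adjoint_single_zero_doubleKacCentred f)
      (adjoint_single_one_doubleKacCentred f), norm_smul, mul_pow, Real.norm_eq_abs, sq_abs,
    norm_sumSingle_sq (mean_oneKac f), norm_sumPair_sq (adjoint_single_zero_doubleKacCentred f)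
      (adjoint_single_one_doubleKacCentred f), norm_doubleKacCentred_sq]
  ring

end TwoBody

/-! ### Moments of the Poisson weights -/

section Weights

variable {lam μ ρ : ℝ}

theorem weight_pos (hμ : 0 < μ) (hρ : 0 < ρ) (N : ℕ) : 0 < weight μ ρ N := by
  unfold weight; positivity

theorem weight_succ_mul (μ ρ : ℝ) (N : ℕ) :
    weight μ ρ (N + 1) * ((N : ℝ) + 1) = μ / ρ * weight μ ρ N := by
  unfold weight
  rw [Nat.factorial_succ, pow_succ]
  push_cast
  have h : (N.factorial : ℝ) ≠ 0 := by positivity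
  have h' : (N : ℝ) + 1 ≠ 0 := by positivity
  field_simp

theorem rho_mul_weight_succ (hρ : 0 < ρ) (N : ℕ) :
    ρ * (((N : ℝ) + 1) * weight μ ρ (N + 1)) = μ * weight μ ρ N := by
  rw [mul_comm _ (weight μ ρ (N + 1)), weight_succ_mul]
  field_simp

theorem hasSum_weight (μ ρ : ℝ) : HasSum (weight μ ρ) 1 := by
  have h := (NormedSpace.expSeries_div_hasSum_exp (𝔸 := ℝ) (μ / ρ)).mul_right
    (Real.exp (-(μ / ρ)))
  rw [← congrFun Real.exp_eq_exp_ℝ, ← Real.exp_add, add_neg_cancel, Real.exp_zero] at h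
  refine h.congr_fun fun N => ?_
  unfold weight
  ring

/-- For a Poisson variable of mean t, E[N G(N)] = t E[G(N + 1)]. The value of `G` at 0 is
irrelevant, because it carries the factor N. -/
theorem hasSum_weight_shift {F G : ℕ → ℝ} {s : ℝ} (hFG : ∀ N, G (N + 1) = F N)
    (h : HasSum (fun N => weight μ ρ N * F N) s) :
    HasSum (fun N : ℕ => weight μ ρ N * (N * G N)) (μ / ρ * s) := by
  have h1 : HasSum (fun N : ℕ => weight μ ρ (N + 1) * (((N + 1 : ℕ) : ℝ) * G (N + 1)))
      (μ / ρ * s) := by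
    refine (h.mul_left (μ / ρ)).congr_fun fun N => ?_
    rw [hFG, ← mul_assoc, ← mul_assoc, ← weight_succ_mul]
    push_cast
    ring
  simpa using (hasSum_nat_add_iff (f := fun N : ℕ => weight μ ρ N * (N * G N)) 1).1 h1

theorem hasSum_weight_mul_id (μ ρ : ℝ) : HasSum (fun N : ℕ => weight μ ρ N * N) (μ / ρ) := by
  have h := hasSum_weight_shift (μ := μ) (ρ := ρ) (F := fun _ => 1) (G := fun _ => 1)
    (fun _ => rfl) (by simpa using hasSum_weight μ ρ)
  simpa using h

theorem hasSum_weight_mul_factorial_two (μ ρ : ℝ) :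
    HasSum (fun N : ℕ => weight μ ρ N * (N * ((N : ℝ) - 1))) ((μ / ρ) ^ 2) := by
  have h := hasSum_weight_shift (μ := μ) (ρ := ρ) (F := fun N => N) (G := fun N => (N : ℝ) - 1)
    (fun N => by push_cast; ring) (hasSum_weight_mul_id μ ρ)
  rwa [← sq] at h

theorem hasSum_weight_mul_sq (μ ρ : ℝ) :
    HasSum (fun N : ℕ => weight μ ρ N * (N : ℝ) ^ 2) ((μ / ρ) ^ 2 + μ / ρ) := by
  refine ((hasSum_weight_mul_factorial_two μ ρ).add (hasSum_weight_mul_id μ ρ)).congr_fun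
    fun N => ?_
  ring

/-- The shift identity reduces the sum to t times the variance, which is t. -/
theorem hasSum_weight_mul_variance (μ ρ : ℝ) :
    HasSum (fun N : ℕ => weight μ ρ N * (N * ((N : ℝ) - 1 - μ / ρ) ^ 2)) ((μ / ρ) ^ 2) := by
  have h1 : HasSum (fun N : ℕ => weight μ ρ N * ((N : ℝ) - μ / ρ) ^ 2) (μ / ρ) := by
    have h2 := ((hasSum_weight_mul_sq μ ρ).sub
      ((hasSum_weight_mul_id μ ρ).mul_left (2 * (μ / ρ)))).add
      ((hasSum_weight μ ρ).mul_left ((μ / ρ) ^ 2))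
    have h3 : (μ / ρ) ^ 2 + μ / ρ - 2 * (μ / ρ) * (μ / ρ) + (μ / ρ) ^ 2 * 1 = μ / ρ := by ring
    rw [h3] at h2
    refine h2.congr_fun fun N => ?_
    ring
  have h := hasSum_weight_shift (μ := μ) (ρ := ρ) (F := fun N => ((N : ℝ) - μ / ρ) ^ 2)
    (G := fun N => ((N : ℝ) - 1 - μ / ρ) ^ 2) (fun N => by push_cast; ring) h1
  rwa [← sq] at h

end Weights

/-! ### The generator on sequences of components -/

section Sequences

variable {lam μ ρ : ℝ}

/-- The components of `P⁺ h`. -/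
def createSeq (h : ∀ N, X (Fin N)) : ∀ N, X (Fin N)
  | 0 => 0
  | N + 1 => createOp N (h N)

/-- The components of the generator applied to `h`. -/
def genSeq (lam μ ρ : ℝ) (h : ∀ N, X (Fin N)) (N : ℕ) : X (Fin N) :=
  ρ • (createSeq h N - (N : ℝ) • h N) + μ • (annihOp N (h (N + 1)) - h N)
    + (lam * ρ / μ) • kacOp N (h N)

/-- Detailed balance pairs creation at level k + 1 with annihilation at level k; cutting the sum at
n leaves only annihilation from level n + 1 and the loss term at level n unpaired. -/
theorem sum_inner_genSeq (hρ : 0 < ρ) (h j : ∀ N, X (Fin N)) (n : ℕ) :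
    ∑ k ∈ Finset.range (n + 1), weight μ ρ k * ⟪h k, genSeq lam μ ρ j k⟫
      = -(μ * ∑ k ∈ Finset.range n, weight μ ρ k * (⟪h k, j k⟫ - ⟪h k, annihOp k (j (k + 1))⟫
          - ⟪j k, annihOp k (h (k + 1))⟫ + ⟪h (k + 1), j (k + 1)⟫))
        + lam * ρ / μ * ∑ k ∈ Finset.range (n + 1), weight μ ρ k * ⟪h k, kacOp k (j k)⟫
        + μ * (weight μ ρ n * (⟪h n, annihOp n (j (n + 1))⟫ - ⟪h n, j n⟫)) := by
  induction n with
  | zero =>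
    simp only [zero_add, Finset.range_one, Finset.sum_singleton, Finset.range_zero,
      Finset.sum_empty, genSeq, createSeq, inner_add_right, inner_smul_right, inner_sub_right,
      inner_zero_right, Nat.cast_zero]
    ring
  | succ n ih =>
    have h1 := rho_mul_weight_succ (μ := μ) hρ n
    have h2 : ⟪h (n + 1), createOp n (j n)⟫ = ((n : ℝ) + 1) * ⟪j n, annihOp n (h (n + 1))⟫ := by
      rw [real_inner_comm, inner_createOp_left]
    rw [Finset.sum_range_succ, ih, Finset.sum_range_succ _ (n + 1), Finset.sum_range_succ
      (fun k => weight μ ρ k * (⟪h k, j k⟫ - ⟪h k, annihOp k (j (k + 1))⟫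
        - ⟪j k, annihOp k (h (k + 1))⟫ + ⟪h (k + 1), j (k + 1)⟫)) n]
    simp only [genSeq, createSeq, inner_add_right, inner_smul_right, inner_sub_right, h2]
    push_cast
    linear_combination (⟪j n, annihOp n (h (n + 1))⟫ - ⟪h (n + 1), j (n + 1)⟫) * h1

/-- The energy of the exchange of one particle. -/
def exchange (h : ∀ N, X (Fin N)) (k : ℕ) : ℝ :=
  ‖h k‖ ^ 2 - 2 * ⟪h k, annihOp k (h (k + 1))⟫ + ‖h (k + 1)‖ ^ 2

theorem exchange_nonneg (h : ∀ N, X (Fin N)) (k : ℕ) : 0 ≤ exchange h k := by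
  have h1 := real_inner_le_norm (h k) (annihOp k (h (k + 1)))
  have h2 := mul_le_mul_of_nonneg_left (norm_annihOp_le (h (k + 1))) (norm_nonneg (h k))
  have h3 := sq_nonneg (‖h k‖ - ‖h (k + 1)‖)
  unfold exchange
  linarith

/-- Otherwise w would eventually dominate a multiple of the harmonic series. This is how boundary
terms are treated on the maximal domain: being small along a subsequence is enough. -/
theorem frequently_lt_of_summable {w b : ℕ → ℝ} (hw : Summable w) {C : ℝ}
    (hb : ∀ n : ℕ, b n ≤ C * ((n : ℝ) + 1) * w n) {η : ℝ} (hη : 0 < η) :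
    ∃ᶠ n in atTop, b n < η := by
  intro hcon
  simp only [not_lt] at hcon
  obtain ⟨n0, hn0⟩ := eventually_atTop.1 hcon
  have h1 : Summable fun n : ℕ => 1 / (((n + n0 : ℕ) : ℝ) + 1) := by
    refine Summable.of_nonneg_of_le (fun n => by positivity) (fun n => ?_)
      (((summable_nat_add_iff n0).2 hw).mul_left (C / η))
    have h2 := (hn0 (n + n0) (Nat.le_add_left _ _)).trans (hb (n + n0))
    rw [div_le_iff₀ (by positivity), div_mul_eq_mul_div, div_mul_eq_mul_div, le_div_iff₀ hη]
    linarith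
  have h3 : Summable fun n : ℕ => 1 / ((n : ℝ) + 1) :=
    (summable_nat_add_iff (f := fun n : ℕ => 1 / ((n : ℝ) + 1)) n0).1 h1
  have h4 : Summable fun n : ℕ => 1 / (n : ℝ) := by
    refine (summable_nat_add_iff 1).1 (h3.congr fun n => ?_)
    push_cast
    rfl
  exact Real.not_summable_one_div_natCast h4

/-- The factor n + 1 is the cost of replacing the weight of level n by that of level n + 1. It is
just what the divergence of the harmonic series tolerates. -/
theorem boundary_le (hμ : 0 < μ) (hρ : 0 < ρ) (h j : ∀ N, X (Fin N)) (n : ℕ) :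
    weight μ ρ n * |⟪h n, annihOp n (j (n + 1))⟫|
      ≤ (1 + ρ / μ) * ((n : ℝ) + 1) * (weight μ ρ n * ‖h n‖ ^ 2
        + weight μ ρ (n + 1) * ‖j (n + 1)‖ ^ 2) := by
  have ha := weight_pos hμ hρ n
  have hb := weight_pos hμ hρ (n + 1)
  have h1 : |⟪h n, annihOp n (j (n + 1))⟫| ≤ ‖h n‖ ^ 2 + ‖j (n + 1)‖ ^ 2 := by
    have h2 := abs_real_inner_le_norm (h n) (annihOp n (j (n + 1)))
    have h3 := mul_le_mul_of_nonneg_left (norm_annihOp_le (j (n + 1))) (norm_nonneg (h n))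
    nlinarith [sq_nonneg (‖h n‖ - ‖j (n + 1)‖), sq_nonneg ‖h n‖, sq_nonneg ‖j (n + 1)‖]
  have h4 : weight μ ρ n = ρ / μ * (((n : ℝ) + 1) * weight μ ρ (n + 1)) := by
    have := rho_mul_weight_succ (μ := μ) hρ n
    field_simp
    linarith
  have h5 : 0 ≤ weight μ ρ n * ‖h n‖ ^ 2 := by positivity
  have h6 : 0 ≤ weight μ ρ (n + 1) * ‖j (n + 1)‖ ^ 2 := by positivity
  have h7 : 0 ≤ ρ / μ := by positivity
  have h8 : (0 : ℝ) ≤ n := by positivity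
  have h9 : weight μ ρ n * ‖j (n + 1)‖ ^ 2
      = ρ / μ * ((n : ℝ) + 1) * (weight μ ρ (n + 1) * ‖j (n + 1)‖ ^ 2) := by
    rw [h4]; ring
  calc weight μ ρ n * |⟪h n, annihOp n (j (n + 1))⟫|
      ≤ weight μ ρ n * (‖h n‖ ^ 2 + ‖j (n + 1)‖ ^ 2) := by gcongr
    _ = weight μ ρ n * ‖h n‖ ^ 2
        + ρ / μ * ((n : ℝ) + 1) * (weight μ ρ (n + 1) * ‖j (n + 1)‖ ^ 2) := by
      rw [mul_add, h9]
    _ ≤ (1 + ρ / μ) * ((n : ℝ) + 1) * (weight μ ρ n * ‖h n‖ ^ 2)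
        + (1 + ρ / μ) * ((n : ℝ) + 1) * (weight μ ρ (n + 1) * ‖j (n + 1)‖ ^ 2) := by
      have h10 : 1 ≤ (1 + ρ / μ) * ((n : ℝ) + 1) := by nlinarith [mul_nonneg h7 h8]
      have h11 : ρ / μ * ((n : ℝ) + 1) ≤ (1 + ρ / μ) * ((n : ℝ) + 1) := by nlinarith
      have h12 := mul_le_mul_of_nonneg_right h10 h5
      have h13 := mul_le_mul_of_nonneg_right h11 h6
      linarith
    _ = _ := by ring

/-- The generator is symmetric on its maximal domain. -/
theorem genSeq_symmetric (hμ : 0 < μ) (hρ : 0 < ρ) {h j : ∀ N, X (Fin N)}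
    (hh : Summable fun N => weight μ ρ N * ‖h N‖ ^ 2)
    (hj : Summable fun N => weight μ ρ N * ‖j N‖ ^ 2) {s₁ s₂ : ℝ}
    (h1 : HasSum (fun N => weight μ ρ N * ⟪h N, genSeq lam μ ρ j N⟫) s₁)
    (h2 : HasSum (fun N => weight μ ρ N * ⟪j N, genSeq lam μ ρ h N⟫) s₂) : s₁ = s₂ := by
  have hlim := (h1.sub h2).tendsto_sum_nat.comp (tendsto_add_atTop_nat 1)
  have hb : ∀ n, |∑ k ∈ Finset.range (n + 1), (weight μ ρ k * ⟪h k, genSeq lam μ ρ j k⟫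
      - weight μ ρ k * ⟪j k, genSeq lam μ ρ h k⟫)|
      ≤ (μ * (1 + ρ / μ)) * ((n : ℝ) + 1) * ((weight μ ρ n * ‖h n‖ ^ 2
        + weight μ ρ (n + 1) * ‖j (n + 1)‖ ^ 2) + (weight μ ρ n * ‖j n‖ ^ 2
        + weight μ ρ (n + 1) * ‖h (n + 1)‖ ^ 2)) := by
    intro n
    have ha := weight_pos hμ hρ n
    have h3 : ∑ k ∈ Finset.range (n + 1), (weight μ ρ k * ⟪h k, genSeq lam μ ρ j k⟫
        - weight μ ρ k * ⟪j k, genSeq lam μ ρ h k⟫)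
        = μ * (weight μ ρ n * ⟪h n, annihOp n (j (n + 1))⟫
          - weight μ ρ n * ⟪j n, annihOp n (h (n + 1))⟫) := by
      rw [Finset.sum_sub_distrib, sum_inner_genSeq hρ, sum_inner_genSeq hρ]
      have h4 : ∑ k ∈ Finset.range n, weight μ ρ k * (⟪h k, j k⟫
          - ⟪h k, annihOp k (j (k + 1))⟫ - ⟪j k, annihOp k (h (k + 1))⟫
          + ⟪h (k + 1), j (k + 1)⟫) = ∑ k ∈ Finset.range n, weight μ ρ k * (⟪j k, h k⟫
          - ⟪j k, annihOp k (h (k + 1))⟫ - ⟪h k, annihOp k (j (k + 1))⟫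
          + ⟪j (k + 1), h (k + 1)⟫) := by
        refine Finset.sum_congr rfl fun k _ => ?_
        rw [real_inner_comm (h k) (j k), real_inner_comm (h (k + 1)) (j (k + 1))]
        ring
      have h5 : ∑ k ∈ Finset.range (n + 1), weight μ ρ k * ⟪h k, kacOp k (j k)⟫
          = ∑ k ∈ Finset.range (n + 1), weight μ ρ k * ⟪j k, kacOp k (h k)⟫ := by
        refine Finset.sum_congr rfl fun k _ => ?_
        rw [← inner_kacOp_left, real_inner_comm]
      rw [h4, h5, real_inner_comm (h n) (j n)]
      ring
    have h6 := boundary_le hμ hρ h j n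
    have h7 := boundary_le hμ hρ j h n
    rw [h3, abs_mul, abs_of_pos hμ]
    calc μ * |weight μ ρ n * ⟪h n, annihOp n (j (n + 1))⟫
          - weight μ ρ n * ⟪j n, annihOp n (h (n + 1))⟫|
        ≤ μ * (weight μ ρ n * |⟪h n, annihOp n (j (n + 1))⟫|
          + weight μ ρ n * |⟪j n, annihOp n (h (n + 1))⟫|) := by
          refine mul_le_mul_of_nonneg_left ((abs_sub _ _).trans_eq ?_) hμ.le
          rw [abs_mul, abs_mul, abs_of_pos ha]
      _ ≤ μ * _ := mul_le_mul_of_nonneg_left (add_le_add h6 h7) hμ.le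
      _ = _ := by ring
  have hw : Summable fun n => (weight μ ρ n * ‖h n‖ ^ 2
        + weight μ ρ (n + 1) * ‖j (n + 1)‖ ^ 2) + (weight μ ρ n * ‖j n‖ ^ 2
        + weight μ ρ (n + 1) * ‖h (n + 1)‖ ^ 2) :=
    (hh.add ((summable_nat_add_iff 1).2 hj)).add (hj.add ((summable_nat_add_iff 1).2 hh))
  -- The partial sums of the difference converge to s₁ - s₂ and are boundary terms, which are
  -- frequently below any positive number.
  by_contra hne
  have hpos : 0 < |s₁ - s₂| := abs_pos.2 (sub_ne_zero.2 hne)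
  have hfreq := frequently_lt_of_summable hw hb (half_pos hpos)
  have hev : ∀ᶠ n in atTop, |s₁ - s₂| / 2 <
      |∑ k ∈ Finset.range (n + 1), (weight μ ρ k * ⟪h k, genSeq lam μ ρ j k⟫
        - weight μ ρ k * ⟪j k, genSeq lam μ ρ h k⟫)| :=
    hlim.abs.eventually (lt_mem_nhds (half_lt_self hpos))
  obtain ⟨n, hn1, hn2⟩ := (hfreq.and_eventually hev).exists
  exact absurd hn1 (not_lt.2 hn2.le)

/-- The energy is bounded by the quadratic form on the maximal domain. -/
theorem energy_le (hlam : 0 < lam) (hμ : 0 < μ) (hρ : 0 < ρ) {h : ∀ N, X (Fin N)}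
    (hh : Summable fun N => weight μ ρ N * ‖h N‖ ^ 2) {s : ℝ}
    (h1 : HasSum (fun N => weight μ ρ N * ⟪h N, genSeq lam μ ρ h N⟫) s) (n : ℕ) :
    μ * ∑ k ∈ Finset.range n, weight μ ρ k * exchange h k
      - lam * ρ / μ * ∑ k ∈ Finset.range (n + 1), weight μ ρ k * ⟪h k, kacOp k (h k)⟫ ≤ -s := by
  have hlim := h1.tendsto_sum_nat.comp (tendsto_add_atTop_nat 1)
  refine le_of_forall_pos_le_add fun η hη => ?_
  have hw : Summable fun n => weight μ ρ n * ‖h n‖ ^ 2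
        + weight μ ρ (n + 1) * ‖h (n + 1)‖ ^ 2 := hh.add ((summable_nat_add_iff 1).2 hh)
  have hb : ∀ n : ℕ, μ * (weight μ ρ n * |⟪h n, annihOp n (h (n + 1))⟫|)
      ≤ (μ * (1 + ρ / μ)) * ((n : ℝ) + 1) * (weight μ ρ n * ‖h n‖ ^ 2
        + weight μ ρ (n + 1) * ‖h (n + 1)‖ ^ 2) := fun n => by
    refine (mul_le_mul_of_nonneg_left (boundary_le hμ hρ h h n) hμ.le).trans_eq ?_
    ring
  have hfreq := frequently_lt_of_summable hw hb (half_pos hη)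
  have hev : ∀ᶠ m in atTop, s - η / 2 <
      ∑ k ∈ Finset.range (m + 1), weight μ ρ k * ⟪h k, genSeq lam μ ρ h k⟫ :=
    hlim.eventually (lt_mem_nhds (by linarith))
  -- The energies increase with the cut, so the bound at n follows from that at some later level m
  -- with small boundary term and partial sum close to s.
  obtain ⟨m, hm1, hm2, hm3⟩ := (hfreq.and_eventually (hev.and (eventually_ge_atTop n))).exists
  have hE : ∑ k ∈ Finset.range n, weight μ ρ k * exchange h k
      ≤ ∑ k ∈ Finset.range m, weight μ ρ k * exchange h k :=
    Finset.sum_le_sum_of_subset_of_nonneg (Finset.range_mono hm3) fun k _ _ =>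
      mul_nonneg (weight_pos hμ hρ k).le (exchange_nonneg h k)
  have hK : ∑ k ∈ Finset.range (m + 1), weight μ ρ k * ⟪h k, kacOp k (h k)⟫
      ≤ ∑ k ∈ Finset.range (n + 1), weight μ ρ k * ⟪h k, kacOp k (h k)⟫ := by
    rw [← neg_le_neg_iff, ← Finset.sum_neg_distrib, ← Finset.sum_neg_distrib]
    refine Finset.sum_le_sum_of_subset_of_nonneg (Finset.range_mono (by omega)) fun k _ _ => ?_
    have := mul_nonneg (weight_pos hμ hρ k).le (neg_nonneg.2 (inner_kacOp_nonpos (h k)))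
    linarith
  rw [sum_inner_genSeq hρ] at hm2
  have hEq : ∑ k ∈ Finset.range m, weight μ ρ k * (⟪h k, h k⟫ - ⟪h k, annihOp k (h (k + 1))⟫
      - ⟪h k, annihOp k (h (k + 1))⟫ + ⟪h (k + 1), h (k + 1)⟫)
      = ∑ k ∈ Finset.range m, weight μ ρ k * exchange h k := by
    refine Finset.sum_congr rfl fun k _ => ?_
    rw [exchange, real_inner_self_eq_norm_sq, real_inner_self_eq_norm_sq]
    ring
  rw [hEq, mul_sub, real_inner_self_eq_norm_sq] at hm2
  have hκ : 0 ≤ lam * ρ / μ := by positivity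
  have hB : μ * (weight μ ρ m * ⟪h m, annihOp m (h (m + 1))⟫) < η / 2 := by
    refine lt_of_le_of_lt ?_ hm1
    have := (weight_pos hμ hρ m).le
    gcongr
    exact le_abs_self _
  have hN : 0 ≤ μ * (weight μ ρ m * ‖h m‖ ^ 2) := by
    have := weight_pos hμ hρ m
    positivity
  have hE' := mul_le_mul_of_nonneg_left hE hμ.le
  have hK' := mul_le_mul_of_nonneg_left hK hκ
  rw [mul_sub] at hm2
  linarith

end Sequences

/-! ### Poincaré inequalities for the Poisson weights -/

section PoissonLimit

/-- Only the terms of index 0 and 1 depend on n, so the limit passes through the sum without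
domination. -/
theorem tendsto_sum_of_eventually_eq {x : ℕ → ℕ → ℝ} {y : ℕ → ℝ} {s : ℝ} {p : ℕ → ℕ}
    (hp : Tendsto p atTop atTop) (h2 : ∀ n k, 2 ≤ k → x n k = y k)
    (hx : ∀ k, Tendsto (fun n => x n k) atTop (𝓝 (y k))) (hy : HasSum y s) :
    Tendsto (fun n => ∑ k ∈ Finset.range (p n), x n k) atTop (𝓝 s) := by
  have h1 : Tendsto (fun n => ∑ k ∈ Finset.range (p n), y k
      + ∑ k ∈ Finset.range 2, (x n k - y k)) atTop (𝓝 (s + ∑ k ∈ Finset.range 2, (y k - y k))) :=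
    (hy.tendsto_sum_nat.comp hp).add
      (tendsto_finsetSum _ fun k _ => (hx k).sub tendsto_const_nhds)
  simp only [sub_self, Finset.sum_const_zero, add_zero] at h1
  refine h1.congr' ?_
  filter_upwards [hp.eventually_ge_atTop 2] with n hn
  symm
  rw [← sub_eq_iff_eq_add', ← Finset.sum_sub_distrib]
  refine (Finset.sum_subset (Finset.range_mono hn) fun k _ hk => ?_).symm
  rw [h2 n k (by simpa only [Finset.mem_range, not_lt] using hk), sub_self]

/-- A truncated sequence need not satisfy the moment conditions exactly. The correction δ of its
first two entries restores them and tends to 0. -/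
theorem poincare_limit {H : Type*} [NormedAddCommGroup H] {a : ℕ → ℝ} {t c : ℝ} {g : ℕ → H} {δ : ℕ → ℕ → H} (hδ0 : ∀ n k, 2 ≤ k → δ n k = 0)
    (hδ : ∀ k, Tendsto (fun n => δ n k) atTop (𝓝 0))
    (hle : ∀ᶠ n in atTop, c * ∑ k ∈ Finset.range (n + 1), a k * ‖g k - δ n k‖ ^ 2
      ≤ t * ∑ k ∈ Finset.range n, a k * ‖(g (k + 1) - δ n (k + 1)) - (g k - δ n k)‖ ^ 2)
    {G D : ℝ} (hG : HasSum (fun k => a k * ‖g k‖ ^ 2) G)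
    (hD : HasSum (fun k => a k * ‖g (k + 1) - g k‖ ^ 2) D) : c * G ≤ t * D := by
  have hlim : ∀ k, Tendsto (fun n => g k - δ n k) atTop (𝓝 (g k)) := fun k => by
    simpa using tendsto_const_nhds.sub (hδ k)
  refine le_of_tendsto_of_tendsto
    ((tendsto_sum_of_eventually_eq (tendsto_add_atTop_nat 1) (fun n k hk => ?_) (fun k => ?_)
      hG).const_mul c)
    ((tendsto_sum_of_eventually_eq tendsto_id (fun n k hk => ?_) (fun k => ?_) hD).const_mul t)
    hle
  · rw [hδ0 n k hk, sub_zero]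
  · exact ((hlim k).norm.pow 2).const_mul _
  · rw [hδ0 n k hk, hδ0 n (k + 1) (by omega), sub_zero, sub_zero]
  · exact (((hlim (k + 1)).sub (hlim k)).norm.pow 2).const_mul _

variable {H : Type*} [NormedAddCommGroup H] [InnerProductSpace ℝ H]
  {a : ℕ → ℝ} {t : ℝ}

theorem poincare (ha : ∀ n, 0 < a n) (ht : 0 < t)
    (hrec : ∀ n : ℕ, a (n + 1) * (n + 1) = t * a n) {g : ℕ → H}
    (h0 : HasSum (fun k => a k • g k) 0)
    {G D : ℝ} (hG : HasSum (fun k => a k * ‖g k‖ ^ 2) G)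
    (hD : HasSum (fun k => a k * ‖g (k + 1) - g k‖ ^ 2) D) : G ≤ t * D := by
  rw [← one_mul G]
  refine poincare_limit (δ := fun n k =>
    if k = 0 then (a 0)⁻¹ • ∑ k ∈ Finset.range (n + 1), a k • g k else 0)
    (fun n k hk => if_neg (by omega)) (fun k => ?_) (Eventually.of_forall fun n => ?_) hG hD
  · by_cases hk : k = 0
    · simp only [hk, if_true]
      simpa using (h0.tendsto_sum_nat.comp (tendsto_add_atTop_nat 1)).const_smul (a 0)⁻¹
    · simp only [hk, if_false]
      exact tendsto_const_nhds
  · rw [one_mul]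
    refine poincare_truncated ha ht hrec _ n ?_
    simp only [smul_sub, Finset.sum_sub_distrib, smul_ite, smul_zero, Finset.sum_ite_eq',
      Finset.mem_range, Nat.succ_pos, if_true, smul_smul, mul_inv_cancel₀ (ha 0).ne', one_smul,
      sub_self]

theorem second_poincare (ha : ∀ n, 0 < a n) (ht : 0 < t)
    (hrec : ∀ n : ℕ, a (n + 1) * (n + 1) = t * a n) {g : ℕ → H}
    (h0 : HasSum (fun k => a k • g k) 0) (h1 : HasSum (fun k : ℕ => (k : ℝ) • a k • g k) 0)
    {G D : ℝ} (hG : HasSum (fun k => a k * ‖g k‖ ^ 2) G)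
    (hD : HasSum (fun k => a k * ‖g (k + 1) - g k‖ ^ 2) D) : 2 * G ≤ t * D := by
  have hl0 := h0.tendsto_sum_nat.comp (tendsto_add_atTop_nat 1)
  have hl1 := h1.tendsto_sum_nat.comp (tendsto_add_atTop_nat 1)
  -- Two corrections for two conditions: entry 1 restores the first moment, and entry 0, which does
  -- not affect it, then restores the mean.
  refine poincare_limit (δ := fun n k =>
    (if k = 0 then (a 0)⁻¹ • (∑ k ∈ Finset.range (n + 1), a k • g k
      - ∑ k ∈ Finset.range (n + 1), (k : ℝ) • a k • g k) else 0)
    + if k = 1 then (a 1)⁻¹ • ∑ k ∈ Finset.range (n + 1), (k : ℝ) • a k • g k else 0)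
    (fun n k hk => by rw [if_neg (by omega), if_neg (by omega), add_zero]) (fun k => ?_) ?_ hG hD
  · rw [show 𝓝 (0 : H) = 𝓝 (0 + 0) by rw [add_zero]]
    refine Tendsto.add ?_ ?_
    · by_cases hk : k = 0
      · simp only [hk, if_true]
        simpa using (hl0.sub hl1).const_smul (a 0)⁻¹
      · simp only [hk, if_false]
        exact tendsto_const_nhds
    · by_cases hk : k = 1
      · simp only [hk, if_true]
        simpa using hl1.const_smul (a 1)⁻¹
      · simp only [hk, if_false]
        exact tendsto_const_nhds
  · filter_upwards [eventually_ge_atTop 1] with n hn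
    have hn' : 1 < n + 1 := by omega
    refine second_poincare_truncated ha ht hrec _ n ?_ ?_
    · simp only [smul_sub, smul_add, Finset.sum_sub_distrib, Finset.sum_add_distrib, smul_ite,
        smul_zero, Finset.sum_ite_eq', Finset.mem_range, Nat.succ_pos, hn', if_true, smul_smul,
        mul_inv_cancel₀ (ha 0).ne', mul_inv_cancel₀ (ha 1).ne', one_smul]
      abel
    · simp only [smul_sub, smul_add, Finset.sum_sub_distrib, Finset.sum_add_distrib, smul_ite,
        smul_zero, Finset.sum_ite_eq', Finset.mem_range, Nat.succ_pos, hn', if_true, smul_smul,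
        Nat.cast_zero, zero_mul, zero_smul, Nat.cast_one, one_mul,
        mul_inv_cancel₀ (ha 1).ne', one_smul]
      abel

end PoissonLimit

/-! ### The bound on the quadratic form -/

section FormBound

variable {lam μ ρ : ℝ} {h : ∀ N, X (Fin N)} {φ : ℕ → X (Fin 1)} {f : X (Fin 1)} {n₀ : ℝ}

theorem mean_eq_zero_of_marg (hφ : ∀ N (i : Fin N), marg i (h N) = φ N) (N : ℕ) :
    mean (φ (N + 1)) = 0 := by
  rw [← hφ (N + 1) 0, mean_marg]

theorem mean_eq_zero_of_hasSum (hφ : ∀ N (i : Fin N), marg i (h N) = φ N)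
    (hf : HasSum (fun M => weight μ ρ M • φ (M + 1)) f) : mean f = 0 := by
  have h1 := hf.mapL (mean (N := 1))
  simp only [map_smul, mean_eq_zero_of_marg hφ, smul_zero] at h1
  exact h1.unique hasSum_zero

theorem summable_mean (hμ : 0 < μ) (hρ : 0 < ρ)
    (hh : Summable fun N => weight μ ρ N * ‖h N‖ ^ 2) :
    Summable fun N => weight μ ρ N * ‖mean (h N)‖ ^ 2 := by
  refine hh.of_nonneg_of_le (fun N => ?_) fun N => ?_
  · have := (weight_pos hμ hρ N).le
    positivity
  · refine mul_le_mul_of_nonneg_left ?_ (weight_pos hμ hρ N).le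
    have h1 := norm_mean_sq_add_le (h N)
    have h2 : 0 ≤ ∑ i, ‖marg i (h N)‖ ^ 2 := Finset.sum_nonneg fun i _ => sq_nonneg _
    linarith

theorem summable_marg (hμ : 0 < μ) (hρ : 0 < ρ)
    (hh : Summable fun N => weight μ ρ N * ‖h N‖ ^ 2)
    (hφ : ∀ N (i : Fin N), marg i (h N) = φ N) :
    Summable fun N : ℕ => weight μ ρ N * (N * ‖φ N‖ ^ 2) := by
  refine hh.of_nonneg_of_le (fun N => ?_) fun N => ?_
  · have := (weight_pos hμ hρ N).le
    positivity
  · refine mul_le_mul_of_nonneg_left ?_ (weight_pos hμ hρ N).le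
    have h1 := norm_mean_sq_add_le (h N)
    simp only [hφ, Finset.sum_const, Finset.card_univ, Fintype.card_fin, nsmul_eq_mul] at h1
    have h2 := sq_nonneg ‖mean (h N)‖
    linarith

theorem weight_mul_div (hμ : 0 < μ) (hρ : 0 < ρ) (N : ℕ) :
    weight μ ρ N = ρ / μ * (weight μ ρ (N + 1) * ((N : ℝ) + 1)) := by
  rw [weight_succ_mul]
  field_simp

theorem summable_marg_succ (hμ : 0 < μ) (hρ : 0 < ρ)
    (hh : Summable fun N => weight μ ρ N * ‖h N‖ ^ 2)
    (hφ : ∀ N (i : Fin N), marg i (h N) = φ N) :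
    Summable fun N : ℕ => weight μ ρ N * ‖φ (N + 1)‖ ^ 2 := by
  refine (((summable_nat_add_iff 1).2 (summable_marg hμ hρ hh hφ)).mul_left (ρ / μ)).congr
    fun N => ?_
  rw [weight_mul_div hμ hρ N]
  push_cast
  ring

theorem summable_weight_smul {H : Type*} [NormedAddCommGroup H] [NormedSpace ℝ H]
    [CompleteSpace H] (hμ : 0 < μ) (hρ : 0 < ρ) {g : ℕ → H}
    (hg : Summable fun N => weight μ ρ N * ‖g N‖ ^ 2) : Summable fun N => weight μ ρ N • g N := by
  refine Summable.of_norm_bounded ((hasSum_weight μ ρ).summable.add hg) fun N => ?_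
  have ha := weight_pos hμ hρ N
  rw [norm_smul, Real.norm_eq_abs, abs_of_pos ha]
  nlinarith [mul_nonneg ha.le (sq_nonneg (‖g N‖ - 1)), mul_nonneg ha.le (sq_nonneg ‖g N‖)]

/-- The exchange energy counts everything twice except the best approximation ∑ f(v_i). The means
are orthogonal to the first two Poisson modes, so `second_poincare` gives the factor 2. The
marginals φ_N count once, and their fluctuation around f gains a second count by `poincare`. The
rest is covered by the local bound. -/
theorem exchange_sum_lower_bound (hμ : 0 < μ) (hρ : 0 < ρ)
    (hh : HasSum (fun N => weight μ ρ N * ‖h N‖ ^ 2) n₀)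
    (hφ : ∀ N (i : Fin N), marg i (h N) = φ N)
    (hf : HasSum (fun M => weight μ ρ M • φ (M + 1)) f)
    (h0 : HasSum (fun N => weight μ ρ N • mean (h N)) 0)
    (h1 : HasSum (fun N : ℕ => (N : ℝ) • weight μ ρ N • mean (h N)) 0)
    {s : ℝ} (hs : HasSum (fun k => weight μ ρ k * exchange h k) s) :
    2 * n₀ - μ / ρ * ‖f‖ ^ 2 ≤ μ / ρ * s := by
  set t := μ / ρ with ht
  have htpos : 0 < t := by positivity
  have ha := fun N => weight_pos hμ hρ N
  have hm := summable_mean hμ hρ hh.summable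
  have hp := summable_marg hμ hρ hh.summable hφ
  have hq := summable_marg_succ hμ hρ hh.summable hφ
  -- Multiplication by t a_k = (k+1)a_{k+1} cancels the denominator in the local bound and moves the
  -- remainder to level k + 1.
  have hloc : ∀ k : ℕ, t * (weight μ ρ k * ‖mean (h (k + 1)) - mean (h k)‖ ^ 2)
      + t * (weight μ ρ k * (k * ‖φ (k + 1) - φ k‖ ^ 2))
      + (2 * (weight μ ρ (k + 1) * ‖h (k + 1)‖ ^ 2)
        - 2 * (weight μ ρ (k + 1) * ‖mean (h (k + 1))‖ ^ 2)
        - weight μ ρ (k + 1) * (((k + 1 : ℕ) : ℝ) * ‖φ (k + 1)‖ ^ 2))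
      ≤ t * (weight μ ρ k * exchange h k) := by
    intro k
    have h2 := mul_le_mul_of_nonneg_left (exchange_lower_bound (hφ k) (hφ (k + 1)))
      (mul_pos htpos (ha k)).le
    have h3 : t * weight μ ρ k = weight μ ρ (k + 1) * ((k : ℝ) + 1) := (weight_succ_mul μ ρ k).symm
    have h0 : (k : ℝ) + 1 ≠ 0 := by positivity
    have h4 : t * weight μ ρ k * ((2 * ‖h (k + 1)‖ ^ 2 - 2 * ‖mean (h (k + 1))‖ ^ 2
        - ((k : ℝ) + 1) * ‖φ (k + 1)‖ ^ 2) / ((k : ℝ) + 1))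
        = 2 * (weight μ ρ (k + 1) * ‖h (k + 1)‖ ^ 2)
        - 2 * (weight μ ρ (k + 1) * ‖mean (h (k + 1))‖ ^ 2)
        - weight μ ρ (k + 1) * (((k + 1 : ℕ) : ℝ) * ‖φ (k + 1)‖ ^ 2) := by
      rw [h3]
      push_cast
      field_simp
    rw [mul_add, mul_add, h4] at h2
    unfold exchange
    linarith
  have hrest : Summable fun k : ℕ => (2 * (weight μ ρ (k + 1) * ‖h (k + 1)‖ ^ 2)
        - 2 * (weight μ ρ (k + 1) * ‖mean (h (k + 1))‖ ^ 2)
        - weight μ ρ (k + 1) * (((k + 1 : ℕ) : ℝ) * ‖φ (k + 1)‖ ^ 2)) :=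
    ((((summable_nat_add_iff 1).2 hh.summable).mul_left 2).sub
      (((summable_nat_add_iff 1).2 hm).mul_left 2)).sub ((summable_nat_add_iff 1).2 hp)
  have hub := (hs.summable.mul_left t).sub hrest
  have hA0 : ∀ k, 0 ≤ weight μ ρ k * ‖mean (h (k + 1)) - mean (h k)‖ ^ 2 := fun k =>
    mul_nonneg (ha k).le (sq_nonneg _)
  have hB0 : ∀ k : ℕ, 0 ≤ weight μ ρ k * (k * ‖φ (k + 1) - φ k‖ ^ 2) := fun k =>
    mul_nonneg (ha k).le (by positivity)
  have hA : Summable fun k => weight μ ρ k * ‖mean (h (k + 1)) - mean (h k)‖ ^ 2 := by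
    refine (summable_mul_left_iff htpos.ne').1 (hub.of_nonneg_of_le
      (fun k => mul_nonneg htpos.le (hA0 k)) fun k => ?_)
    have h2 := hloc k
    have h3 := mul_nonneg htpos.le (hB0 k)
    linarith
  have hB : Summable fun k : ℕ => weight μ ρ k * (k * ‖φ (k + 1) - φ k‖ ^ 2) := by
    refine (summable_mul_left_iff htpos.ne').1 (hub.of_nonneg_of_le
      (fun k => mul_nonneg htpos.le (hB0 k)) fun k => ?_)
    have h2 := hloc k
    have h3 := mul_nonneg htpos.le (hA0 k)
    linarith
  obtain ⟨A, hA⟩ := hA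
  obtain ⟨B, hB⟩ := hB
  obtain ⟨m, hm⟩ := hm
  obtain ⟨p, hp⟩ := hp
  obtain ⟨q, hq⟩ := hq
  -- the mean
  have hpm : 2 * m ≤ t * A := second_poincare ha htpos (weight_succ_mul μ ρ) h0 h1 hm hA
  -- the marginals
  have hpq : p = t * q := by
    refine hp.unique ?_
    exact hasSum_weight_shift (F := fun N => ‖φ (N + 1)‖ ^ 2) (G := fun N => ‖φ N‖ ^ 2)
      (fun N => rfl) hq
  -- The size-biased sum of marginal differences, shifted by one level, is an unbiased Poisson sum
  -- for k ↦ φ_{k+1} - f, which is centred.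
  have hB' : HasSum (fun k => weight μ ρ k
      * ‖(φ (k + 1 + 1) - f) - (φ (k + 1) - f)‖ ^ 2) (B / t) := by
    have h2 := ((hasSum_nat_add_iff' 1).2 hB).div_const t
    simp only [Finset.range_one, Finset.sum_singleton, Nat.cast_zero, zero_mul, mul_zero,
      sub_zero] at h2
    refine h2.congr_fun fun k => ?_
    have h3 : t * weight μ ρ k = weight μ ρ (k + 1) * ((k : ℝ) + 1) := (weight_succ_mul μ ρ k).symm
    rw [sub_sub_sub_cancel_right, eq_div_iff htpos.ne']
    push_cast
    rw [← mul_assoc, ← h3]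
    ring
  have hf0 : HasSum (fun k => weight μ ρ k • (φ (k + 1) - f)) 0 := by
    have h2 := hf.sub ((hasSum_weight μ ρ).smul_const f)
    rw [one_smul, sub_self] at h2
    exact h2.congr_fun fun k => smul_sub _ _ _
  have hfn : HasSum (fun k => weight μ ρ k * ‖φ (k + 1) - f‖ ^ 2) (q - ‖f‖ ^ 2) := by
    have h2 := (hq.sub ((hf.mapL (innerSL ℝ f)).mul_left 2)).add
      ((hasSum_weight μ ρ).mul_right (‖f‖ ^ 2))
    simp only [innerSL_apply_apply, real_inner_self_eq_norm_sq, one_mul] at h2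
    have h3 : q - 2 * ‖f‖ ^ 2 + ‖f‖ ^ 2 = q - ‖f‖ ^ 2 := by ring
    rw [h3] at h2
    refine h2.congr_fun fun k => ?_
    rw [norm_sub_sq_real, inner_smul_right, real_inner_comm]
    ring
  have hpf : q - ‖f‖ ^ 2 ≤ t * (B / t) :=
    poincare ha htpos (weight_succ_mul μ ρ) hf0 hfn hB'
  rw [mul_div_cancel₀ _ htpos.ne'] at hpf
  -- summation
  have hsum := hasSum_le hloc (((hA.mul_left t).add (hB.mul_left t)).add
    (((((hasSum_nat_add_iff' 1).2 hh).mul_left 2).sub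
      (((hasSum_nat_add_iff' 1).2 hm).mul_left 2)).sub ((hasSum_nat_add_iff' 1).2 hp)))
    (hs.mul_left t)
  simp only [Finset.range_one, Finset.sum_singleton, Nat.cast_zero, zero_mul, mul_zero,
    sub_zero] at hsum
  -- The remainders are summed from level 1 on. The missing level 0 contributes nothing, since
  -- without variables a function is its own mean.
  have hzero : ‖h 0‖ = ‖mean (h 0)‖ := by
    have h2 := integrateOut_univ (h 0)
    have h3 : (Finset.univ : Finset (Fin 0)) = ∅ := rfl
    rw [h3, integrateOut_empty] at h2
    rw [h2, norm_const, ← h2]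
  rw [hzero] at hsum
  have hB2 := mul_le_mul_of_nonneg_left hpf htpos.le
  rw [hpq] at hsum
  linarith

/-- Put S = ∑ f(v_i). Nonpositivity of K on x - S gives -⟨x, Kx⟩ ≥ -2⟨x, KS⟩ + ⟨S, KS⟩. The cross
term is compared with the mean-field value -t∑ (oneKac f)(v_i) of KS, and the error is split by
Cauchy-Schwarz with weights s⁻¹ and s. -/
theorem kac_lower_bound {N : ℕ} (t : ℝ) {s : ℝ} (hs : 0 < s) {x : X (Fin N)} {p : X (Fin 1)}
    (hx : ∀ i, marg i x = p) (hf : mean f = 0) :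
    -(s⁻¹ * (‖x‖ ^ 2 - 2 * (N * ⟪p, f⟫) + N * ‖f‖ ^ 2))
      - s * (N * ((N : ℝ) - 1) * (⟪f, oneKac f⟫ - ‖oneKac f‖ ^ 2)
        + N * ((N : ℝ) - 1 - t) ^ 2 * ‖oneKac f‖ ^ 2)
      + (N * ((N : ℝ) - 1) * ⟪f, oneKac f⟫ - 2 * t * (N * ⟪f, oneKac f⟫))
      + 2 * t * (N * ⟪p, oneKac f⟫) ≤ -⟪x, kacOp N x⟫ := by
  have h1 := inner_kacOp_nonpos (x - sumSingle N f)
  have h2 : ⟪x - sumSingle N f, kacOp N (x - sumSingle N f)⟫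
      = ⟪x, kacOp N x⟫ - 2 * ⟪x, kacOp N (sumSingle N f)⟫
        + ⟪sumSingle N f, kacOp N (sumSingle N f)⟫ := by
    have h3 : ⟪sumSingle N f, kacOp N x⟫ = ⟪x, kacOp N (sumSingle N f)⟫ := by
      rw [← inner_kacOp_left, real_inner_comm]
    rw [map_sub, inner_sub_left, inner_sub_right, inner_sub_right, h3]
    ring
  have h4 := two_mul_abs_inner_le (inv_pos.2 hs) (x - sumSingle N f)
    (kacOp N (sumSingle N f) + t • sumSingle N (oneKac f))
  have h5 := le_abs_self ⟪x - sumSingle N f,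
    kacOp N (sumSingle N f) + t • sumSingle N (oneKac f)⟫
  have h6 : ‖x - sumSingle N f‖ ^ 2 = ‖x‖ ^ 2 - 2 * (N * ⟪p, f⟫) + N * ‖f‖ ^ 2 := by
    rw [norm_sub_sq_real, inner_sumSingle_right hx hf, norm_sumSingle_sq hf]
  rw [inv_inv, norm_kacOp_sumSingle_add_sq, h6] at h4
  have h7 : ⟪x - sumSingle N f, kacOp N (sumSingle N f) + t • sumSingle N (oneKac f)⟫
      = ⟪x, kacOp N (sumSingle N f)⟫ + t * (N * ⟪p, oneKac f⟫)
        - ⟪sumSingle N f, kacOp N (sumSingle N f)⟫ - t * (N * ⟪f, oneKac f⟫) := by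
    rw [inner_sub_left, inner_add_right, inner_add_right, inner_smul_right, inner_smul_right,
      inner_sumSingle_right hx (mean_oneKac f), inner_sumSingle_sumSingle hf (mean_oneKac f)]
    ring
  rw [h2, inner_kacOp_sumSingle hf] at h1
  have h8 := (mul_le_mul_of_nonneg_left h5 zero_le_two).trans h4
  rw [h7, inner_kacOp_sumSingle hf] at h8
  linarith

/-- The exchange bound and the Kac bound, averaged over N. The Poisson average of the squared
Cauchy-Schwarz error is exactly t²⟨f, oneKac f⟩, as the ‖oneKac f‖² terms cancel; this is why s only
lowers the coefficient of that form to 1 - s. -/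
theorem form_upper_bound (hlam : 0 < lam) (hμ : 0 < μ) (hρ : 0 < ρ)
    (hh : HasSum (fun N => weight μ ρ N * ‖h N‖ ^ 2) n₀)
    (hφ : ∀ N (i : Fin N), marg i (h N) = φ N)
    (hf : HasSum (fun M => weight μ ρ M • φ (M + 1)) f)
    (h0 : HasSum (fun N => weight μ ρ N • mean (h N)) 0)
    (h1 : HasSum (fun N : ℕ => (N : ℝ) • weight μ ρ N • mean (h N)) 0)
    {q : ℝ} (hq : HasSum (fun N => weight μ ρ N * ⟪h N, genSeq lam μ ρ h N⟫) q)
    {s : ℝ} (hs : 0 < s) :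
    q ≤ -(ρ * (2 * n₀ - μ / ρ * ‖f‖ ^ 2))
      - lam * (μ / ρ) * (1 - s) * ⟪f, oneKac f⟫
      + lam * (ρ / μ) * s⁻¹ * (n₀ - μ / ρ * ‖f‖ ^ 2) := by
  have ha := fun N => weight_pos hμ hρ N
  have hκ : 0 < lam * ρ / μ := by positivity
  have hen := energy_le hlam hμ hρ hh.summable hq
  have hf0 := mean_eq_zero_of_hasSum hφ hf
  have hp : ∀ y : X (Fin 1), HasSum (fun N : ℕ => weight μ ρ N * (N * ⟪φ N, y⟫))
      (μ / ρ * ⟪f, y⟫) := fun y => by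
    refine hasSum_weight_shift (F := fun N => ⟪φ (N + 1), y⟫) (G := fun N => ⟪φ N, y⟫)
      (fun N => rfl) ?_
    have h2 := hf.mapL (innerSL ℝ y)
    simp only [innerSL_apply_apply, inner_smul_right] at h2
    rw [real_inner_comm]
    exact h2.congr_fun fun N => by rw [real_inner_comm]
  obtain ⟨E, hE⟩ : Summable fun k => weight μ ρ k * exchange h k := by
    refine summable_of_sum_range_le (c := -q / μ)
      (fun k => mul_nonneg (ha k).le (exchange_nonneg h k)) fun n => ?_
    rw [le_div_iff₀ hμ]
    have h2 := hen n
    have h3 : 0 ≤ -∑ k ∈ Finset.range (n + 1), weight μ ρ k * ⟪h k, kacOp k (h k)⟫ := by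
      rw [← Finset.sum_neg_distrib]
      refine Finset.sum_nonneg fun k _ => ?_
      have := mul_nonneg (ha k).le (neg_nonneg.2 (inner_kacOp_nonpos (h k)))
      linarith
    have h4 := mul_nonneg hκ.le h3
    linarith
  have hEb := exchange_sum_lower_bound hμ hρ hh hφ hf h0 h1 hE
  have hR := ((((((hh.sub ((hp f).mul_left 2)).add
      ((hasSum_weight_mul_id μ ρ).mul_right (‖f‖ ^ 2))).mul_left s⁻¹).neg).sub
      ((((hasSum_weight_mul_factorial_two μ ρ).mul_right
        (⟪f, oneKac f⟫ - ‖oneKac f‖ ^ 2)).add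
        ((hasSum_weight_mul_variance μ ρ).mul_right (‖oneKac f‖ ^ 2))).mul_left s)).add
      (((hasSum_weight_mul_factorial_two μ ρ).mul_right ⟪f, oneKac f⟫).sub
        (((hasSum_weight_mul_id μ ρ).mul_right ⟪f, oneKac f⟫).mul_left (2 * (μ / ρ))))).add
      ((hp (oneKac f)).mul_left (2 * (μ / ρ)))
  have hlim := ((hE.tendsto_sum_nat).const_mul μ).add
    ((hR.tendsto_sum_nat.comp (tendsto_add_atTop_nat 1)).const_mul (lam * ρ / μ))
  have hle := le_of_tendsto' hlim (b := -q) fun n => by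
    refine le_trans ?_ (hen n)
    rw [sub_eq_add_neg (μ * ∑ k ∈ Finset.range n, weight μ ρ k * exchange h k),
      ← mul_neg (lam * ρ / μ)]
    refine add_le_add le_rfl (mul_le_mul_of_nonneg_left ?_ hκ.le)
    rw [← Finset.sum_neg_distrib]
    refine Finset.sum_le_sum fun k _ => ?_
    have h2 := mul_le_mul_of_nonneg_left (kac_lower_bound (μ / ρ) hs (hφ k) hf0) (ha k).le
    rw [mul_neg] at h2
    refine le_trans (le_of_eq ?_) h2
    ring
  rw [real_inner_self_eq_norm_sq] at hle
  have h5 : ρ * (2 * n₀ - μ / ρ * ‖f‖ ^ 2) ≤ μ * E := by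
    have := mul_le_mul_of_nonneg_left hEb hρ.le
    have h6 : ρ * (μ / ρ * E) = μ * E := by field_simp
    linarith
  have h7 : lam * ρ / μ * (-(s⁻¹ * (n₀ - 2 * (μ / ρ * ‖f‖ ^ 2) + μ / ρ * ‖f‖ ^ 2))
      - s * ((μ / ρ) ^ 2 * (⟪f, oneKac f⟫ - ‖oneKac f‖ ^ 2) + (μ / ρ) ^ 2 * ‖oneKac f‖ ^ 2)
      + ((μ / ρ) ^ 2 * ⟪f, oneKac f⟫ - 2 * (μ / ρ) * (μ / ρ * ⟪f, oneKac f⟫))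
      + 2 * (μ / ρ) * (μ / ρ * ⟪f, oneKac f⟫))
      = lam * (μ / ρ) * (1 - s) * ⟪f, oneKac f⟫
        - lam * (ρ / μ) * s⁻¹ * (n₀ - μ / ρ * ‖f‖ ^ 2) := by
    field_simp
    ring
  rw [h7] at hle
  linarith

end FormBound

/-! ### Moments of the Maxwellian and completeness of the polynomials -/

section Moments

theorem memLp_pow (n : ℕ) : MemLp (fun x : ℝ => x ^ n) 2 maxwellian := by
  rw [maxwellian_eq]
  have h : MemLp (fun x : ℝ => x ^ n) 2 (ProbabilityTheory.gaussianReal 0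
      (1 / (2 * Real.pi)).toNNReal) := by
    rcases Nat.eq_zero_or_pos n with rfl | hn
    · simpa using memLp_const (1 : ℝ)
    have h1 := (ProbabilityTheory.memLp_id_gaussianReal (μ := 0)
      (v := Real.toNNReal (1 / (2 * Real.pi))) (n * 2 : ℕ)).integrable_norm_pow (by positivity)
    rw [memLp_two_iff_integrable_sq (by fun_prop)]
    refine h1.congr (Eventually.of_forall fun x => ?_)
    simp only [id, Real.norm_eq_abs]
    rw [← pow_mul, (Even.mul_left even_two n).pow_abs]
  exact h

theorem integrable_pow (n : ℕ) : Integrable (fun x : ℝ => x ^ n) maxwellian :=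
  (memLp_pow n).integrable (by norm_num)

theorem integrable_maxwellian_iff (f : ℝ → ℝ) :
    Integrable f maxwellian ↔ Integrable fun x => Real.exp (-(Real.pi * x ^ 2)) * f x := by
  rw [maxwellian, integrable_withDensity_iff_integrable_smul' (by fun_prop)
    (Eventually.of_forall fun _ => ENNReal.ofReal_lt_top)]
  refine integrable_congr (Eventually.of_forall fun x => ?_)
  simp only [ENNReal.toReal_ofReal (Real.exp_pos _).le, smul_eq_mul]

/-- The moments of the Maxwellian. -/
def moment (n : ℕ) : ℝ := ∫ x, x ^ n ∂maxwellian

theorem moment_zero : moment 0 = 1 := by simp [moment]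

/-- The integrand times the density is the derivative of e^{-πx²}xⁿ. For n = 0 the truncated
exponent n - 1 is harmless because of its factor n. -/
theorem integral_deriv_maxwellian_pow (n : ℕ) :
    ∫ x, ((n : ℝ) * x ^ (n - 1) - 2 * Real.pi * x ^ (n + 1)) ∂maxwellian = 0 := by
  have hi : Integrable (fun x : ℝ => (n : ℝ) * x ^ (n - 1) - 2 * Real.pi * x ^ (n + 1))
      maxwellian := ((integrable_pow _).const_mul _).sub ((integrable_pow _).const_mul _)
  rw [integral_maxwellian]
  refine integral_eq_zero_of_hasDerivAt_of_integrable
    (f := fun x : ℝ => Real.exp (-(Real.pi * x ^ 2)) * x ^ n) (fun x => ?_)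
    ((integrable_maxwellian_iff _).1 hi) ((integrable_maxwellian_iff _).1 (integrable_pow n))
  have h1 := ((((hasDerivAt_id x).pow 2).const_mul Real.pi).neg.exp).mul ((hasDerivAt_id x).pow n)
  refine h1.congr_deriv ?_
  simp only [id, Pi.pow_apply, Pi.neg_apply]
  push_cast
  ring

theorem moment_one : moment 1 = 0 := by
  have h := integral_deriv_maxwellian_pow 0
  simp only [Nat.cast_zero, zero_mul, zero_sub, zero_add] at h
  rw [integral_neg, integral_const_mul, neg_eq_zero] at h
  exact (mul_eq_zero.1 h).resolve_left (by positivity)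

theorem moment_add_two (n : ℕ) : 2 * Real.pi * moment (n + 2) = (n + 1) * moment n := by
  have h := integral_deriv_maxwellian_pow (n + 1)
  rw [integral_sub ((integrable_pow _).const_mul _) ((integrable_pow _).const_mul _),
    integral_const_mul, integral_const_mul, sub_eq_zero] at h
  push_cast at h
  exact h.symm

theorem integrable_exp_abs_mul (t : ℝ) : MemLp (fun x : ℝ => Real.exp |t * x|) 2 maxwellian := by
  rw [memLp_two_iff_integrable_sq (by fun_prop), maxwellian_eq]
  refine ((ProbabilityTheory.integrable_exp_mul_gaussianReal (2 * t)).add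
    (ProbabilityTheory.integrable_exp_mul_gaussianReal (-(2 * t)))).mono'
    (by fun_prop) (Eventually.of_forall fun x => ?_)
  simp only [Pi.add_apply]
  rw [Real.norm_eq_abs, abs_of_nonneg (by positivity), ← Real.exp_nat_mul]
  rcases abs_cases (t * x) with ⟨h, -⟩ | ⟨h, -⟩ <;> rw [h]
  · refine le_trans (le_of_eq ?_) (le_add_of_nonneg_right (Real.exp_pos _).le)
    push_cast
    ring_nf
  · refine le_trans (le_of_eq ?_) (le_add_of_nonneg_left (Real.exp_pos _).le)
    push_cast
    ring_nf

/-- Termwise integration of the exponential series, dominated by e^{|tx|}|F|, which is integrable as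
a product of two square integrable functions. -/
theorem integral_exp_mul_eq_zero {F : ℝ → ℝ} (hF : MemLp F 2 maxwellian)
    (h : ∀ m : ℕ, ∫ x, x ^ m * F x ∂maxwellian = 0) (t : ℝ) :
    ∫ x : ℝ, Complex.exp (t * x * Complex.I) * (F x : ℂ) ∂maxwellian = 0 := by
  have hsum : ∀ x : ℝ, HasSum (fun n : ℕ => |t * x| ^ n / (n.factorial : ℝ) * |F x|)
      (Real.exp |t * x| * |F x|) := fun x => by
    have h1 := NormedSpace.exp_series_hasSum_exp' (𝕂 := ℝ) |t * x|
    rw [← Real.exp_eq_exp_ℝ] at h1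
    refine (h1.mul_right |F x|).congr_fun fun n => ?_
    rw [smul_eq_mul]
    ring
  have h1 : HasSum (fun n : ℕ => ∫ x : ℝ, (t * x * Complex.I) ^ n / (n.factorial : ℂ)
      * (F x : ℂ) ∂maxwellian) (∫ x : ℝ, Complex.exp (t * x * Complex.I) * (F x : ℂ) ∂maxwellian) := by
    refine hasSum_integral_of_dominated_convergence
      (fun n x => |t * x| ^ n / (n.factorial : ℝ) * |F x|) (fun n => ?_)
      (fun n => Eventually.of_forall fun x => ?_) (Eventually.of_forall fun x => (hsum x).summable)
      ?_ (Eventually.of_forall fun x => ?_)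
    · have h2 : Continuous fun x : ℝ => ((t : ℂ) * x * Complex.I) ^ n / (n.factorial : ℂ) := by
        fun_prop
      exact h2.aestronglyMeasurable.mul
        (Complex.continuous_ofReal.comp_aestronglyMeasurable hF.1)
    · rw [norm_mul, norm_div, norm_pow, norm_mul, Complex.norm_I, mul_one, Complex.norm_real,
        Real.norm_eq_abs (F x), ← Complex.ofReal_mul, Complex.norm_real, Real.norm_eq_abs,
        Complex.norm_natCast]
    · simp only [(hsum _).tsum_eq]
      exact (integrable_exp_abs_mul t).integrable_mul hF.norm
    · have h2 := NormedSpace.exp_series_hasSum_exp' (𝕂 := ℂ) ((t : ℂ) * x * Complex.I)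
      rw [← Complex.exp_eq_exp_ℂ] at h2
      refine (h2.mul_right (F x : ℂ)).congr_fun fun n => ?_
      rw [smul_eq_mul]
      ring
  refine h1.unique ?_
  convert! hasSum_zero using 2 with n
  have h2 : ∀ x : ℝ, ((t : ℂ) * x * Complex.I) ^ n / (n.factorial : ℂ) * (F x : ℂ)
      = ((t : ℂ) * Complex.I) ^ n / (n.factorial : ℂ) * ((x ^ n * F x : ℝ) : ℂ) := fun x => by
    push_cast
    ring
  simp only [h2]
  rw [integral_const_mul, integral_complex_ofReal, h n]
  simp

theorem ae_eq_zero_of_moments {F : ℝ → ℝ} (hF : MemLp F 2 maxwellian)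
    (h : ∀ m : ℕ, ∫ x, x ^ m * F x ∂maxwellian = 0) : F =ᵐ[maxwellian] 0 := by
  wlog hFm : Measurable F generalizing F with H
  · have h1 := H ((memLp_congr_ae hF.1.ae_eq_mk).1 hF) (fun m => ?_)
      hF.1.stronglyMeasurable_mk.measurable
    · exact hF.1.ae_eq_mk.trans h1
    · rw [← h m]
      refine integral_congr_ae ?_
      filter_upwards [hF.1.ae_eq_mk] with x hx
      rw [hx]
  have hi : Integrable F maxwellian := hF.integrable (by norm_num)
  -- The truncation in `ENNReal.ofReal` makes these the measures of the positive and negative parts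
  -- of F; equality of their characteristic functions makes them equal.
  set P := maxwellian.withDensity fun x => ENNReal.ofReal (F x) with hP
  set Q := maxwellian.withDensity fun x => ENNReal.ofReal (-F x) with hQ
  have : IsFiniteMeasure P := isFiniteMeasure_withDensity_ofReal hi.hasFiniteIntegral
  have : IsFiniteMeasure Q := isFiniteMeasure_withDensity_ofReal hi.neg.hasFiniteIntegral
  have hPQ : P = Q := by
    refine Measure.ext_of_charFun (funext fun t => ?_)
    rw [charFun_apply_real, charFun_apply_real, hP, hQ,
      integral_withDensity_eq_integral_toReal_smul (by fun_prop)
        (Eventually.of_forall fun _ => ENNReal.ofReal_lt_top),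
      integral_withDensity_eq_integral_toReal_smul (by fun_prop)
        (Eventually.of_forall fun _ => ENNReal.ofReal_lt_top), ← sub_eq_zero]
    have hb : ∀ G : ℝ → ℝ, Integrable G maxwellian → Measurable G → Integrable (fun x : ℝ =>
        (ENNReal.ofReal (G x)).toReal • Complex.exp (t * x * Complex.I)) maxwellian := by
      intro G hG hGm
      refine hG.norm.mono' (by fun_prop) (Eventually.of_forall fun x => ?_)
      have h3 : ‖Complex.exp (t * x * Complex.I)‖ = 1 := by
        rw [← Complex.ofReal_mul, Complex.norm_exp_ofReal_mul_I]
      rw [norm_smul, h3, mul_one, ENNReal.toReal_ofReal', Real.norm_eq_abs, Real.norm_eq_abs,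
        abs_of_nonneg (le_max_right _ _)]
      exact max_le (le_abs_self _) (abs_nonneg _)
    rw [← integral_sub (hb _ hi hFm) (hb (fun x => -F x) hi.neg hFm.neg), ← integral_exp_mul_eq_zero hF h t]
    refine integral_congr_ae (Eventually.of_forall fun x => ?_)
    simp only [ENNReal.toReal_ofReal', ← sub_smul]
    have h4 : max (F x) 0 - max (-F x) 0 = F x := by
      rcases le_total 0 (F x) with h0 | h0
      · rw [max_eq_left h0, max_eq_right (neg_nonpos.2 h0), sub_zero]
      · rw [max_eq_right h0, max_eq_left (neg_nonneg.2 h0), zero_sub, neg_neg]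
    rw [h4, Complex.real_smul, mul_comm]
  have h5 := (withDensity_eq_iff (by fun_prop) (by fun_prop) ?_).1 hPQ
  · filter_upwards [h5] with x hx
    rcases le_total 0 (F x) with h0 | h0
    · rw [ENNReal.ofReal_of_nonpos (neg_nonpos.2 h0), ENNReal.ofReal_eq_zero] at hx
      exact le_antisymm hx h0
    · rw [ENNReal.ofReal_of_nonpos h0, eq_comm, ENNReal.ofReal_eq_zero] at hx
      exact le_antisymm h0 (neg_nonpos.1 hx)
  · exact (lintegral_ofReal_le_lintegral_enorm F).trans_lt hi.hasFiniteIntegral |>.ne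

end Moments

/-! ### Monomials -/

section Monomials

theorem measurePreserving_gauss_one :
    MeasurePreserving (fun v : Fin 1 → ℝ => v 0) (gauss (Fin 1)) maxwellian :=
  measurePreserving_eval (fun _ : Fin 1 => maxwellian) 0

theorem memLp_mono (n : ℕ) : MemLp (fun v : Fin 1 → ℝ => v 0 ^ n) 2 (gauss (Fin 1)) :=
  (memLp_pow n).comp_measurePreserving measurePreserving_gauss_one

/-- The monomial `v ↦ v^n`. -/
def mono (n : ℕ) : X (Fin 1) := (memLp_mono n).toLp _

theorem coeFn_mono (n : ℕ) : mono n =ᵐ[gauss (Fin 1)] fun v => v 0 ^ n := MemLp.coeFn_toLp _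

theorem inner_mono_mono (m n : ℕ) : ⟪mono m, mono n⟫ = moment (m + n) := by
  rw [L2.inner_def, moment, ← integral_pull measurePreserving_gauss_one (by fun_prop)]
  refine integral_congr_ae ?_
  filter_upwards [coeFn_mono m, coeFn_mono n] with v h1 h2
  rw [h1, h2]
  simp only [RCLike.inner_apply, conj_trivial]
  rw [pow_add, mul_comm]

theorem eq_zero_of_inner_mono {f : X (Fin 1)} (h : ∀ m, ⟪mono m, f⟫ = 0) : f = 0 := by
  have hmp : MeasurePreserving (fun (x : ℝ) (_ : Fin 1) => x) maxwellian (gauss (Fin 1)) :=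
    (measurePreserving_funUnique maxwellian (Fin 1)).symm
  have hF : MemLp (fun x : ℝ => f fun _ => x) 2 maxwellian :=
    (Lp.memLp f).comp_measurePreserving hmp
  have h0 := ae_eq_zero_of_moments hF fun m => by
    rw [← h m, L2.inner_def,
      ← integral_pull measurePreserving_gauss_one
        (f := fun x => x ^ m * f fun _ => x) ((memLp_pow m).1.mul hF.1)]
    refine integral_congr_ae ?_
    filter_upwards [coeFn_mono m] with v hv
    have h1 : (fun _ : Fin 1 => v 0) = v := by
      funext j
      rw [Subsingleton.elim j 0]
    rw [hv, h1]
    simp only [RCLike.inner_apply, conj_trivial]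
    rw [mul_comm]
  refine Lp.ext ?_
  filter_upwards [measurePreserving_gauss_one.quasiMeasurePreserving.ae h0,
    Lp.coeFn_zero ℝ 2 (gauss (Fin 1))] with v hv h2
  have h1 : (fun _ : Fin 1 => v 0) = v := by
    funext j
    rw [Subsingleton.elim j 0]
  rw [h2, ← h1]
  exact hv

/-- The polynomials of degree less than `d`. -/
def polyBelow (d : ℕ) : Submodule ℝ (X (Fin 1)) := Submodule.span ℝ (mono '' Set.Iio d)

theorem mono_mem_polyBelow {m d : ℕ} (h : m < d) : mono m ∈ polyBelow d :=
  Submodule.subset_span ⟨m, h, rfl⟩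

theorem polyBelow_mono {d e : ℕ} (h : d ≤ e) : polyBelow d ≤ polyBelow e :=
  Submodule.span_mono (Set.image_mono (Set.Iio_subset_Iio h))

theorem polyBelow_induction {d : ℕ} {f : X (Fin 1)} (hf : f ∈ polyBelow (d + 1)) :
    ∃ c : ℝ, ∃ g ∈ polyBelow d, f = c • mono d + g := by
  rw [polyBelow, ← Order.succ_eq_add_one, Order.Iio_succ_eq_insert, Set.image_insert_eq,
    Submodule.mem_span_insert] at hf
  exact hf

instance (d : ℕ) : FiniteDimensional ℝ (polyBelow d) :=
  FiniteDimensional.span_of_finite ℝ ((Set.finite_Iio d).image _)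

theorem dense_polyBelow : Dense (⋃ d, (polyBelow d : Set (X (Fin 1)))) := by
  have h : (⨆ d, polyBelow d).topologicalClosure = ⊤ := by
    rw [Submodule.topologicalClosure_eq_top_iff, Submodule.eq_bot_iff]
    refine fun f hf => eq_zero_of_inner_mono fun m => ?_
    exact (Submodule.mem_orthogonal _ _).1 hf _
      (Submodule.mem_iSup_of_mem (m + 1) (mono_mem_polyBelow m.lt_succ_self))
  rw [← Submodule.coe_iSup_of_directed]
  · exact Submodule.dense_iff_topologicalClosure_eq_top.2 h
  · exact directed_of_isDirected_le fun _ _ => polyBelow_mono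

end Monomials

/-! ### Collisions of powers -/

section CollidePowers

/-- The rate `(2π)⁻¹ ∫ (cos^m + sin^m)`. -/
def collideRate (m : ℕ) : ℝ :=
  (1 / (2 * Real.pi)) * ∫ θ in (0 : ℝ)..(2 * Real.pi), (Real.cos θ ^ m + Real.sin θ ^ m)

theorem collideRate_zero : collideRate 0 = 2 := by
  simp only [collideRate, pow_zero, intervalIntegral.integral_const, sub_zero, smul_eq_mul]
  field_simp
  norm_num

theorem collideRate_one : collideRate 1 = 0 := by
  rw [collideRate, intervalIntegral.integral_add
    (Continuous.intervalIntegrable (by fun_prop) _ _)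
    (Continuous.intervalIntegrable (by fun_prop) _ _)]
  simp

theorem collideRate_add_two (n : ℕ) :
    collideRate (n + 2) = ((n : ℝ) + 1) / (n + 2) * collideRate n := by
  rw [collideRate, collideRate, intervalIntegral.integral_add
    (Continuous.intervalIntegrable (by fun_prop) _ _)
    (Continuous.intervalIntegrable (by fun_prop) _ _), intervalIntegral.integral_add
    (Continuous.intervalIntegrable (by fun_prop) _ _)
    (Continuous.intervalIntegrable (by fun_prop) _ _), integral_sin_pow, integral_cos_pow]
  simp only [Real.sin_zero, Real.cos_zero, Real.sin_two_pi, Real.cos_two_pi, ne_eq,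
    Nat.add_eq_zero_iff, one_ne_zero, and_false, not_false_eq_true, zero_pow, zero_mul, mul_zero,
    sub_self, zero_div, zero_add]
  ring

theorem collideRate_two : collideRate 2 = 1 := by
  rw [collideRate_add_two 0, collideRate_zero]; norm_num

theorem collideRate_four : collideRate 4 = 3 / 4 := by
  rw [collideRate_add_two 2, collideRate_two]; norm_num

theorem collideRate_odd (k : ℕ) : collideRate (2 * k + 1) = 0 := by
  induction k with
  | zero => exact collideRate_one
  | succ k ih =>
    rw [show 2 * (k + 1) + 1 = 2 * k + 1 + 2 by ring, collideRate_add_two, ih, mul_zero]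

/-- The recursion makes the even rates decrease, and the value at exponent 6 is 5/8. This is the
source of the constant 3/8 = 1 - 5/8 below. -/
theorem collideRate_even_le (k : ℕ) :
    0 ≤ collideRate (2 * (k + 3)) ∧ collideRate (2 * (k + 3)) ≤ 5 / 8 := by
  induction k with
  | zero =>
    rw [show 2 * (0 + 3) = 4 + 2 by rfl, collideRate_add_two, collideRate_four]
    norm_num
  | succ k ih =>
    rw [show 2 * (k + 1 + 3) = 2 * (k + 3) + 2 by ring, collideRate_add_two]
    have h1 : ((2 * (k + 3) : ℕ) + 1 : ℝ) / ((2 * (k + 3) : ℕ) + 2) ≤ 1 := by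
      rw [div_le_one (by positivity)]
      linarith
    have h2 : 0 ≤ ((2 * (k + 3) : ℕ) + 1 : ℝ) / ((2 * (k + 3) : ℕ) + 2) := by positivity
    exact ⟨mul_nonneg h2 ih.1, (mul_le_of_le_one_left ih.1 h1).trans ih.2⟩

theorem collideRate_le {m : ℕ} (h0 : m ≠ 0) (h2 : m ≠ 2) (h4 : m ≠ 4) : collideRate m ≤ 5 / 8 := by
  obtain ⟨k, rfl | rfl⟩ := m.even_or_odd'
  · obtain ⟨l, rfl⟩ : ∃ l, k = l + 3 := ⟨k - 3, by omega⟩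
    exact (collideRate_even_le l).2
  · rw [collideRate_odd]
    norm_num

theorem exists_rotate_eq_zero {N : ℕ} {i j : Fin N} (v : Fin N → ℝ) :
    ∃ φ, rotate i j φ v j = 0 := by
  simp only [rotate_right]
  by_cases h : v i = 0
  · exact ⟨Real.pi / 2, by simp [h]⟩
  · refine ⟨-Real.arctan (v j / v i), ?_⟩
    have hc : Real.cos (Real.arctan (v j / v i)) ≠ 0 := (Real.cos_arctan_pos _).ne'
    have ht := Real.tan_mul_cos hc
    rw [Real.tan_arctan] at ht
    rw [Real.sin_neg, Real.cos_neg, ← ht]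
    field_simp
    ring

/-- The average is rotation invariant, so it may be evaluated where the j-th velocity vanishes and
the i-th is w. -/
theorem collide_pow_add_pow {N : ℕ} {i j : Fin N} (hij : i ≠ j) (m : ℕ) (v : Fin N → ℝ) :
    ∃ w : ℝ, w ^ 2 = v i ^ 2 + v j ^ 2 ∧
      collide i j (fun u => u i ^ m + u j ^ m) v = collideRate m * w ^ m := by
  obtain ⟨φ, hφ⟩ := exists_rotate_eq_zero (i := i) (j := j) v
  refine ⟨rotate i j φ v i, ?_, ?_⟩
  · have h1 : rotate i j φ v i ^ 2 + rotate i j φ v j ^ 2 = v i ^ 2 + v j ^ 2 := by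
      rw [rotate_left hij, rotate_right]
      have := Real.sin_sq_add_cos_sq φ
      linear_combination (v i ^ 2 + v j ^ 2) * this
    rw [← h1, hφ]
    ring
  · rw [← collide_rotate hij _ φ v, collide, collideRate, mul_assoc,
      ← intervalIntegral.integral_mul_const]
    congr 1
    refine intervalIntegral.integral_congr fun θ _ => ?_
    simp only [rotate_left hij θ, rotate_right θ, hφ]
    ring

theorem collide_pow_add_pow_even {N : ℕ} {i j : Fin N} (hij : i ≠ j) (k : ℕ) (v : Fin N → ℝ) :
    collide i j (fun u => u i ^ (2 * k) + u j ^ (2 * k)) v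
      = collideRate (2 * k) * (v i ^ 2 + v j ^ 2) ^ k := by
  obtain ⟨w, h1, h2⟩ := collide_pow_add_pow hij (2 * k) v
  rw [h2, pow_mul, h1]

theorem collide_pow_add_pow_odd {N : ℕ} {i j : Fin N} (hij : i ≠ j) (k : ℕ) (v : Fin N → ℝ) :
    collide i j (fun u => u i ^ (2 * k + 1) + u j ^ (2 * k + 1)) v = 0 := by
  obtain ⟨w, -, h2⟩ := collide_pow_add_pow hij (2 * k + 1) v
  rw [h2, collideRate_odd, zero_mul]

end CollidePowers

/-! ### The one-particle operator on polynomials -/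

section OneParticle

theorem coeFn_double_mono (m : ℕ) :
    double (mono m) =ᵐ[gauss (Fin 2)] fun v => v 0 ^ m + v 1 ^ m := by
  rw [double_apply]
  filter_upwards [Lp.coeFn_add (single (N := 2) 0 (mono m)) (single 1 (mono m)),
    coeFn_lift (e := fun _ : Fin 1 => (0 : Fin 2)) (Function.injective_of_subsingleton _) (mono m),
    coeFn_lift (e := fun _ : Fin 1 => (1 : Fin 2)) (Function.injective_of_subsingleton _) (mono m),
    ae_of_pull (measurePreserving_comp (e := fun _ : Fin 1 => (0 : Fin 2))
      (Function.injective_of_subsingleton _)) (coeFn_mono m),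
    ae_of_pull (measurePreserving_comp (e := fun _ : Fin 1 => (1 : Fin 2))
      (Function.injective_of_subsingleton _)) (coeFn_mono m)] with v h1 h2 h3 h4 h5
  rw [h1, Pi.add_apply]
  exact congrArg₂ (· + ·) (h2.trans h4) (h3.trans h5)

theorem const_mean_mono (m : ℕ) : const 1 (mean (mono m)) = moment m • mono 0 := by
  refine ext_inner_right ℝ fun g => ?_
  have hm : ∀ g : X (Fin 1), const 1 (mean g) = ⟪mono 0, g⟫ • mono 0 := fun g => by
    refine Lp.ext ?_
    filter_upwards [coeFn_lift (e := (Fin.elim0 : Fin 0 → Fin 1))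
        (Function.injective_of_subsingleton _) (mean g),
      ae_of_pull (measurePreserving_comp (e := (Fin.elim0 : Fin 0 → Fin 1))
        (Function.injective_of_subsingleton _))
        (coeFn_adjoint_lift (e := (Fin.elim0 : Fin 0 → Fin 1))
        (Function.injective_of_subsingleton _) g), Lp.coeFn_smul ⟪mono 0, g⟫ (mono 0),
      coeFn_mono 0] with v h1 h2 h3 h4
    rw [h3, Pi.smul_apply, h4, pow_zero, smul_eq_mul, mul_one]
    refine h1.trans (h2.trans ?_)
    rw [L2.inner_def]
    refine integral_congr_ae ?_
    filter_upwards [coeFn_mono 0] with w hw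
    have h5 : Function.extend (Fin.elim0 : Fin 0 → Fin 1) (fun j => v (Fin.elim0 j)) w = w := by
      funext k
      exact Function.extend_apply' _ _ _ fun ⟨j, _⟩ => j.elim0
    rw [h5, hw, pow_zero]
    simp
  rw [hm, inner_mono_mono, zero_add]

theorem oneKac_eq (f : X (Fin 1)) : oneKac f = f + const 1 (mean f)
    - (single 0).adjoint (rot zero_ne_one_fin_two (double f)) := by
  have h : (single 0).adjoint (double f) = f + const 1 (mean f) := by
    rw [double_apply, map_add, adjoint_single_single,
      adjoint_single_single_of_ne zero_ne_one_fin_two]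
  rw [oneKac_apply, doubleKac_apply, map_sub, h, neg_sub]

/-- Up to the factor -1/2, the form is that of R - 1 on sums of one-particle functions of two
particles. -/
theorem inner_oneKac_left (f g : X (Fin 1)) : ⟪oneKac f, g⟫ = ⟪f, oneKac g⟫ := by
  have h : ∀ f g : X (Fin 1), 2 * ⟪oneKac f, g⟫ = -⟪doubleKac f, double g⟫ := fun f g => by
    rw [double_apply, inner_add_right, ← ContinuousLinearMap.adjoint_inner_left,
      ← ContinuousLinearMap.adjoint_inner_left, adjoint_single_one_doubleKac, oneKac_apply,
      inner_neg_left]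
    ring
  have h1 := h f g
  have h2 := h g f
  have h3 : ⟪doubleKac f, double g⟫ = ⟪doubleKac g, double f⟫ := by
    rw [doubleKac_apply, doubleKac_apply, inner_sub_left, inner_sub_left, inner_rot_left,
      real_inner_comm, real_inner_comm (double f) (double g)]
  rw [real_inner_comm] at h2
  linarith

theorem coeFn_adjoint_single_of_ae {F : (Fin 2 → ℝ) → ℝ} {f : X (Fin 2)} (hf : f =ᵐ[gauss (Fin 2)] F) :
    (single 0).adjoint f =ᵐ[gauss (Fin 1)] fun u => ∫ w : Fin 2 → ℝ, F ![u 0, w 1] ∂gauss (Fin 2) := by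
  filter_upwards [coeFn_adjoint_lift_of_ae (e := fun _ : Fin 1 => (0 : Fin 2))
    (Function.injective_of_subsingleton _) f hf] with u hu
  refine hu.trans ?_
  congr 1
  funext w
  congr 1
  funext k
  fin_cases k
  · exact Function.Injective.extend_apply (f := fun _ : Fin 1 => (0 : Fin 2))
      (Function.injective_of_subsingleton _) _ _ 0
  · exact Function.extend_apply' _ _ _ fun ⟨j, hj⟩ => zero_ne_one_fin_two hj

theorem oneKac_mono_odd (k : ℕ) :
    oneKac (mono (2 * k + 1)) = mono (2 * k + 1) + moment (2 * k + 1) • mono 0 := by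
  have h : rot zero_ne_one_fin_two (double (mono (2 * k + 1))) = 0 := by
    refine Lp.ext ((coeFn_rot_of_ae _ _ (coeFn_double_mono _)).trans ?_)
    filter_upwards [Lp.coeFn_zero ℝ 2 (gauss (Fin 2))] with v hv
    rw [hv, collide_pow_add_pow_odd zero_ne_one_fin_two]
    rfl
  rw [oneKac_eq, h, map_zero, sub_zero, const_mean_mono]

/-- The rotation average of v^{2k} + w^{2k} is a multiple of (v² + w²)^k; expand and integrate over
w. -/
theorem oneKac_mono_even (k : ℕ) :
    oneKac (mono (2 * k)) = mono (2 * k) + moment (2 * k) • mono 0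
      - collideRate (2 * k) • ∑ j ∈ Finset.range (k + 1),
        (k.choose j * moment (2 * (k - j))) • mono (2 * j) := by
  rw [oneKac_eq, const_mean_mono]
  congr 1
  have h1 := (coeFn_rot_of_ae zero_ne_one_fin_two _ (coeFn_double_mono (2 * k))).trans
    (Eventually.of_forall fun v => collide_pow_add_pow_even zero_ne_one_fin_two k v)
  refine Lp.ext ((coeFn_adjoint_single_of_ae h1).trans ?_)
  have h2 : ∀ᵐ u ∂gauss (Fin 1), ∀ j : ℕ,
      ((k.choose j * moment (2 * (k - j))) • mono (2 * j) : X (Fin 1)) u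
        = k.choose j * moment (2 * (k - j)) * u 0 ^ (2 * j) := by
    rw [ae_all_iff]
    intro j
    filter_upwards [Lp.coeFn_smul (k.choose j * moment (2 * (k - j))) (mono (2 * j)),
      coeFn_mono (2 * j)] with u h3 h4
    rw [h3, Pi.smul_apply, h4, smul_eq_mul]
  filter_upwards [h2, Lp.coeFn_smul (collideRate (2 * k)) (∑ j ∈ Finset.range (k + 1),
    (k.choose j * moment (2 * (k - j))) • mono (2 * j)), Lp.coeFn_finsetSum
    (Finset.range (k + 1)) fun j => ((k.choose j * moment (2 * (k - j))) • mono (2 * j))]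
    with u h3 h4 h5
  rw [h4, Pi.smul_apply, h5, Finset.sum_apply, smul_eq_mul, integral_const_mul]
  congr 1
  simp only [h3, Matrix.cons_val_zero, Matrix.cons_val_one, add_pow, ← pow_mul]
  have h6 : ∀ n : ℕ, Integrable (fun w : Fin 2 → ℝ => w 1 ^ n) (gauss (Fin 2)) := fun n =>
    (measurePreserving_eval (fun _ : Fin 2 => maxwellian) 1).integrable_comp_of_integrable
      (integrable_pow n)
  rw [integral_finsetSum _ fun j _ => ((h6 _).const_mul _).mul_const _]
  refine Finset.sum_congr rfl fun j _ => ?_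
  rw [integral_mul_const, integral_const_mul, moment,
    ← integral_pull (measurePreserving_eval (fun _ : Fin 2 => maxwellian) 1) (by fun_prop)]
  simp only [Function.eval]
  ring

/-- `oneKac` is triangular on monomials. Degree 0 is excluded, because there the mean of the
function also has top degree. -/
theorem oneKac_mono_sub_mem {m : ℕ} (hm : m ≠ 0) :
    oneKac (mono m) - (1 - collideRate m) • mono m ∈ polyBelow m := by
  obtain ⟨k, rfl | rfl⟩ := m.even_or_odd'
  · rw [oneKac_mono_even, Finset.sum_range_succ]
    have h1 : ∀ j ∈ Finset.range k, (k.choose j * moment (2 * (k - j))) • mono (2 * j)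
        ∈ polyBelow (2 * k) := fun j hj =>
      Submodule.smul_mem _ _ (mono_mem_polyBelow (by have := Finset.mem_range.1 hj; omega))
    have h2 := Submodule.sub_mem _ (Submodule.smul_mem (polyBelow (2 * k)) (moment (2 * k))
      (mono_mem_polyBelow (m := 0) (by omega)))
      (Submodule.smul_mem _ (collideRate (2 * k)) (Submodule.sum_mem _ h1))
    refine (congrArg (· ∈ polyBelow (2 * k)) ?_).mp h2
    simp only [Nat.choose_self, Nat.cast_one, Nat.sub_self, mul_zero, moment_zero, mul_one,
      smul_add, sub_smul, one_smul]
    abel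
  · rw [oneKac_mono_odd, collideRate_odd, sub_zero, one_smul, add_sub_cancel_left]
    exact Submodule.smul_mem _ _ (mono_mem_polyBelow (by omega))

theorem oneKac_mem_polyBelow {d : ℕ} {f : X (Fin 1)} (hf : f ∈ polyBelow d) :
    oneKac f ∈ polyBelow d := by
  refine (Submodule.span_le (p := (polyBelow d).comap (oneKac : X (Fin 1) →ₗ[ℝ] X (Fin 1)))).2 ?_ hf
  rintro _ ⟨m, hm, rfl⟩
  have hm' : m < d := hm
  simp only [SetLike.mem_coe, Submodule.mem_comap, ContinuousLinearMap.coe_coe]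
  by_cases h0 : m = 0
  · subst h0
    have h := oneKac_mono_even 0
    simp only [mul_zero] at h
    rw [h]
    refine Submodule.sub_mem _ (Submodule.add_mem _ (mono_mem_polyBelow hm')
      (Submodule.smul_mem _ _ (mono_mem_polyBelow hm'))) (Submodule.smul_mem _ _
      (Submodule.sum_mem _ fun j hj => Submodule.smul_mem _ _ (mono_mem_polyBelow ?_)))
    have := Finset.mem_range.1 hj
    omega
  · have h := Submodule.add_mem _ (polyBelow_mono hm'.le (oneKac_mono_sub_mem h0))
      (Submodule.smul_mem (polyBelow d) (1 - collideRate m) (mono_mem_polyBelow hm'))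
    rwa [sub_add_cancel] at h

/-! ### Hermite polynomials of degree two and four. -/

/-- The second Hermite polynomial, `2πv² - 1`. -/
def hermTwo : X (Fin 1) := (2 * Real.pi) • mono 2 - mono 0

/-- The fourth Hermite polynomial, `(2πv²)² - 6(2πv²) + 3`. -/
def hermFour : X (Fin 1) :=
  (2 * Real.pi) ^ 2 • mono 4 - (6 * (2 * Real.pi)) • mono 2 + (3 : ℝ) • mono 0

theorem moment_two : moment 2 = 1 / (2 * Real.pi) := by
  have h := moment_add_two 0
  rw [moment_zero] at h
  push_cast at h
  rw [eq_div_iff (by positivity)]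
  linarith

theorem moment_four : moment 4 = 3 / (2 * Real.pi) ^ 2 := by
  have h := moment_add_two 2
  rw [moment_two] at h
  push_cast at h
  rw [eq_div_iff (by positivity)]
  field_simp at h
  linarith

theorem moment_six : moment 6 = 15 / (2 * Real.pi) ^ 3 := by
  have h := moment_add_two 4
  rw [moment_four] at h
  push_cast at h
  rw [eq_div_iff (by positivity)]
  field_simp at h
  linarith

theorem moment_eight : moment 8 = 105 / (2 * Real.pi) ^ 4 := by
  have h := moment_add_two 6
  rw [moment_six] at h
  push_cast at h
  rw [eq_div_iff (by positivity)]
  field_simp at h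
  linarith

theorem moment_odd (k : ℕ) : moment (2 * k + 1) = 0 := by
  induction k with
  | zero => exact moment_one
  | succ k ih =>
    have h := moment_add_two (2 * k + 1)
    rw [ih, mul_zero] at h
    exact (mul_eq_zero.1 h).resolve_left (by positivity)

theorem inner_hermTwo_mono (m : ℕ) :
    ⟪hermTwo, mono m⟫ = 2 * Real.pi * moment (m + 2) - moment m := by
  rw [hermTwo, inner_sub_left, inner_smul_left, inner_mono_mono, inner_mono_mono, zero_add,
    add_comm 2 m]
  simp

theorem inner_hermFour_mono (m : ℕ) : ⟪hermFour, mono m⟫ = (2 * Real.pi) ^ 2 * moment (m + 4)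
    - 6 * (2 * Real.pi) * moment (m + 2) + 3 * moment m := by
  rw [hermFour, inner_add_left, inner_sub_left, inner_smul_left, inner_smul_left, inner_smul_left,
    inner_mono_mono, inner_mono_mono, inner_mono_mono, zero_add, add_comm 2 m, add_comm 4 m]
  simp

theorem norm_hermTwo_sq : ‖hermTwo‖ ^ 2 = 2 := by
  have hp := Real.pi_pos
  rw [← real_inner_self_eq_norm_sq]
  nth_rewrite 2 [hermTwo]
  rw [inner_sub_right, inner_smul_right, inner_hermTwo_mono, inner_hermTwo_mono, moment_four,
    moment_two, moment_zero]
  field_simp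
  ring

theorem norm_hermFour_sq : ‖hermFour‖ ^ 2 = 24 := by
  have hp := Real.pi_pos
  rw [← real_inner_self_eq_norm_sq]
  nth_rewrite 2 [hermFour]
  rw [inner_add_right, inner_sub_right, inner_smul_right, inner_smul_right, inner_smul_right,
    inner_hermFour_mono, inner_hermFour_mono, inner_hermFour_mono, moment_eight, moment_six,
    moment_four, moment_two, moment_zero]
  field_simp
  ring

theorem inner_hermTwo_hermFour : ⟪hermTwo, hermFour⟫ = 0 := by
  have hp := Real.pi_pos
  rw [hermFour, inner_add_right, inner_sub_right, inner_smul_right, inner_smul_right,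
    inner_smul_right, inner_hermTwo_mono, inner_hermTwo_mono, inner_hermTwo_mono, moment_six,
    moment_four, moment_two, moment_zero]
  field_simp
  ring

theorem inner_hermTwo_eq_zero {f : X (Fin 1)} (hf : f ∈ polyBelow 2) : ⟪hermTwo, f⟫ = 0 := by
  refine (Submodule.span_le (p := (ℝ ∙ hermTwo)ᗮ)).2 ?_ hf |> fun h =>
    (Submodule.mem_orthogonal_singleton_iff_inner_right).1 h
  rintro _ ⟨m, hm, rfl⟩
  rw [SetLike.mem_coe, Submodule.mem_orthogonal_singleton_iff_inner_right, inner_hermTwo_mono]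
  have hm' : m < 2 := hm
  have hp := Real.pi_pos
  interval_cases m
  · rw [moment_two, moment_zero]; field_simp; ring
  · rw [moment_odd 1, moment_one]; ring

theorem inner_hermFour_eq_zero {f : X (Fin 1)} (hf : f ∈ polyBelow 4) : ⟪hermFour, f⟫ = 0 := by
  refine (Submodule.span_le (p := (ℝ ∙ hermFour)ᗮ)).2 ?_ hf |> fun h =>
    (Submodule.mem_orthogonal_singleton_iff_inner_right).1 h
  rintro _ ⟨m, hm, rfl⟩
  rw [SetLike.mem_coe, Submodule.mem_orthogonal_singleton_iff_inner_right, inner_hermFour_mono]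
  have hm' : m < 4 := hm
  have hp := Real.pi_pos
  interval_cases m
  · rw [moment_four, moment_two, moment_zero]; field_simp; ring
  · rw [moment_odd 2, moment_odd 1, moment_one]; ring
  · rw [moment_six, moment_four, moment_two]; field_simp; ring
  · rw [moment_odd 3, moment_odd 2, moment_odd 1]; ring

theorem oneKac_mono_zero : oneKac (mono 0) = 0 := by
  have h := oneKac_mono_even 0
  simp only [mul_zero, zero_add, Finset.range_one, Finset.sum_singleton, Nat.choose_self,
    Nat.cast_one, moment_zero, collideRate_zero, one_smul, mul_one, Nat.sub_self] at h
  rw [h, two_smul, sub_self]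

theorem oneKac_hermTwo : oneKac hermTwo = 0 := by
  have h := oneKac_mono_even 1
  simp only [mul_one, Finset.sum_range_succ, Finset.range_zero, Finset.sum_empty, zero_add,
    Nat.choose_zero_right, Nat.choose_self, Nat.cast_one, one_mul, mul_zero, Nat.sub_self,
    Nat.sub_zero, moment_zero, collideRate_two, one_smul] at h
  rw [hermTwo, map_sub, map_smul, oneKac_mono_zero, h]
  module

theorem oneKac_hermFour : oneKac hermFour = (1 / 4 : ℝ) • hermFour := by
  have hp := Real.pi_pos
  have h := oneKac_mono_even 2
  simp only [Finset.sum_range_succ, Finset.range_zero, Finset.sum_empty, zero_add,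
    Nat.choose_zero_right, Nat.choose_self, Nat.cast_one, one_mul, mul_zero, mul_one, Nat.sub_self,
    Nat.sub_zero, moment_zero, one_smul, Nat.choose_one_right, Nat.cast_ofNat] at h
  norm_num only [collideRate_four, moment_two, moment_four] at h
  have h2 : oneKac (mono 2) = 0 := by
    have h3 := oneKac_hermTwo
    rw [hermTwo, map_sub, map_smul, oneKac_mono_zero, sub_zero] at h3
    exact (smul_eq_zero.1 h3).resolve_left (by positivity)
  rw [hermFour, map_add, map_sub, map_smul, map_smul, map_smul, oneKac_mono_zero, h, h2]
  match_scalars <;> field_simp <;> ring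

/-- If the orthogonal polynomial of degree d is known, orthogonality to it removes the top
coefficient. This skips the degrees 0, 2 and 4 in the induction below. -/
theorem mem_polyBelow_of_inner_eq_zero {d : ℕ} {a : ℝ} (ha : a ≠ 0) {e g f : X (Fin 1)}
    (he : e = a • mono d + g) (hg : g ∈ polyBelow d) (he0 : e ≠ 0)
    (horth : ∀ p ∈ polyBelow d, ⟪e, p⟫ = 0) (hf : f ∈ polyBelow (d + 1)) (hef : ⟪e, f⟫ = 0) :
    f ∈ polyBelow d := by
  obtain ⟨c, p, hp, rfl⟩ := polyBelow_induction hf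
  have h1 : c • mono d + p = (c / a) • e + (p - (c / a) • g) := by
    rw [he, smul_add, smul_smul, div_mul_cancel₀ _ ha]
    abel
  have h2 : p - (c / a) • g ∈ polyBelow d :=
    Submodule.sub_mem _ hp (Submodule.smul_mem _ _ hg)
  rw [h1, inner_add_right, inner_smul_right, horth _ h2, add_zero, real_inner_self_eq_norm_sq,
    mul_eq_zero, div_eq_zero_iff] at hef
  have hc : c = 0 := (hef.resolve_right (by simpa using he0)).resolve_right ha
  rw [hc, zero_smul, zero_add]
  exact hp

theorem hermTwo_mem : hermTwo ∈ polyBelow 3 :=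
  Submodule.sub_mem _ (Submodule.smul_mem _ _ (mono_mem_polyBelow (by norm_num)))
    (mono_mem_polyBelow (by norm_num))

theorem hermFour_mem : hermFour ∈ polyBelow 5 :=
  Submodule.add_mem _ (Submodule.sub_mem _
    (Submodule.smul_mem _ _ (mono_mem_polyBelow (by norm_num)))
    (Submodule.smul_mem _ _ (mono_mem_polyBelow (by norm_num))))
    (Submodule.smul_mem _ _ (mono_mem_polyBelow (by norm_num)))

theorem hermTwo_ne_zero : hermTwo ≠ 0 := fun h => by
  have := norm_hermTwo_sq
  rw [h] at this
  norm_num at this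

theorem hermFour_ne_zero : hermFour ≠ 0 := fun h => by
  have := norm_hermFour_sq
  rw [h] at this
  norm_num at this

theorem norm_mono_zero : ‖mono 0‖ ^ 2 = 1 := by
  rw [← real_inner_self_eq_norm_sq, inner_mono_mono, moment_zero]

/-! ### The spectral gap of the one-particle operator. -/

/-- The spectral gap of `oneKac` on polynomials. -/
theorem inner_oneKac_polyBelow (d : ℕ) : ∀ f ∈ polyBelow d, (0 < d → ⟪mono 0, f⟫ = 0) →
    (2 < d → ⟪hermTwo, f⟫ = 0) → (4 < d → ⟪hermFour, f⟫ = 0) →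
    3 / 8 * ‖f‖ ^ 2 ≤ ⟪f, oneKac f⟫ := by
  induction d with
  | zero =>
    intro f hf _ _ _
    have h : f = 0 := by simpa [polyBelow] using hf
    simp [h]
  | succ d ih =>
    intro f hf h0 h2 h4
    have hp := Real.pi_pos
    have hin : f ∈ polyBelow d → 3 / 8 * ‖f‖ ^ 2 ≤ ⟪f, oneKac f⟫ := fun hf' =>
      ih f hf' (fun hd => h0 (by omega)) (fun hd => h2 (by omega)) fun hd => h4 (by omega)
    by_cases hd0 : d = 0
    · subst hd0
      refine hin (mem_polyBelow_of_inner_eq_zero (a := 1) (e := mono 0) one_ne_zero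
        (by rw [one_smul, add_zero]) (Submodule.zero_mem _) (fun h => ?_) (fun p hp => ?_) hf
        (h0 (by norm_num)))
      · have := norm_mono_zero
        rw [h] at this
        norm_num at this
      · have h : p = 0 := by simpa [polyBelow] using hp
        rw [h, inner_zero_right]
    by_cases hd2 : d = 2
    · subst hd2
      exact hin (mem_polyBelow_of_inner_eq_zero (a := 2 * Real.pi) (by positivity)
        (sub_eq_add_neg _ _) (Submodule.neg_mem _ (mono_mem_polyBelow (by norm_num)))
        hermTwo_ne_zero (fun p => inner_hermTwo_eq_zero) hf (h2 (by norm_num)))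
    by_cases hd4 : d = 4
    · subst hd4
      refine hin (mem_polyBelow_of_inner_eq_zero (a := (2 * Real.pi) ^ 2) (by positivity)
        (g := -((6 * (2 * Real.pi)) • mono 2) + (3 : ℝ) • mono 0) ?_ ?_
        hermFour_ne_zero (fun p => inner_hermFour_eq_zero) hf (h4 (by norm_num)))
      · rw [hermFour]
        abel
      · exact Submodule.add_mem _ (Submodule.neg_mem _ (Submodule.smul_mem _ _
          (mono_mem_polyBelow (by norm_num))))
          (Submodule.smul_mem _ _ (mono_mem_polyBelow (by norm_num)))
    have hr := collideRate_le hd0 hd2 hd4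
    obtain ⟨c, g, hg, rfl⟩ := polyBelow_induction hf
    set π := (polyBelow d).starProjection (mono d) with hπ
    have hπm : π ∈ polyBelow d := Submodule.starProjection_apply_mem _ _
    set e := mono d - π with he
    have heo : ∀ p ∈ polyBelow d, ⟪e, p⟫ = 0 := fun p hp => by
      rw [real_inner_comm]
      exact (Submodule.mem_orthogonal _ _).1
        (Submodule.sub_starProjection_mem_orthogonal (mono d)) p hp
    -- Triangularity puts the error in the lower-degree polynomials, while symmetry makes it
    -- orthogonal to them; so the orthogonal polynomial is an eigenvector.
    have hCe : oneKac e = (1 - collideRate d) • e := by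
      have hm : oneKac e - (1 - collideRate d) • e ∈ polyBelow d := by
        have h5 := Submodule.add_mem _ (Submodule.sub_mem _ (oneKac_mono_sub_mem hd0)
          (oneKac_mem_polyBelow hπm)) (Submodule.smul_mem _ (1 - collideRate d) hπm)
        refine (congrArg (· ∈ polyBelow d) ?_).mp h5
        rw [he, map_sub, smul_sub]
        abel
      have h6 : ⟪oneKac e - (1 - collideRate d) • e, oneKac e - (1 - collideRate d) • e⟫ = 0 := by
        rw [inner_sub_left, inner_smul_left, heo _ hm, inner_oneKac_left,
          heo _ (oneKac_mem_polyBelow hm), mul_zero, sub_zero]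
      exact sub_eq_zero.1 (inner_self_eq_zero.1 h6)
    set q := g + c • π with hq
    have hqm : q ∈ polyBelow d := Submodule.add_mem _ hg (Submodule.smul_mem _ _ hπm)
    have hf' : c • mono d + g = c • e + q := by
      rw [he, hq, smul_sub]
      abel
    rw [hf'] at h0 h2 h4 ⊢
    have horth : ∀ y ∈ polyBelow d, ⟪y, c • e + q⟫ = 0 → ⟪y, q⟫ = 0 := fun y hy h => by
      rwa [inner_add_right, inner_smul_right, real_inner_comm, heo y hy, mul_zero, zero_add] at h
    have hiq := ih q hqm (fun hd => horth _ (mono_mem_polyBelow hd) (h0 (by omega)))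
      (fun hd => horth _ (polyBelow_mono hd hermTwo_mem) (h2 (by omega)))
      fun hd => horth _ (polyBelow_mono hd hermFour_mem) (h4 (by omega))
    have h7 : ⟪c • e + q, oneKac (c • e + q)⟫
        = c ^ 2 * (1 - collideRate d) * ‖e‖ ^ 2 + ⟪q, oneKac q⟫ := by
      rw [map_add, map_smul, hCe, inner_add_left, inner_add_right, inner_add_right,
        inner_smul_left, inner_smul_left, inner_smul_right, inner_smul_right, inner_smul_right,
        inner_smul_right, real_inner_comm e q, heo q hqm, heo _ (oneKac_mem_polyBelow hqm),
        real_inner_self_eq_norm_sq]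
      simp only [conj_trivial]
      ring
    have h8 : ‖c • e + q‖ ^ 2 = c ^ 2 * ‖e‖ ^ 2 + ‖q‖ ^ 2 := by
      rw [norm_add_sq_real, inner_smul_left, heo q hqm, norm_smul, mul_pow, Real.norm_eq_abs,
        sq_abs]
      ring
    rw [h7, h8]
    have h9 : 3 / 8 * (c ^ 2 * ‖e‖ ^ 2) ≤ (1 - collideRate d) * (c ^ 2 * ‖e‖ ^ 2) :=
      mul_le_mul_of_nonneg_right (by linarith) (by positivity)
    linarith

theorem inner_oneKac_of_orthogonal {f : X (Fin 1)} (h0 : ⟪mono 0, f⟫ = 0) (h2 : ⟪hermTwo, f⟫ = 0)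
    (h4 : ⟪hermFour, f⟫ = 0) : 3 / 8 * ‖f‖ ^ 2 ≤ ⟪f, oneKac f⟫ := by
  -- The inequality is proved for `T g` with g a polynomial and extended by density. Composing with
  -- this projection keeps the orthogonality conditions along the approximation; 2 and 24 are the
  -- squared norms of the two Hermite polynomials.
  let T : X (Fin 1) → X (Fin 1) := fun g => g - ⟪mono 0, g⟫ • mono 0
    - (⟪hermTwo, g⟫ / 2) • hermTwo - (⟪hermFour, g⟫ / 24) • hermFour
  have hT : Continuous T := by fun_prop
  have hTf : T f = f := by simp [T, h0, h2, h4]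
  have h02 : ⟪mono 0, hermTwo⟫ = 0 := by
    rw [real_inner_comm]
    exact inner_hermTwo_eq_zero (mono_mem_polyBelow (by norm_num))
  have h04 : ⟪mono 0, hermFour⟫ = 0 := by
    rw [real_inner_comm]
    exact inner_hermFour_eq_zero (mono_mem_polyBelow (by norm_num))
  have h24 := inner_hermTwo_hermFour
  have h20 : ⟪hermTwo, mono 0⟫ = 0 := by rw [real_inner_comm, h02]
  have h40 : ⟪hermFour, mono 0⟫ = 0 := by rw [real_inner_comm, h04]
  have h42 : ⟪hermFour, hermTwo⟫ = 0 := by rw [real_inner_comm, h24]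
  have hall : ∀ g : X (Fin 1), 3 / 8 * ‖T g‖ ^ 2 ≤ ⟪T g, oneKac (T g)⟫ := by
    refine dense_polyBelow.induction (fun g hg => ?_)
      (isClosed_le (by fun_prop) (hT.inner (oneKac.continuous.comp hT)))
    obtain ⟨d, hd⟩ := Set.mem_iUnion.1 hg
    refine inner_oneKac_polyBelow (d + 5) (T g) ?_ (fun _ => ?_) (fun _ => ?_) fun _ => ?_
    · refine Submodule.sub_mem _ (Submodule.sub_mem _ (Submodule.sub_mem _ (polyBelow_mono
        (by omega) hd) (Submodule.smul_mem _ _ (mono_mem_polyBelow (by omega))))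
        (Submodule.smul_mem _ _ (polyBelow_mono (by omega) hermTwo_mem)))
        (Submodule.smul_mem _ _ (polyBelow_mono (by omega) hermFour_mem))
    · simp only [T, inner_sub_right, inner_smul_right, h02, h04, real_inner_self_eq_norm_sq,
        norm_mono_zero]
      ring
    · simp only [T, inner_sub_right, inner_smul_right, h24, h20, real_inner_self_eq_norm_sq,
        norm_hermTwo_sq]
      ring
    · simp only [T, inner_sub_right, inner_smul_right, h40, h42, real_inner_self_eq_norm_sq,
        norm_hermFour_sq]
      ring
  have h := hall f
  rwa [hTf] at h

theorem mono_zero_inner_eq_zero {f : X (Fin 1)} (hf : mean f = 0) : ⟪mono 0, f⟫ = 0 := by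
  have h : mono 0 = const 1 (mean (mono 0)) := by
    rw [const_mean_mono, moment_zero, one_smul]
  rw [h, inner_const_left, hf, inner_zero_right]

/-- The spectral gap of `oneKac` below the fourth Hermite polynomial. -/
theorem inner_oneKac_ge {f : X (Fin 1)} (hf : mean f = 0) (h2 : ⟪hermTwo, f⟫ = 0) :
    3 / 8 * ‖f‖ ^ 2 - 1 / 8 * (⟪hermFour, f⟫ ^ 2 / 24) ≤ ⟪f, oneKac f⟫ := by
  have h0 := mono_zero_inner_eq_zero hf
  set b := ⟪hermFour, f⟫ / 24 with hb
  -- Remove the H₄ part, which has eigenvalue 1/4 instead of at least 3/8; the defect 1/8 multiplies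
  -- its squared norm.
  set w := f - b • hermFour with hw
  have h04 : ⟪mono 0, hermFour⟫ = 0 := by
    rw [real_inner_comm]
    exact inner_hermFour_eq_zero (mono_mem_polyBelow (by norm_num))
  have hw4 : ⟪hermFour, w⟫ = 0 := by
    rw [hw, inner_sub_right, inner_smul_right, real_inner_self_eq_norm_sq, norm_hermFour_sq]
    ring
  have h1 := inner_oneKac_of_orthogonal (f := w)
    (by rw [hw, inner_sub_right, inner_smul_right, h0, h04]; ring)
    (by rw [hw, inner_sub_right, inner_smul_right, h2, inner_hermTwo_hermFour]; ring) hw4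
  have hf' : f = w + b • hermFour := by rw [hw, sub_add_cancel]
  have h5 : ⟪f, oneKac f⟫ = ⟪w, oneKac w⟫ + b ^ 2 * 6 := by
    rw [hf', map_add, map_smul, oneKac_hermFour, inner_add_left, inner_add_right,
      inner_add_right, inner_smul_left, inner_smul_left, inner_smul_right, inner_smul_right,
      inner_smul_right, ← inner_oneKac_left hermFour, oneKac_hermFour, inner_smul_left,
      hw4, inner_smul_right, real_inner_self_eq_norm_sq, norm_hermFour_sq,
      real_inner_comm hermFour w, hw4]
    simp only [conj_trivial]
    ring
  have h6 : ‖f‖ ^ 2 = ‖w‖ ^ 2 + b ^ 2 * 24 := by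
    rw [hf', norm_add_sq_real, inner_smul_right, real_inner_comm, hw4, norm_smul, mul_pow,
      norm_hermFour_sq, Real.norm_eq_abs, sq_abs]
    ring
  have h7 : ⟪hermFour, f⟫ = 24 * b := by rw [hb]; ring
  rw [h5, h6, h7]
  linarith

end OneParticle

/-! ### The gap of the quadratic form -/

section Gap

/-- The states orthogonal to `E₀ ⊕ E₁`, in terms of their components `h`; `φ` are the centred
marginals, `f` their weighted mean and `n₀` is the square of the norm. -/
structure Reduced (μ ρ : ℝ) (h : ∀ N, X (Fin N)) (φ : ℕ → X (Fin 1)) (f : X (Fin 1)) (n₀ : ℝ) :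
    Prop where
  norm_sq : HasSum (fun N => weight μ ρ N * ‖h N‖ ^ 2) n₀
  marg_eq : ∀ N (i : Fin N), marg i (h N) = φ N
  hasSum_marg : HasSum (fun M => weight μ ρ M • φ (M + 1)) f
  hasSum_mean : HasSum (fun N => weight μ ρ N • mean (h N)) 0
  hasSum_smul_mean : HasSum (fun N : ℕ => (N : ℝ) • weight μ ρ N • mean (h N)) 0
  inner_hermTwo : ⟪hermTwo, f⟫ = 0

variable {lam μ ρ : ℝ} {h : ∀ N, X (Fin N)} {φ : ℕ → X (Fin 1)} {f : X (Fin 1)} {n₀ : ℝ}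

theorem Reduced.hasSum_inner_marg (hr : Reduced μ ρ h φ f n₀) (y : X (Fin 1)) :
    HasSum (fun N : ℕ => weight μ ρ N * (N * ⟪φ N, y⟫)) (μ / ρ * ⟪f, y⟫) := by
  refine hasSum_weight_shift (F := fun N => ⟪φ (N + 1), y⟫) (G := fun N => ⟪φ N, y⟫)
    (fun N => rfl) ?_
  have h2 := hr.hasSum_marg.mapL (innerSL ℝ y)
  simp only [innerSL_apply_apply, inner_smul_right] at h2
  rw [real_inner_comm]
  exact h2.congr_fun fun N => by rw [real_inner_comm]

theorem Reduced.hasSum_inner_sumSingle (hr : Reduced μ ρ h φ f n₀) {y : X (Fin 1)}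
    (hy : mean y = 0) :
    HasSum (fun N : ℕ => weight μ ρ N * ⟪h N, sumSingle N y⟫) (μ / ρ * ⟪f, y⟫) := by
  refine (hr.hasSum_inner_marg y).congr_fun fun N => ?_
  rw [inner_sumSingle_right (hr.marg_eq N) hy]

theorem Reduced.mean_eq_zero (hr : Reduced μ ρ h φ f n₀) : mean f = 0 :=
  mean_eq_zero_of_hasSum hr.marg_eq hr.hasSum_marg

/-- Bessel's inequality: ∑ f(v_i) is the projection of h onto such sums, and its squared norm is
t‖f‖². -/
theorem Reduced.norm_le (hμ : 0 < μ) (hρ : 0 < ρ) (hr : Reduced μ ρ h φ f n₀) :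
    μ / ρ * ‖f‖ ^ 2 ≤ n₀ := by
  have hf := hr.mean_eq_zero
  have hs := (hr.norm_sq.sub ((hr.hasSum_inner_marg f).mul_left 2)).add
    ((hasSum_weight_mul_id μ ρ).mul_right (‖f‖ ^ 2))
  have h0 := hasSum_le (fun N => ?_) hasSum_zero hs
  · rw [real_inner_self_eq_norm_sq] at h0
    linarith
  · have h1 : weight μ ρ N * ‖h N - sumSingle N f‖ ^ 2
        = weight μ ρ N * ‖h N‖ ^ 2 - 2 * (weight μ ρ N * (N * ⟪φ N, f⟫))
          + weight μ ρ N * N * ‖f‖ ^ 2 := by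
      rw [norm_sub_sq_real, inner_sumSingle_right (hr.marg_eq N) hf, norm_sumSingle_sq hf]
      ring
    rw [← h1]
    exact mul_nonneg (weight_pos hμ hρ N).le (sq_nonneg _)

theorem sqrt_ratio_pos (hμ : 0 < μ) (hρ : 0 < ρ) : 0 < Real.sqrt (ρ / μ) :=
  Real.sqrt_pos.2 (by positivity)

theorem sqrt_ratio_lt (hμ : 0 < μ) (hρ : 0 < ρ) (ht : μ / ρ > 256) :
    Real.sqrt (ρ / μ) < 1 / 16 := by
  rw [Real.sqrt_lt' (by norm_num), div_lt_iff₀ hμ]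
  rw [gt_iff_lt, lt_div_iff₀ hρ] at ht
  linarith

theorem ratio_eq_sq (hμ : 0 < μ) (hρ : 0 < ρ) : ρ / μ = Real.sqrt (ρ / μ) ^ 2 :=
  (Real.sq_sqrt (by positivity)).symm

theorem inner_sq_le (g f : X (Fin 1)) : ⟪g, f⟫ ^ 2 ≤ ‖g‖ ^ 2 * ‖f‖ ^ 2 := by
  rw [← mul_pow]
  exact sq_le_sq.2 (by rw [abs_of_nonneg (by positivity : 0 ≤ ‖g‖ * ‖f‖)]
                       exact abs_real_inner_le_norm g f)

/-- The quadratic form on the complement of `E₀ ⊕ E₁`. -/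
theorem Reduced.form_le (hlam : 0 < lam) (hμ : 0 < μ) (hρ : 0 < ρ)
    (hcond : ρ > lam / 4 + 2 * lam * Real.sqrt (ρ / μ))
    (hr : Reduced μ ρ h φ f n₀) {q : ℝ}
    (hq : HasSum (fun N => weight μ ρ N * ⟪h N, genSeq lam μ ρ h N⟫) q) (ht : μ / ρ > 256) :
    q ≤ (-ρ - lam / 4 + lam * Real.sqrt (ρ / μ)) * n₀ := by
  have hε := sqrt_ratio_pos hμ hρ
  have hε1 := sqrt_ratio_lt hμ hρ ht
  have hsq := ratio_eq_sq hμ hρ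
  set ε := Real.sqrt (ρ / μ) with hεdef
  -- With s = 4ε both errors are of order λε: the loss in the one-particle term is λε and the other
  -- error is λε/4. The condition 4ε < 1 is covered by t > 256.
  have hb := form_upper_bound hlam hμ hρ hr.norm_sq hr.marg_eq hr.hasSum_marg hr.hasSum_mean
    hr.hasSum_smul_mean hq (s := 4 * ε) (by positivity)
  have hx := hr.norm_le hμ hρ
  have htpos : 0 < μ / ρ := by positivity
  have h1 := inner_oneKac_ge hr.mean_eq_zero hr.inner_hermTwo
  have h2 := inner_sq_le hermFour f
  rw [norm_hermFour_sq] at h2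
  have h3 : 1 / 4 * (μ / ρ * ‖f‖ ^ 2) ≤ μ / ρ * ⟪f, oneKac f⟫ := by
    have : 1 / 4 * ‖f‖ ^ 2 ≤ ⟪f, oneKac f⟫ := by linarith
    have := mul_le_mul_of_nonneg_left this htpos.le
    linarith
  have h4 : lam * (ρ / μ) * (4 * ε)⁻¹ = lam * ε / 4 := by
    rw [hsq]
    field_simp
  rw [h4] at hb
  set x := μ / ρ * ‖f‖ ^ 2 with hxdef
  have h5 : lam * (1 - 4 * ε) * (1 / 4 * x) ≤ lam * (1 - 4 * ε) * (μ / ρ * ⟪f, oneKac f⟫) :=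
    mul_le_mul_of_nonneg_left h3 (mul_nonneg hlam.le (by linarith))
  -- This product is the claimed bound minus the one obtained. It vanishes at x = n₀, so the
  -- one-particle states are the critical ones.
  have h6 : 0 ≤ (n₀ - x) * (ρ - lam / 4 + 3 / 4 * (lam * ε)) := by
    refine mul_nonneg (by linarith) ?_
    have := mul_pos hlam hε
    linarith
  linarith

/-- The quadratic form on the complement of `E₀ ⊕ E₁` and of the fourth Hermite polynomial. -/
theorem Reduced.form_le_add (hlam : 0 < lam) (hμ : 0 < μ) (hρ : 0 < ρ)
    (hcond : ρ > lam / 4 + 2 * lam * Real.sqrt (ρ / μ))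
    (hr : Reduced μ ρ h φ f n₀) {q : ℝ}
    (hq : HasSum (fun N => weight μ ρ N * ⟪h N, genSeq lam μ ρ h N⟫) q) (ht : μ / ρ > 256) :
    q ≤ -(ρ + lam / 4 + lam * Real.sqrt (ρ / μ) / 2) * n₀
      + 3 / 32 * lam * (μ / ρ * (⟪hermFour, f⟫ ^ 2 / 24)) := by
  have hε := sqrt_ratio_pos hμ hρ
  have hε1 := sqrt_ratio_lt hμ hρ ht
  have hsq := ratio_eq_sq hμ hρ
  set ε := Real.sqrt (ρ / μ) with hεdef
  have hb := form_upper_bound hlam hμ hρ hr.norm_sq hr.marg_eq hr.hasSum_marg hr.hasSum_mean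
    hr.hasSum_smul_mean hq (s := 1 / 4) (by norm_num)
  have hx := hr.norm_le hμ hρ
  have htpos : 0 < μ / ρ := by positivity
  have h1 := inner_oneKac_ge hr.mean_eq_zero hr.inner_hermTwo
  have h2 := inner_sq_le hermFour f
  rw [norm_hermFour_sq] at h2
  set y := ⟪hermFour, f⟫ ^ 2 / 24 with hy
  have hy1 : y ≤ ‖f‖ ^ 2 := by rw [hy]; linarith
  -- The coefficient is chosen so that 3/4 of it, for s = 1/4, is 1/4 + ε/2. It stays below 3/8
  -- precisely when ε < 1/16, that is, t > 256.
  have h3 : (1 / 3 + 2 / 3 * ε) * ‖f‖ ^ 2 - 1 / 8 * y ≤ ⟪f, oneKac f⟫ := by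
    have hy0 := sq_nonneg ‖f‖
    have h7 := mul_nonneg hy0 (by linarith : 0 ≤ 3 / 8 - (1 / 3 + 2 / 3 * ε))
    linarith
  have h4 : lam * (3 / 4) * (μ / ρ * ((1 / 3 + 2 / 3 * ε) * ‖f‖ ^ 2 - 1 / 8 * y))
      ≤ lam * (3 / 4) * (μ / ρ * ⟪f, oneKac f⟫) :=
    mul_le_mul_of_nonneg_left (mul_le_mul_of_nonneg_left h3 htpos.le) (by positivity)
  have h5 : lam * (ρ / μ) * (1 / 4 : ℝ)⁻¹ = 4 * (lam * ε ^ 2) := by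
    rw [hsq]
    ring
  rw [h5] at hb
  -- Off the one-particle states the value -2ρ must beat the error 4λε². As 4ε² ≤ ε/4, the assumed
  -- lower bound on ρ suffices.
  have h6 : 0 ≤ (n₀ - μ / ρ * ‖f‖ ^ 2) * (ρ - lam * (1 / 4 + ε / 2) - 4 * (lam * ε ^ 2)) := by
    refine mul_nonneg (by linarith) ?_
    have h7 : lam * ε * ε ≤ lam * ε * (1 / 16) :=
      mul_le_mul_of_nonneg_left hε1.le (by positivity)
    have := mul_pos hlam hε
    nlinarith
  generalize ‖f‖ ^ 2 = F at *
  generalize ⟪f, oneKac f⟫ = I at *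
  nlinarith

end Gap

/-! ### Absolute continuity of the Maxwellian -/

section AbsolutelyContinuous

theorem maxwellian_ac : maxwellian ≪ volume := withDensity_absolutelyContinuous _ _

theorem ac_maxwellian : (volume : Measure ℝ) ≪ maxwellian :=
  withDensity_absolutelyContinuous' (by fun_prop)
    (Eventually.of_forall fun v => by simp [Real.exp_pos])

theorem pi_ac {μ ν : Measure ℝ} [SigmaFinite μ] [SigmaFinite ν] (h : μ ≪ ν) (N : ℕ) :
    Measure.pi (fun _ : Fin N => μ) ≪ Measure.pi fun _ : Fin N => ν := by
  induction N with
  | zero => rw [Measure.pi_of_empty, Measure.pi_of_empty]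
  | succ N ih =>
    rw [← (measurePreserving_piFinSuccAbove (fun _ : Fin (N + 1) => μ) 0).symm.map_eq,
      ← (measurePreserving_piFinSuccAbove (fun _ : Fin (N + 1) => ν) 0).symm.map_eq]
    exact (h.prod ih).map (MeasurableEquiv.measurable _)

theorem ae_volume_iff {N : ℕ} {p : (Fin N → ℝ) → Prop} :
    (∀ᵐ v ∂(volume : Measure (Fin N → ℝ)), p v) ↔ ∀ᵐ v ∂gauss (Fin N), p v :=
  ⟨fun h => (pi_ac maxwellian_ac N).ae_le h, fun h => (pi_ac ac_maxwellian N).ae_le h⟩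

end AbsolutelyContinuous

/-! ### Components of states -/

section Components

theorem mk_injective (N : ℕ) : Function.Injective fun v : Fin N → ℝ => (⟨N, v⟩ : Phase) :=
  fun v w h => by simpa using h

theorem measurableEmbedding_mk (N : ℕ) :
    MeasurableEmbedding fun v : Fin N → ℝ => (⟨N, v⟩ : Phase) where
  injective := mk_injective N
  measurable := measurable_mk N
  measurableSet_image' := by
    intro s hs
    rw [MeasurableSpace.measurableSet_iInf]
    intro M
    change MeasurableSet ((fun v : Fin M → ℝ => (⟨M, v⟩ : Phase)) ⁻¹' _)
    by_cases h : M = N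
    · subst h
      rwa [Set.preimage_image_eq _ (mk_injective M)]
    · convert! MeasurableSet.empty using 1
      ext v
      simp only [Set.mem_preimage, Set.mem_image, Set.mem_empty_iff_false, iff_false]
      rintro ⟨w, -, hw⟩
      exact h (congrArg Sigma.fst hw).symm

variable {lam μ ρ : ℝ}

theorem ae_steady_iff (hμ : 0 < μ) (hρ : 0 < ρ) {p : Phase → Prop} :
    (∀ᵐ x ∂steady μ ρ, p x) ↔ ∀ N, ∀ᵐ v ∂gauss (Fin N), p ⟨N, v⟩ := by
  rw [steady, Measure.ae_sum_iff]
  refine forall_congr' fun N => ?_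
  rw [Measure.ae_ennreal_smul_measure_iff (by simpa using weight_pos hμ hρ N),
    (measurableEmbedding_mk N).ae_map_iff]
  rfl

theorem memLp_component (hμ : 0 < μ) (hρ : 0 < ρ) {f : Phase → ℝ} (hf : MemLp f 2 (steady μ ρ))
    (N : ℕ) : MemLp (fun v => f ⟨N, v⟩) 2 (gauss (Fin N)) := by
  have h1 : ENNReal.ofReal (weight μ ρ N) ≠ 0 := by simpa using weight_pos hμ hρ N
  have h2 : MemLp f 2 (ENNReal.ofReal (weight μ ρ N) •
      (maxwellianN N).map (fun v => (⟨N, v⟩ : Phase))) := hf.mono_measure (Measure.le_sum _ N)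
  have h3 := h2.smul_measure (c := (ENNReal.ofReal (weight μ ρ N))⁻¹) (by simpa using h1)
  rw [smul_smul, ENNReal.inv_mul_cancel h1 ENNReal.ofReal_ne_top, one_smul,
    (measurableEmbedding_mk N).memLp_map_measure_iff] at h3
  exact h3

theorem hasSum_integral_steady (hμ : 0 < μ) (hρ : 0 < ρ) {f : Phase → ℝ}
    (hf : Integrable f (steady μ ρ)) :
    HasSum (fun N => weight μ ρ N * ∫ v, f ⟨N, v⟩ ∂gauss (Fin N)) (∫ x, f x ∂steady μ ρ) := by
  refine (hasSum_integral_measure hf).congr_fun fun N => ?_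
  rw [integral_smul_measure, (measurableEmbedding_mk N).integral_map,
    ENNReal.toReal_ofReal (weight_pos hμ hρ N).le, smul_eq_mul]
  rfl

/-- The component of a state in `L²(γ_N)`. -/
def comp (hμ : 0 < μ) (hρ : 0 < ρ) (x : L2 μ ρ) (N : ℕ) : X (Fin N) :=
  (memLp_component hμ hρ (Lp.memLp x) N).toLp _

theorem coeFn_comp (hμ : 0 < μ) (hρ : 0 < ρ) (x : L2 μ ρ) (N : ℕ) :
    comp hμ hρ x N =ᵐ[gauss (Fin N)] fun v => x ⟨N, v⟩ := MemLp.coeFn_toLp _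

theorem comp_eq_of_ae (hμ : 0 < μ) (hρ : 0 < ρ) {x : L2 μ ρ} {f : Phase → ℝ}
    (h : x =ᵐ[steady μ ρ] f) (N : ℕ) :
    comp hμ hρ x N =ᵐ[gauss (Fin N)] fun v => f ⟨N, v⟩ := by
  filter_upwards [coeFn_comp hμ hρ x N, (ae_steady_iff hμ hρ).1 h N] with v h1 h2
  rw [h1, h2]

theorem comp_add (hμ : 0 < μ) (hρ : 0 < ρ) (x y : L2 μ ρ) (N : ℕ) :
    comp hμ hρ (x + y) N = comp hμ hρ x N + comp hμ hρ y N := by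
  refine Lp.ext ((comp_eq_of_ae hμ hρ (Lp.coeFn_add x y) N).trans ?_)
  filter_upwards [Lp.coeFn_add (comp hμ hρ x N) (comp hμ hρ y N), coeFn_comp hμ hρ x N,
    coeFn_comp hμ hρ y N] with v h1 h2 h3
  rw [h1, Pi.add_apply, Pi.add_apply, h2, h3]

theorem comp_smul (hμ : 0 < μ) (hρ : 0 < ρ) (c : ℝ) (x : L2 μ ρ) (N : ℕ) :
    comp hμ hρ (c • x) N = c • comp hμ hρ x N := by
  refine Lp.ext ((comp_eq_of_ae hμ hρ (Lp.coeFn_smul c x) N).trans ?_)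
  filter_upwards [Lp.coeFn_smul c (comp hμ hρ x N), coeFn_comp hμ hρ x N] with v h1 h2
  rw [h1, Pi.smul_apply, Pi.smul_apply, h2]

theorem hasSum_inner_comp (hμ : 0 < μ) (hρ : 0 < ρ) (x y : L2 μ ρ) :
    HasSum (fun N => weight μ ρ N * ⟪comp hμ hρ x N, comp hμ hρ y N⟫) ⟪x, y⟫ := by
  rw [L2.inner_def]
  refine (hasSum_integral_steady hμ hρ (L2.integrable_inner x y)).congr_fun fun N => ?_
  rw [L2.inner_def]
  congr 1
  refine integral_congr_ae ?_
  filter_upwards [coeFn_comp hμ hρ x N, coeFn_comp hμ hρ y N] with v h1 h2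
  rw [h1, h2]

theorem hasSum_norm_comp (hμ : 0 < μ) (hρ : 0 < ρ) (x : L2 μ ρ) :
    HasSum (fun N => weight μ ρ N * ‖comp hμ hρ x N‖ ^ 2) (‖x‖ ^ 2) := by
  have h := hasSum_inner_comp hμ hρ x x
  simp only [real_inner_self_eq_norm_sq] at h
  exact h

theorem memLp_of_components (hμ : 0 < μ) (hρ : 0 < ρ) {g : ∀ N, X (Fin N)}
    (hg : Summable fun N => weight μ ρ N * ‖g N‖ ^ 2) {f : Phase → ℝ}
    (hf : ∀ N, g N =ᵐ[gauss (Fin N)] fun v => f ⟨N, v⟩) : MemLp f 2 (steady μ ρ) := by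
  have hm : Measurable fun z : Phase => g z.1 z.2 :=
    measurable_of_components _ fun N => (Lp.stronglyMeasurable (g N)).measurable
  have h1 : MemLp (fun z : Phase => g z.1 z.2) 2 (steady μ ρ) := by
    refine ⟨hm.aestronglyMeasurable, ?_⟩
    rw [eLpNorm_lt_top_iff_lintegral_rpow_enorm_lt_top (by norm_num) (by norm_num)]
    simp only [ENNReal.toReal_ofNat, ENNReal.rpow_ofNat]
    rw [lintegral_steady μ ρ (fun x => ‖g x.1 x.2‖ₑ ^ 2) (by fun_prop)]
    refine lt_of_le_of_lt (ENNReal.tsum_le_tsum fun N => ?_) hg.tsum_ofReal_lt_top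
    rw [ENNReal.ofReal_mul (weight_pos hμ hρ N).le]
    refine mul_le_mul_right (le_of_eq ?_) _
    rw [← real_inner_self_eq_norm_sq, L2.inner_def, ofReal_integral_eq_lintegral_ofReal
      (L2.integrable_inner _ _) (Eventually.of_forall fun v => real_inner_self_nonneg)]
    refine lintegral_congr fun v => ?_
    rw [real_inner_self_eq_norm_sq, ENNReal.ofReal_pow (norm_nonneg _), ofReal_norm]
  refine (memLp_congr_ae ?_).1 h1
  exact (ae_steady_iff hμ hρ).2 fun N => hf N

theorem coeFn_createSeq {f : Phase → ℝ} {h : ∀ N, X (Fin N)}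
    (hf : ∀ N, h N =ᵐ[gauss (Fin N)] fun v => f ⟨N, v⟩) (N : ℕ) :
    createSeq h N =ᵐ[gauss (Fin N)] fun v => creation f ⟨N, v⟩ := by
  cases N with
  | zero => exact Lp.coeFn_zero ℝ 2 (gauss (Fin 0))
  | succ N => exact coeFn_createOp (h N) (hf N)

theorem coeFn_genSeq {f : Phase → ℝ} {h : ∀ N, X (Fin N)}
    (hf : ∀ N, h N =ᵐ[gauss (Fin N)] fun v => f ⟨N, v⟩) (N : ℕ) :
    genSeq lam μ ρ h N =ᵐ[gauss (Fin N)] fun v => generator lam μ ρ f ⟨N, v⟩ := by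
  rw [genSeq]
  filter_upwards [hf N, coeFn_createSeq hf N, coeFn_annihOp (h (N + 1)) (hf (N + 1)),
    coeFn_kacOp (h N) (hf N),
    Lp.coeFn_add (ρ • (createSeq h N - (N : ℝ) • h N) + μ • (annihOp N (h (N + 1)) - h N))
      ((lam * ρ / μ) • kacOp N (h N)),
    Lp.coeFn_add (ρ • (createSeq h N - (N : ℝ) • h N)) (μ • (annihOp N (h (N + 1)) - h N)),
    Lp.coeFn_smul ρ (createSeq h N - (N : ℝ) • h N), Lp.coeFn_smul (N : ℝ) (h N),
    Lp.coeFn_sub (createSeq h N) ((N : ℝ) • h N), Lp.coeFn_smul μ (annihOp N (h (N + 1)) - h N),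
    Lp.coeFn_sub (annihOp N (h (N + 1))) (h N), Lp.coeFn_smul (lam * ρ / μ) (kacOp N (h N))]
    with v h0 h1 h2 h3 h4 h5 h6 h7 h8 h9 h10 h11
  simp only [h4, h5, h6, h7, h8, h9, h10, h11, h0, h1, h2, h3, Pi.add_apply, Pi.smul_apply,
    Pi.sub_apply, smul_eq_mul, generator]

theorem coeFn_genSeq_comp (hμ : 0 < μ) (hρ : 0 < ρ) (x : L2 μ ρ) (N : ℕ) :
    genSeq lam μ ρ (comp hμ hρ x) N
      =ᵐ[gauss (Fin N)] fun v => generator lam μ ρ x ⟨N, v⟩ :=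
  coeFn_genSeq (coeFn_comp hμ hρ x) N

/-- The state with given components. -/
theorem exists_comp_eq (hμ : 0 < μ) (hρ : 0 < ρ) {g : ∀ N, X (Fin N)}
    (hg : Summable fun N => weight μ ρ N * ‖g N‖ ^ 2) :
    ∃ x : L2 μ ρ, ∀ N, comp hμ hρ x N = g N := by
  have h := memLp_of_components hμ hρ hg (f := fun z => g z.1 z.2) fun N => EventuallyEq.refl _ _
  refine ⟨h.toLp _, fun N => Lp.ext (comp_eq_of_ae hμ hρ h.coeFn_toLp N)⟩

theorem hasSum_norm_genSeq (hμ : 0 < μ) (hρ : 0 < ρ) {x : L2 μ ρ}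
    (hx : MemLp (generator lam μ ρ x) 2 (steady μ ρ)) :
    (∀ N, comp hμ hρ (hx.toLp _) N = genSeq lam μ ρ (comp hμ hρ x) N) ∧
    HasSum (fun N => weight μ ρ N * ⟪comp hμ hρ x N, genSeq lam μ ρ (comp hμ hρ x) N⟫)
      (form lam μ ρ x) := by
  have h1 : ∀ N, comp hμ hρ (hx.toLp _) N = genSeq lam μ ρ (comp hμ hρ x) N := fun N =>
    Lp.ext ((comp_eq_of_ae hμ hρ hx.coeFn_toLp N).trans (coeFn_genSeq_comp hμ hρ x N).symm)
  refine ⟨h1, ?_⟩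
  have h2 := hasSum_inner_comp hμ hρ x (hx.toLp _)
  simp only [h1] at h2
  convert! h2 using 1
  rw [L2.inner_def, form]
  refine integral_congr_ae ?_
  filter_upwards [hx.coeFn_toLp] with z hz
  rw [hz]
  simp only [RCLike.inner_apply, conj_trivial]
  ring

theorem hasSum_form (hμ : 0 < μ) (hρ : 0 < ρ) {x : L2 μ ρ} (hx : x ∈ domain lam μ ρ) :
    HasSum (fun N => weight μ ρ N * ⟪comp hμ hρ x N, genSeq lam μ ρ (comp hμ hρ x) N⟫)
      (form lam μ ρ x) := (hasSum_norm_genSeq hμ hρ hx.2).2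

theorem genSeq_eq_of_mem_eigenspace (hμ : 0 < μ) (hρ : 0 < ρ) {c : ℝ} {x : L2 μ ρ}
    (hx : x ∈ eigenspace lam μ ρ c) (N : ℕ) :
    genSeq lam μ ρ (comp hμ hρ x) N = c • comp hμ hρ x N := by
  refine Lp.ext ((coeFn_genSeq_comp hμ hρ x N).trans ?_)
  filter_upwards [(ae_steady_iff hμ hρ).1 hx.2 N, Lp.coeFn_smul c (comp hμ hρ x N),
    coeFn_comp hμ hρ x N] with v h1 h2 h3
  rw [h1, h2, Pi.smul_apply, h3, smul_eq_mul]

theorem mem_eigenspace_of_genSeq_eq (hμ : 0 < μ) (hρ : 0 < ρ) {c : ℝ} {x : L2 μ ρ}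
    (hs : IsSymmetric x) (h : ∀ N, genSeq lam μ ρ (comp hμ hρ x) N = c • comp hμ hρ x N) :
    x ∈ eigenspace lam μ ρ c := by
  have h1 : generator lam μ ρ x =ᵐ[steady μ ρ] fun z => c * x z := by
    refine (ae_steady_iff hμ hρ).2 fun N => ?_
    filter_upwards [coeFn_genSeq_comp (lam := lam) hμ hρ x N,
      Lp.coeFn_smul c (comp hμ hρ x N), coeFn_comp hμ hρ x N] with v h1 h2 h3
    rw [← h1, h N, h2, Pi.smul_apply, h3, smul_eq_mul]
  exact ⟨⟨hs, (memLp_congr_ae h1).2 ((Lp.memLp x).const_mul c)⟩, h1⟩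

theorem form_of_mem_eigenspace (hμ : 0 < μ) (hρ : 0 < ρ) {c : ℝ} {x : L2 μ ρ}
    (hx : x ∈ eigenspace lam μ ρ c) : form lam μ ρ x = c * ‖x‖ ^ 2 := by
  refine (hasSum_form hμ hρ hx.1).unique ?_
  refine ((hasSum_norm_comp hμ hρ x).mul_left c).congr_fun fun N => ?_
  rw [genSeq_eq_of_mem_eigenspace hμ hρ hx, inner_smul_right, real_inner_self_eq_norm_sq]
  ring

/-! ### Symmetric states -/

theorem lift_perm_eq (hμ : 0 < μ) (hρ : 0 < ρ) {x : L2 μ ρ} (hx : IsSymmetric x) {N : ℕ}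
    (σ : Equiv.Perm (Fin N)) : lift σ.injective (comp hμ hρ x N) = comp hμ hρ x N := by
  refine Lp.ext ((coeFn_lift σ.injective _).trans ?_)
  filter_upwards [ae_of_pull (measurePreserving_comp σ.injective) (coeFn_comp hμ hρ x N),
    coeFn_comp hμ hρ x N, ae_volume_iff.1 (hx N σ)] with v h1 h2 h3
  rw [h2, ← h3]
  exact h1

theorem adjoint_single_eq (hμ : 0 < μ) (hρ : 0 < ρ) {x : L2 μ ρ} (hx : IsSymmetric x) {N : ℕ}
    (i j : Fin N) :
    (single i).adjoint (comp hμ hρ x N) = (single j).adjoint (comp hμ hρ x N) := by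
  refine ext_inner_right ℝ fun y => ?_
  rw [ContinuousLinearMap.adjoint_inner_left, ContinuousLinearMap.adjoint_inner_left,
    ← inner_lift_lift (Equiv.swap i j).injective, lift_perm_eq hμ hρ hx]
  congr 1
  exact lift_lift _ _ _ (fun _ => (Equiv.swap_apply_left i j).symm) y

/-- The common value of the centred marginals of a symmetric state. -/
def commonMarg (h : ∀ N, X (Fin N)) (N : ℕ) : X (Fin 1) :=
  if hN : 0 < N then marg ⟨0, hN⟩ (h N) else 0

theorem marg_comp_eq (hμ : 0 < μ) (hρ : 0 < ρ) {x : L2 μ ρ} (hx : IsSymmetric x) (N : ℕ)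
    (i : Fin N) : marg i (comp hμ hρ x N) = commonMarg (comp hμ hρ x) N := by
  have hN : 0 < N := lt_of_le_of_lt (Nat.zero_le _) i.2
  rw [commonMarg, dif_pos hN, marg_apply, marg_apply, adjoint_single_eq hμ hρ hx i ⟨0, hN⟩]

end Components

/-! ### States orthogonal to `E₀ ⊕ E₁` -/

section Reduction

variable {lam μ ρ : ℝ} {N : ℕ}

theorem coeFn_sumSingle {f : X (Fin 1)} {F : ℝ → ℝ} (hf : f =ᵐ[gauss (Fin 1)] fun v => F (v 0)) :
    sumSingle N f =ᵐ[gauss (Fin N)] fun v => ∑ i, F (v i) := by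
  have h1 : ∀ᵐ v ∂gauss (Fin N), ∀ i : Fin N, single i f v = F (v i) := by
    rw [ae_all_iff]
    intro i
    filter_upwards [coeFn_lift (e := fun _ : Fin 1 => i) (Function.injective_of_subsingleton _) f,
      ae_of_pull (measurePreserving_comp (e := fun _ : Fin 1 => i)
        (Function.injective_of_subsingleton _)) hf] with v h1 h2
    exact h1.trans h2
  rw [sumSingle_apply]
  filter_upwards [h1, Lp.coeFn_finsetSum Finset.univ fun i : Fin N => single i f] with v h1 h2
  rw [h2, Finset.sum_apply]
  exact Finset.sum_congr rfl fun i _ => h1 i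

theorem coeFn_hermTwo : hermTwo =ᵐ[gauss (Fin 1)] fun v => 2 * Real.pi * v 0 ^ 2 - 1 := by
  rw [hermTwo]
  filter_upwards [Lp.coeFn_sub ((2 * Real.pi) • mono 2) (mono 0),
    Lp.coeFn_smul (2 * Real.pi) (mono 2), coeFn_mono 2, coeFn_mono 0] with v h1 h2 h3 h4
  rw [h1, Pi.sub_apply, h2, Pi.smul_apply, h3, h4, pow_zero, smul_eq_mul]

theorem coeFn_hermFour : hermFour =ᵐ[gauss (Fin 1)] fun v =>
    (2 * Real.pi * v 0 ^ 2) ^ 2 - 6 * (2 * Real.pi * v 0 ^ 2) + 3 := by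
  rw [hermFour]
  filter_upwards [Lp.coeFn_add ((2 * Real.pi) ^ 2 • mono 4 - (6 * (2 * Real.pi)) • mono 2)
      ((3 : ℝ) • mono 0), Lp.coeFn_sub ((2 * Real.pi) ^ 2 • mono 4)
      ((6 * (2 * Real.pi)) • mono 2), Lp.coeFn_smul ((2 * Real.pi) ^ 2) (mono 4),
    Lp.coeFn_smul (6 * (2 * Real.pi)) (mono 2), Lp.coeFn_smul (3 : ℝ) (mono 0), coeFn_mono 4,
    coeFn_mono 2, coeFn_mono 0] with v h1 h2 h3 h4 h5 h6 h7 h8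
  simp only [h1, h2, h3, h4, h5, h6, h7, h8, Pi.add_apply, Pi.sub_apply, Pi.smul_apply,
    smul_eq_mul]
  ring

theorem mean_eq_zero_of_const {f : X (Fin 1)} (hf : const 1 (mean f) = 0) : mean f = 0 := by
  rw [← norm_eq_zero, ← norm_const (N := 1), hf, norm_zero]

theorem mean_hermTwo : mean hermTwo = 0 := by
  refine mean_eq_zero_of_const ?_
  have hp := Real.pi_pos
  rw [hermTwo, map_sub, map_smul, map_sub, map_smul, const_mean_mono, const_mean_mono, smul_smul,
    moment_two, moment_zero, mul_one_div_cancel (by positivity), sub_self]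

theorem mean_hermFour : mean hermFour = 0 := by
  have h := mean_oneKac hermFour
  rw [oneKac_hermFour, map_smul] at h
  exact (smul_eq_zero.1 h).resolve_left (by norm_num)

/-- The constant function `1` of no variables. -/
def one : X (Fin 0) := (memLp_const (1 : ℝ)).toLp _

theorem coeFn_const_one : const N one =ᵐ[gauss (Fin N)] fun _ => 1 := by
  filter_upwards [coeFn_lift (e := (Fin.elim0 : Fin 0 → Fin N))
    (Function.injective_of_subsingleton _) one,
    ae_of_pull (measurePreserving_comp (e := (Fin.elim0 : Fin 0 → Fin N))
      (Function.injective_of_subsingleton _))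
      (MemLp.coeFn_toLp (memLp_const (μ := gauss (Fin 0)) (p := 2) (1 : ℝ)))] with v h1 h2
  exact h1.trans h2

theorem eq_zero_of_inner_one {y : X (Fin 0)} (h : ⟪one, y⟫ = 0) : y = 0 := by
  have hy : y =ᵐ[gauss (Fin 0)] fun _ => y 0 :=
    Eventually.of_forall fun v => by rw [Subsingleton.elim v 0]
  have h1 : ⟪one, y⟫ = y 0 := by
    rw [L2.inner_def]
    have h2 : ∫ v, ⟪one v, y v⟫ ∂gauss (Fin 0) = ∫ _, y 0 ∂gauss (Fin 0) := by
      refine integral_congr_ae ?_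
      filter_upwards [hy, MemLp.coeFn_toLp (memLp_const (μ := gauss (Fin 0)) (p := 2) (1 : ℝ))]
        with v h3 h4
      rw [one, h4, h3]
      simp
    rw [h2]
    simp
  refine Lp.ext ?_
  filter_upwards [hy, Lp.coeFn_zero ℝ 2 (gauss (Fin 0))] with v h3 h4
  rw [h3, h4, ← h1, h]
  rfl

theorem comp_e0 (hμ : 0 < μ) (hρ : 0 < ρ) (N : ℕ) : comp hμ hρ (e0 μ ρ) N = const N one := by
  refine Lp.ext ((comp_eq_of_ae hμ hρ (memLp_e0Fun μ ρ).coeFn_toLp N).trans ?_)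
  filter_upwards [coeFn_const_one (N := N)] with v hv
  rw [hv, e0Fun]

theorem comp_e1 (hμ : 0 < μ) (hρ : 0 < ρ) (N : ℕ) : comp hμ hρ (e1 μ ρ) N
    = (Real.sqrt (ρ / μ) * N - Real.sqrt (μ / ρ)) • const N one := by
  refine Lp.ext ((comp_eq_of_ae hμ hρ (memLp_e1Fun μ ρ).coeFn_toLp N).trans ?_)
  filter_upwards [coeFn_const_one (N := N), Lp.coeFn_smul
    (Real.sqrt (ρ / μ) * N - Real.sqrt (μ / ρ)) (const N one)] with v hv h2
  rw [h2, Pi.smul_apply, hv, smul_eq_mul, e1Fun, creation_e0Fun, e0Fun]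
  ring

theorem comp_e2 (hμ : 0 < μ) (hρ : 0 < ρ) (N : ℕ) : comp hμ hρ (e2 μ ρ) N
    = Real.sqrt (ρ / (2 * μ)) • sumSingle N hermTwo := by
  refine Lp.ext ((comp_eq_of_ae hμ hρ (memLp_e2Fun μ ρ).coeFn_toLp N).trans ?_)
  filter_upwards [coeFn_sumSingle (N := N) (F := fun x => 2 * Real.pi * x ^ 2 - 1) coeFn_hermTwo,
    Lp.coeFn_smul (Real.sqrt (ρ / (2 * μ))) (sumSingle N hermTwo)] with v hv h2
  rw [h2, Pi.smul_apply, hv, smul_eq_mul, e2Fun]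

theorem mem_orthogonal_iff {x : L2 μ ρ} : x ∈ (E0 μ ρ ⊔ E1 μ ρ)ᗮ ↔
    ⟪e0 μ ρ, x⟫ = 0 ∧ ⟪e1 μ ρ, x⟫ = 0 ∧ ⟪e2 μ ρ, x⟫ = 0 := by
  rw [← Submodule.inf_orthogonal, Submodule.mem_inf, E0, E1, Submodule.span_insert,
    ← Submodule.inf_orthogonal, Submodule.mem_inf, Submodule.mem_orthogonal_singleton_iff_inner_right,
    Submodule.mem_orthogonal_singleton_iff_inner_right,
    Submodule.mem_orthogonal_singleton_iff_inner_right]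

theorem summable_smul_mean (hμ : 0 < μ) (hρ : 0 < ρ) {h : ∀ N, X (Fin N)}
    (hh : Summable fun N => weight μ ρ N * ‖h N‖ ^ 2) :
    Summable fun N : ℕ => (N : ℝ) • weight μ ρ N • mean (h N) := by
  refine Summable.of_norm_bounded ((hasSum_weight_mul_sq μ ρ).summable.add
    (summable_mean hμ hρ hh)) fun N => ?_
  have ha := weight_pos hμ hρ N
  rw [norm_smul, norm_smul, Real.norm_eq_abs, Real.norm_eq_abs, abs_of_pos ha, Nat.abs_cast]
  nlinarith [mul_nonneg ha.le (sq_nonneg ((N : ℝ) - ‖mean (h N)‖)),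
    mul_nonneg ha.le (sq_nonneg ‖mean (h N)‖), mul_nonneg ha.le (sq_nonneg (N : ℝ))]

/-- Orthogonality to `e0` and `e1` gives the two moment conditions on the means, and orthogonality
to `e2` gives that on the averaged marginal; symmetry makes the marginals independent of the
particle. -/
theorem exists_reduced (hμ : 0 < μ) (hρ : 0 < ρ) {x : L2 μ ρ} (hs : IsSymmetric x)
    (hx : x ∈ (E0 μ ρ ⊔ E1 μ ρ)ᗮ) :
    ∃ f, Reduced μ ρ (comp hμ hρ x) (commonMarg (comp hμ hρ x)) f (‖x‖ ^ 2) := by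
  obtain ⟨h0, h1, h2⟩ := mem_orthogonal_iff.1 hx
  have hn := hasSum_norm_comp hμ hρ x
  have hφ := marg_comp_eq hμ hρ hs
  obtain ⟨f, hf⟩ := summable_weight_smul hμ hρ (summable_marg_succ hμ hρ hn.summable hφ)
  obtain ⟨S, hS⟩ := summable_weight_smul hμ hρ (summable_mean hμ hρ hn.summable)
  obtain ⟨T, hT⟩ := summable_smul_mean hμ hρ hn.summable
  have hS1 : ⟪one, S⟫ = 0 := by
    have h3 := hS.mapL (innerSL ℝ one)
    have h4 := hasSum_inner_comp hμ hρ (e0 μ ρ) x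
    rw [h0] at h4
    refine h3.unique (h4.congr_fun fun N => ?_)
    rw [comp_e0, inner_const_left, innerSL_apply_apply, inner_smul_right]
  have hT1 : ⟪one, T⟫ = 0 := by
    have h3 := ((hT.mapL (innerSL ℝ one)).mul_left (Real.sqrt (ρ / μ))).sub
      ((hS.mapL (innerSL ℝ one)).mul_left (Real.sqrt (μ / ρ)))
    have h4 := hasSum_inner_comp hμ hρ (e1 μ ρ) x
    rw [h1] at h4
    have h5 := h3.unique (h4.congr_fun fun N => by
      rw [comp_e1, inner_smul_left, inner_const_left, innerSL_apply_apply, innerSL_apply_apply,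
        inner_smul_right, inner_smul_right]
      simp only [conj_trivial]
      ring)
    rw [innerSL_apply_apply, innerSL_apply_apply, hS1, mul_zero, sub_zero] at h5
    exact (mul_eq_zero.1 h5).resolve_left (Real.sqrt_pos.2 (by positivity)).ne'
  rw [eq_zero_of_inner_one hS1] at hS
  rw [eq_zero_of_inner_one hT1] at hT
  refine ⟨f, hn, hφ, hf, hS, hT, ?_⟩
  have h3 : HasSum (fun N : ℕ => weight μ ρ N * (N * ⟪commonMarg (comp hμ hρ x) N, hermTwo⟫))
      (μ / ρ * ⟪f, hermTwo⟫) := by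
    refine hasSum_weight_shift (F := fun N => ⟪commonMarg (comp hμ hρ x) (N + 1), hermTwo⟫)
      (G := fun N => ⟪commonMarg (comp hμ hρ x) N, hermTwo⟫) (fun N => rfl) ?_
    have h4 := hf.mapL (innerSL ℝ hermTwo)
    simp only [innerSL_apply_apply, inner_smul_right] at h4
    rw [real_inner_comm]
    exact h4.congr_fun fun N => by rw [real_inner_comm]
  have h4 := hasSum_inner_comp hμ hρ (e2 μ ρ) x
  rw [h2] at h4
  have h5 := (h3.mul_left (Real.sqrt (ρ / (2 * μ)))).unique (h4.congr_fun fun N => by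
    rw [comp_e2, inner_smul_left, real_inner_comm (comp hμ hρ x N),
      inner_sumSingle_right (hφ N) mean_hermTwo]
    simp only [conj_trivial]
    ring)
  have h6 : Real.sqrt (ρ / (2 * μ)) ≠ 0 := (Real.sqrt_pos.2 (by positivity)).ne'
  have h7 : μ / ρ ≠ 0 := by positivity
  rw [real_inner_comm]
  simpa [h6, h7] using h5

end Reduction

/-! ### The states built from Hermite polynomials -/

section Sector

variable {lam μ ρ : ℝ} {N : ℕ}

theorem lift_succAbove_const (i : Fin (N + 1)) (c : X (Fin 0)) :
    lift (Fin.succAbove_right_injective (p := i)) (const N c) = const (N + 1) c :=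
  lift_lift _ _ _ (fun j => j.elim0) c

theorem createOp_const (c : X (Fin 0)) :
    createOp N (const N c) = ((N : ℝ) + 1) • const (N + 1) c := by
  rw [createOp_apply]
  simp only [lift_succAbove_const, Finset.sum_const, Finset.card_univ, Fintype.card_fin]
  rw [← Nat.cast_smul_eq_nsmul ℝ]
  push_cast
  rfl

theorem annihOp_const (c : X (Fin 0)) : annihOp N (const (N + 1) c) = const N c := by
  rw [annihOp_apply]
  have h : ∀ i : Fin (N + 1), (lift (Fin.succAbove_right_injective (p := i))).adjoint
      (const (N + 1) c) = const N c := fun i => by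
    rw [← lift_succAbove_const i, adjoint_lift_lift_self]
  simp only [h, Finset.sum_const, Finset.card_univ, Fintype.card_fin]
  rw [← Nat.cast_smul_eq_nsmul ℝ, smul_smul]
  push_cast
  rw [one_div_mul_cancel (by positivity), one_smul]

theorem kacOp_const (c : X (Fin 0)) : kacOp N (const N c) = 0 := by
  rw [kacOp_apply]
  refine Finset.sum_eq_zero fun i _ => Finset.sum_eq_zero fun j _ => ?_
  split_ifs with hij
  · rw [sub_eq_zero]
    exact rot_lift_of_ne hij _ (fun k => k.elim0) c
  · rfl

theorem lift_succAbove_single (i : Fin (N + 1)) (j : Fin N) (f : X (Fin 1)) :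
    lift (Fin.succAbove_right_injective (p := i)) (single j f) = single (i.succAbove j) f :=
  lift_lift (Fin.succAbove_right_injective (p := i)) (e' := fun _ : Fin 1 => j)
    (Function.injective_of_subsingleton _) (e'' := fun _ : Fin 1 => i.succAbove j)
    (Function.injective_of_subsingleton _) (fun _ => rfl) f

/-- Each of the N + 1 removals drops one term of the sum over N + 1 particles, so every term
survives N times. -/
theorem createOp_sumSingle (f : X (Fin 1)) :
    createOp N (sumSingle N f) = (N : ℝ) • sumSingle (N + 1) f := by
  have h : ∀ i : Fin (N + 1), lift (Fin.succAbove_right_injective (p := i)) (sumSingle N f)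
      = sumSingle (N + 1) f - single i f := fun i => by
    rw [sumSingle_apply, sumSingle_apply, map_sum, Fin.sum_univ_succAbove _ i]
    simp only [lift_succAbove_single, add_sub_cancel_left]
  rw [createOp_apply]
  simp only [h, Finset.sum_sub_distrib, ← sumSingle_apply, Finset.sum_const, Finset.card_univ,
    Fintype.card_fin]
  rw [← Nat.cast_smul_eq_nsmul ℝ]
  push_cast
  module

theorem annihOp_sumSingle {f : X (Fin 1)} (hf : mean f = 0) :
    annihOp N (sumSingle (N + 1) f) = sumSingle N f := by
  have h : ∀ i : Fin (N + 1), (lift (Fin.succAbove_right_injective (p := i))).adjoint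
      (sumSingle (N + 1) f) = sumSingle N f := fun i => by
    have h1 : (lift (Fin.succAbove_right_injective (p := i))).adjoint (single i f) = 0 := by
      have h2 := adjoint_lift_lift (Fin.succAbove_right_injective (p := i))
        (e' := fun _ : Fin 1 => i) (Function.injective_of_subsingleton _)
        (a := (Fin.elim0 : Fin 0 → Fin N)) (Function.injective_of_subsingleton _)
        (b := (Fin.elim0 : Fin 0 → Fin 1)) (Function.injective_of_subsingleton _)
        (fun k => k.elim0) (fun j k h => absurd h (Fin.succAbove_ne i j)) f
      exact h2.trans ((congrArg _ hf).trans (map_zero _))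
    rw [sumSingle_apply, sumSingle_apply, map_sum, Fin.sum_univ_succAbove _ i, h1, zero_add]
    simp only [← lift_succAbove_single, adjoint_lift_lift_self]
  rw [annihOp_apply]
  simp only [h, Finset.sum_const, Finset.card_univ, Fintype.card_fin]
  rw [← Nat.cast_smul_eq_nsmul ℝ, smul_smul]
  push_cast
  rw [one_div_mul_cancel (by positivity), one_smul]

theorem kacOp_sumSingle_hermTwo : kacOp N (sumSingle N hermTwo) = 0 := by
  -- The squared norm of the centred part is expressed through `oneKac`, which annihilates H₂; this
  -- is conservation of energy.
  have h : doubleKacCentred hermTwo = 0 := by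
    have h1 := norm_doubleKacCentred_sq hermTwo
    rw [oneKac_hermTwo, inner_zero_right, norm_zero] at h1
    norm_num at h1
    exact h1
  rw [kacOp_sumSingle, oneKac_hermTwo, h]
  simp [sumPair]

/-- The symmetric two-particle state `∑_{i<j} (3/2) H₂(v_i) H₂(v_j)`. -/
def pairState (N : ℕ) : X (Fin N) := sumPair N (doubleKacCentred hermFour)

/-- The symmetric one-particle state `∑ᵢ H₄(v_i)`. -/
def quarticState (N : ℕ) : X (Fin N) := sumSingle N hermFour

theorem kacOp_quarticState :
    kacOp N (quarticState N) = -(((N : ℝ) - 1) / 4) • quarticState N + pairState N := by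
  rw [quarticState, kacOp_sumSingle, oneKac_hermFour, map_smul, pairState]
  module

theorem norm_quarticState_sq : ‖quarticState N‖ ^ 2 = 24 * N := by
  rw [quarticState, norm_sumSingle_sq mean_hermFour, norm_hermFour_sq, mul_comm]

theorem norm_pairState_sq : ‖pairState N‖ ^ 2 = 9 / 2 * (N * ((N : ℝ) - 1)) := by
  rw [pairState, norm_sumPair_sq (adjoint_single_zero_doubleKacCentred _)
    (adjoint_single_one_doubleKacCentred _), norm_doubleKacCentred_sq, oneKac_hermFour,
    inner_smul_right, norm_smul, mul_pow, real_inner_self_eq_norm_sq, norm_hermFour_sq]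
  norm_num
  ring

theorem inner_pairState_quarticState : ⟪pairState N, quarticState N⟫ = 0 :=
  inner_sumPair_sumSingle (adjoint_single_zero_doubleKacCentred _)
    (adjoint_single_one_doubleKacCentred _) _

/-- The second Hermite polynomial as a function. -/
def quad (x : ℝ) : ℝ := 2 * Real.pi * x ^ 2 - 1

theorem collide_add_mul {i j : Fin N} (a b c : ℝ) (F G : (Fin N → ℝ) → ℝ) (hF : Continuous F)
    (hG : Continuous G) (v : Fin N → ℝ) :
    collide i j (fun u => a * F u + b * G u + c) v
      = a * collide i j F v + b * collide i j G v + c := by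
  have hr : Continuous fun θ => rotate i j θ v := by
    unfold rotate
    fun_prop
  unfold collide
  rw [intervalIntegral.integral_add (Continuous.intervalIntegrable (by fun_prop) _ _)
    (Continuous.intervalIntegrable (by fun_prop) _ _), intervalIntegral.integral_add
    (Continuous.intervalIntegrable (by fun_prop) _ _)
    (Continuous.intervalIntegrable (by fun_prop) _ _), intervalIntegral.integral_const_mul,
    intervalIntegral.integral_const_mul, intervalIntegral.integral_const, sub_zero, smul_eq_mul]
  field_simp

theorem coeFn_doubleKacCentred :
    doubleKacCentred hermFour =ᵐ[gauss (Fin 2)] fun v => 3 / 2 * (quad (v 0) * quad (v 1)) := by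
  have h0 := coeFn_sumSingle (N := 2)
    (F := fun x => (2 * Real.pi * x ^ 2) ^ 2 - 6 * (2 * Real.pi * x ^ 2) + 3) coeFn_hermFour
  have hd : double hermFour = sumSingle 2 hermFour := by
    rw [sumSingle_apply, Fin.sum_univ_two, double_apply]
  have h1 : doubleKacCentred hermFour = rot zero_ne_one_fin_two (sumSingle 2 hermFour)
      + (-(3 / 4) : ℝ) • sumSingle 2 hermFour := by
    rw [doubleKacCentred, doubleKac_apply, oneKac_hermFour, map_smul, map_smul, hd,
      sumSingle_apply, Fin.sum_univ_two]
    module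
  rw [h1]
  filter_upwards [h0, coeFn_rot_of_ae zero_ne_one_fin_two _ h0,
    Lp.coeFn_add (rot zero_ne_one_fin_two (sumSingle 2 hermFour))
      ((-(3 / 4) : ℝ) • sumSingle 2 hermFour),
    Lp.coeFn_smul (-(3 / 4) : ℝ) (sumSingle 2 hermFour)] with v h2 h3 h4 h5
  rw [h4, Pi.add_apply, h5, Pi.smul_apply, h3, h2, smul_eq_mul]
  have h6 : (fun u : Fin 2 → ℝ => ∑ i, ((2 * Real.pi * u i ^ 2) ^ 2
      - 6 * (2 * Real.pi * u i ^ 2) + 3)) = fun u => (2 * Real.pi) ^ 2 * (u 0 ^ (2 * 2)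
      + u 1 ^ (2 * 2)) + (-(12 * Real.pi)) * (u 0 ^ (2 * 1) + u 1 ^ (2 * 1)) + 6 := by
    funext u
    rw [Fin.sum_univ_two]
    ring
  rw [h6, collide_add_mul _ _ _ _ _ (by fun_prop) (by fun_prop),
    collide_pow_add_pow_even zero_ne_one_fin_two, collide_pow_add_pow_even zero_ne_one_fin_two,
    mul_one, show 2 * 2 = 4 by rfl, collideRate_four, collideRate_two, Fin.sum_univ_two, quad, quad]
  ring

/-- The function representing `quarticState`. -/
def quarticFun : Phase → ℝ := fun x =>
  ∑ i, ((2 * Real.pi * x.2 i ^ 2) ^ 2 - 6 * (2 * Real.pi * x.2 i ^ 2) + 3)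

/-- The function representing `pairState`. -/
def pairFun : Phase → ℝ := fun x => 3 / 4 * ((∑ i, quad (x.2 i)) ^ 2 - ∑ i, quad (x.2 i) ^ 2)

theorem coeFn_quarticState :
    quarticState N =ᵐ[gauss (Fin N)] fun v => quarticFun ⟨N, v⟩ :=
  coeFn_sumSingle (F := fun x => (2 * Real.pi * x ^ 2) ^ 2 - 6 * (2 * Real.pi * x ^ 2) + 3)
    coeFn_hermFour

theorem sum_Ioi_mul (F : Fin N → ℝ) :
    ∑ i, ∑ j ∈ Finset.Ioi i, F i * F j = ((∑ i, F i) ^ 2 - ∑ i, F i ^ 2) / 2 := by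
  have h1 : ∑ i : Fin N, ∑ j ∈ Finset.Iio i, F i * F j = ∑ i, ∑ j ∈ Finset.Ioi i, F i * F j := by
    rw [Finset.sum_comm' (t' := Finset.univ) (s' := fun j => Finset.Ioi j) (by simp)]
    exact Finset.sum_congr rfl fun i _ => Finset.sum_congr rfl fun j _ => mul_comm _ _
  have h2 : (∑ i, F i) ^ 2 = ∑ i, F i ^ 2 + ∑ i : Fin N, ∑ j ∈ Finset.Iio i, F i * F j
      + ∑ i, ∑ j ∈ Finset.Ioi i, F i * F j := by
    rw [pow_two, Finset.sum_mul_sum, ← Finset.sum_add_distrib, ← Finset.sum_add_distrib]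
    refine Finset.sum_congr rfl fun i _ => ?_
    have h3 : (Finset.univ : Finset (Fin N)) = insert i (Finset.Iio i ∪ Finset.Ioi i) := by
      ext j
      simp only [Finset.mem_univ, Finset.mem_insert, Finset.mem_union, Finset.mem_Iio,
        Finset.mem_Ioi, true_iff]
      rcases lt_trichotomy j i with h | h | h <;> tauto
    rw [h3, Finset.sum_insert (by simp), Finset.sum_union]
    · ring
    · rw [Finset.disjoint_left]
      intro j hj hj'
      exact lt_asymm (Finset.mem_Iio.1 hj) (Finset.mem_Ioi.1 hj')
  rw [h1] at h2
  linarith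

theorem coeFn_pairState : pairState N =ᵐ[gauss (Fin N)] fun v => pairFun ⟨N, v⟩ := by
  have h1 : ∀ᵐ v ∂gauss (Fin N), ∀ i j : Fin N, ∀ hij : i ≠ j,
      pair hij (doubleKacCentred hermFour) v = 3 / 2 * (quad (v i) * quad (v j)) := by
    simp only [ae_all_iff]
    intro i j hij
    filter_upwards [coeFn_lift (pair_injective hij) (doubleKacCentred hermFour),
      ae_of_pull (measurePreserving_comp (pair_injective hij)) coeFn_doubleKacCentred]
      with v h1 h2
    exact h1.trans h2
  have h2 : ∀ᵐ v ∂gauss (Fin N), ∀ i : Fin N, (∑ j ∈ Finset.Ioi i,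
      (if hij : i ≠ j then pair hij (doubleKacCentred hermFour) else 0 : X (Fin N)) :
        X (Fin N)) v = ∑ j ∈ Finset.Ioi i, 3 / 2 * (quad (v i) * quad (v j)) := by
    rw [ae_all_iff]
    intro i
    filter_upwards [h1, Lp.coeFn_finsetSum (Finset.Ioi i) fun j =>
      (if hij : i ≠ j then pair hij (doubleKacCentred hermFour) else 0 : X (Fin N))] with v h3 h4
    rw [h4, Finset.sum_apply]
    refine Finset.sum_congr rfl fun j hj => ?_
    rw [dif_pos (Finset.mem_Ioi.1 hj).ne, h3]
  rw [pairState, sumPair]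
  filter_upwards [h2, Lp.coeFn_finsetSum Finset.univ fun i : Fin N => (∑ j ∈ Finset.Ioi i,
      (if hij : i ≠ j then pair hij (doubleKacCentred hermFour) else 0 : X (Fin N)))] with v h3 h4
  rw [h4, Finset.sum_apply]
  have h5 := sum_Ioi_mul fun i => quad (v i)
  have h6 : ∑ i, ∑ j ∈ Finset.Ioi i, 3 / 2 * (quad (v i) * quad (v j))
      = 3 / 2 * ∑ i, ∑ j ∈ Finset.Ioi i, quad (v i) * quad (v j) := by
    simp only [Finset.mul_sum]
  rw [Finset.sum_congr rfl fun i _ => h3 i, h6, h5, pairFun]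
  ring

/-- This combination is (∑ H₂(v_i))² - 2N, a function of the total energy. -/
theorem rot_pairState {i j : Fin N} (hij : i ≠ j) :
    rot hij ((4 / 3 : ℝ) • pairState N + quarticState N + (4 : ℝ) • sumSingle N hermTwo)
      = (4 / 3 : ℝ) • pairState N + quarticState N + (4 : ℝ) • sumSingle N hermTwo := by
  have h : ((4 / 3 : ℝ) • pairState N + quarticState N + (4 : ℝ) • sumSingle N hermTwo : X (Fin N))
      =ᵐ[gauss (Fin N)] fun v => (∑ i, quad (v i)) ^ 2 - 2 * N := by
    filter_upwards [coeFn_pairState (N := N), coeFn_quarticState (N := N),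
      coeFn_sumSingle (N := N) (F := quad) coeFn_hermTwo,
      Lp.coeFn_add ((4 / 3 : ℝ) • pairState N + quarticState N) ((4 : ℝ) • sumSingle N hermTwo),
      Lp.coeFn_add ((4 / 3 : ℝ) • pairState N) (quarticState N),
      Lp.coeFn_smul (4 / 3 : ℝ) (pairState N), Lp.coeFn_smul (4 : ℝ) (sumSingle N hermTwo)]
      with v h1 h2 h3 h4 h5 h6 h7
    rw [h4, Pi.add_apply, h5, Pi.add_apply, h6, h7, Pi.smul_apply, Pi.smul_apply, h1, h2, h3,
      pairFun, quarticFun, smul_eq_mul, smul_eq_mul]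
    have h8 : ∑ i, ((2 * Real.pi * v i ^ 2) ^ 2 - 6 * (2 * Real.pi * v i ^ 2) + 3)
        = ∑ i, quad (v i) ^ 2 - 4 * ∑ i, quad (v i) - 2 * N := by
      have h9 : (2 * N : ℝ) = ∑ _i : Fin N, 2 := by
        rw [Finset.sum_const, Finset.card_univ, Fintype.card_fin, nsmul_eq_mul, mul_comm]
      rw [h9, Finset.mul_sum, ← Finset.sum_sub_distrib, ← Finset.sum_sub_distrib]
      refine Finset.sum_congr rfl fun i _ => ?_
      rw [quad]
      ring
    simp only
    rw [h8]
    ring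
  refine Lp.ext ((coeFn_rot_of_ae hij _ h).trans ?_)
  filter_upwards [h] with v hv
  rw [hv]
  refine collide_const_of_rotate fun θ => ?_
  have h1 : ∑ k, quad (rotate i j θ v k) = ∑ k, quad (v k) := by
    rw [sum_rotate hij (fun _ => quad)]
    have := Real.sin_sq_add_cos_sq θ
    simp only [quad]
    linear_combination (2 * Real.pi * (v i ^ 2 + v j ^ 2)) * this
  rw [h1]

/-- K kills both the function of the energy in `rot_pairState` and ∑ H₂(v_i). The resulting relation
closes the quartic sector under K. -/
theorem kacOp_pairState : kacOp N (pairState N) = -(3 / 4 : ℝ) • kacOp N (quarticState N) := by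
  have h : kacOp N ((4 / 3 : ℝ) • pairState N + quarticState N + (4 : ℝ) • sumSingle N hermTwo)
      = 0 := by
    rw [kacOp_apply]
    refine Finset.sum_eq_zero fun i _ => Finset.sum_eq_zero fun j _ => ?_
    split_ifs with hij
    · rw [rot_pairState, sub_self]
    · rfl
  rw [map_add, map_add, map_smul, map_smul, kacOp_sumSingle_hermTwo, smul_zero, add_zero] at h
  have h2 : kacOp N (pairState N) = (3 / 4 : ℝ) • ((4 / 3 : ℝ) • kacOp N (pairState N)
      + kacOp N (quarticState N)) - (3 / 4 : ℝ) • kacOp N (quarticState N) := by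
    module
  rw [h2, h]
  module

theorem createOp_quarticState : createOp N (quarticState N) = (N : ℝ) • quarticState (N + 1) :=
  createOp_sumSingle _

theorem annihOp_quarticState : annihOp N (quarticState (N + 1)) = quarticState N :=
  annihOp_sumSingle mean_hermFour

/-- Each pair survives the removal of any of the N - 1 remaining particles. -/
theorem createOp_pairState : createOp N (pairState N) = ((N : ℝ) - 1) • pairState (N + 1) := by
  refine Lp.ext ((coeFn_createOp _ coeFn_pairState).trans ?_)
  filter_upwards [coeFn_pairState (N := N + 1), Lp.coeFn_smul ((N : ℝ) - 1) (pairState (N + 1))]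
    with v h1 h2
  rw [h2, Pi.smul_apply, h1, smul_eq_mul]
  have h3 : ∀ (F : ℝ → ℝ) (i : Fin (N + 1)), ∑ j, F (i.removeNth v j)
      = ∑ j, F (v j) - F (v i) := fun F i => by
    rw [Fin.sum_univ_succAbove (fun j => F (v j)) i, add_sub_cancel_left]
    rfl
  simp only [creation, pairFun, h3 quad, h3 fun x => quad x ^ 2, ← Finset.mul_sum,
    Finset.sum_sub_distrib, sub_sq, Finset.sum_add_distrib, Finset.sum_const, Finset.card_univ,
    Fintype.card_fin, nsmul_eq_mul]
  push_cast
  ring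

theorem integral_sq : ∫ w, quad w ∂maxwellian = 0 := by
  have hp := Real.pi_pos
  simp only [quad]
  rw [integral_sub ((integrable_pow 2).const_mul _) (integrable_const _), integral_const_mul]
  have h := moment_two
  rw [moment] at h
  rw [h]
  simp
  field_simp
  ring

theorem annihOp_pairState : annihOp N (pairState (N + 1)) = pairState N := by
  refine Lp.ext ((coeFn_annihOp _ coeFn_pairState).trans ?_)
  filter_upwards [coeFn_pairState (N := N)] with v h1
  rw [h1]
  have h2 : ∀ i : Fin (N + 1), ∫ w : ℝ, Real.exp (-(Real.pi * w ^ 2))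
      * pairFun ⟨N + 1, i.insertNth w v⟩ = pairFun ⟨N, v⟩ := fun i => by
    rw [← integral_maxwellian]
    have h3 : ∀ w : ℝ, pairFun ⟨N + 1, i.insertNth w v⟩
        = pairFun ⟨N, v⟩ + 3 / 2 * (∑ j, quad (v j)) * quad w := fun w => by
      simp only [pairFun]
      rw [Fin.sum_univ_succAbove _ i, Fin.sum_univ_succAbove _ i]
      simp only [Fin.insertNth_apply_same, Fin.insertNth_apply_succAbove]
      ring
    have h4 : Integrable quad maxwellian :=
      ((integrable_pow 2).const_mul _).sub (integrable_const _)
    simp only [h3]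
    rw [integral_add (integrable_const _) (h4.const_mul _), integral_const_mul, integral_sq]
    simp
  simp only [annihilation, h2, Finset.sum_const, Finset.card_univ, Fintype.card_fin, nsmul_eq_mul]
  push_cast
  field_simp

end Sector

/-! ### Eigenvectors as weak limits of maximizers -/

section WeakLimit

variable {H ι : Type*} [NormedAddCommGroup H] [InnerProductSpace ℝ H] {b g : ι → H}

theorem inner_linearCombination_comm (hsymm : ∀ k l, ⟪g k, b l⟫ = ⟪b k, g l⟫) (c d : ι →₀ ℝ) :
    ⟪Finsupp.linearCombination ℝ g c, Finsupp.linearCombination ℝ b d⟫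
      = ⟪Finsupp.linearCombination ℝ b c, Finsupp.linearCombination ℝ g d⟫ := by
  simp only [Finsupp.linearCombination_apply, Finsupp.sum, sum_inner, inner_sum, inner_smul_left,
    inner_smul_right, hsymm]

/-- The Finsupp with given coefficients on a finite set. -/
def ofCoeff (s : Finset ι) : EuclideanSpace ℝ s →ₗ[ℝ] ι →₀ ℝ :=
  ∑ k : s, (Finsupp.lsingle (k : ι)) ∘ₗ
    (EuclideanSpace.proj (𝕜 := ℝ) k : EuclideanSpace ℝ s →L[ℝ] ℝ).toLinearMap

theorem linearCombination_ofCoeff (s : Finset ι) (v : ι → H) (x : EuclideanSpace ℝ s) :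
    Finsupp.linearCombination ℝ v (ofCoeff s x) = ∑ k : s, x k • v k := by
  simp [ofCoeff]

variable [CompleteSpace H]

/-- Rayleigh-Ritz on the span of finitely many basis vectors: the form attains its maximum on the
compact sphere, and the stationarity condition is the eigenvalue equation tested against these
vectors. -/
theorem exists_maximizer [DecidableEq ι] (hb : Orthonormal ℝ b)
    (hsymm : ∀ k l, ⟪g k, b l⟫ = ⟪b k, g l⟫) (s : Finset ι) (hs : s.Nonempty) :
    ∃ c : ι →₀ ℝ, ∃ E : ℝ, ‖Finsupp.linearCombination ℝ b c‖ = 1 ∧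
      (∀ k ∈ s, ⟪Finsupp.linearCombination ℝ b c, g k⟫
        = E * ⟪Finsupp.linearCombination ℝ b c, b k⟫) ∧
      ⟪Finsupp.linearCombination ℝ b c, Finsupp.linearCombination ℝ g c⟫ = E ∧
      ∀ d : ι →₀ ℝ, d.support ⊆ s →
        ⟪Finsupp.linearCombination ℝ b d, Finsupp.linearCombination ℝ g d⟫
          ≤ E * ‖Finsupp.linearCombination ℝ b d‖ ^ 2 := by
  have hne : Nonempty s := hs.to_subtype
  obtain ⟨Φ, hΦ⟩ : ∃ Φ : EuclideanSpace ℝ s →L[ℝ] H,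
      ∀ x, Φ x = Finsupp.linearCombination ℝ b (ofCoeff s x) :=
    ⟨(Finsupp.linearCombination ℝ b ∘ₗ ofCoeff s).toContinuousLinearMap, fun _ => rfl⟩
  obtain ⟨Γ, hΓ⟩ : ∃ Γ : EuclideanSpace ℝ s →L[ℝ] H,
      ∀ x, Γ x = Finsupp.linearCombination ℝ g (ofCoeff s x) :=
    ⟨(Finsupp.linearCombination ℝ g ∘ₗ ofCoeff s).toContinuousLinearMap, fun _ => rfl⟩
  have hsub : Orthonormal ℝ fun k : s => b k := hb.comp _ Subtype.val_injective
  have hn : ∀ x, ‖Φ x‖ ^ 2 = ‖x‖ ^ 2 := fun x => by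
    rw [hΦ, linearCombination_ofCoeff, ← real_inner_self_eq_norm_sq, hsub.inner_sum,
      EuclideanSpace.norm_sq_eq]
    refine Finset.sum_congr rfl fun k _ => ?_
    rw [Real.norm_eq_abs, sq_abs, pow_two]
    rfl
  obtain ⟨T, hT⟩ : ∃ T : EuclideanSpace ℝ s →L[ℝ] EuclideanSpace ℝ s,
      ∀ x y, ⟪T x, y⟫ = ⟪Φ x, Γ y⟫ := by
    refine ⟨(ContinuousLinearMap.adjoint Γ).comp Φ, fun x y => ?_⟩
    rw [ContinuousLinearMap.comp_apply, ContinuousLinearMap.adjoint_inner_left]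
  have hTs : IsSelfAdjoint T := by
    rw [ContinuousLinearMap.isSelfAdjoint_iff_isSymmetric]
    intro x y
    change ⟪T x, y⟫ = ⟪x, T y⟫
    rw [hT, real_inner_comm, real_inner_comm (T y) x, hT, hΦ, hΦ, hΓ, hΓ,
      inner_linearCombination_comm hsymm]
  have hq : Continuous T.reApplyInnerSelf := T.reApplyInnerSelf_continuous
  obtain ⟨x, hx, hmax⟩ := (isCompact_sphere (0 : EuclideanSpace ℝ s) 1).exists_isMaxOn
    (NormedSpace.sphere_nonempty.2 zero_le_one) hq.continuousOn
  have hx1 : ‖x‖ = 1 := by simpa using hx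
  have hx0 : x ≠ 0 := fun h => by rw [h, norm_zero] at hx1; exact zero_ne_one hx1
  have hev := hTs.hasEigenvector_of_isMaxOn hx0 (by rwa [hx1])
  obtain ⟨E, hE⟩ : ∃ E : ℝ, T x = E • x := ⟨_, hev.apply_eq_smul⟩
  have hEq : ⟪T x, x⟫ = E := by
    rw [hE, inner_smul_left, real_inner_self_eq_norm_sq, hx1]
    simp
  have hΦ1 : ‖Φ x‖ = 1 := by
    exact (pow_eq_one_iff_of_nonneg (norm_nonneg _) two_ne_zero).1 (by rw [hn, hx1, one_pow])
  refine ⟨ofCoeff s x, E, hΦ x ▸ hΦ1, fun k hk => ?_, ?_, fun d hd => ?_⟩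
  · have h1 := hT x (EuclideanSpace.single ⟨k, hk⟩ 1)
    have h2 : ∀ v : ι → H, Finsupp.linearCombination ℝ v
        (ofCoeff s (EuclideanSpace.single ⟨k, hk⟩ 1)) = v k := fun v => by
      rw [linearCombination_ofCoeff, Finset.sum_eq_single ⟨k, hk⟩]
      · simp
      · intro l _ hl
        simp [hl]
      · simp
    have h3 : ⟪Φ x, b k⟫ = ⟪x, EuclideanSpace.single ⟨k, hk⟩ 1⟫ := by
      rw [← h2 b, hΦ, linearCombination_ofCoeff, linearCombination_ofCoeff, hsub.inner_sum,
        EuclideanSpace.inner_eq_star_dotProduct]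
      simp [dotProduct]
    rw [hΓ, h2] at h1
    rw [← hΦ, ← h1, h3, hE, inner_smul_left]
    rfl
  · rw [← hΦ, ← hΓ, ← hT, hEq]
  · obtain ⟨y, hy⟩ : ∃ y : EuclideanSpace ℝ s, ofCoeff s y = d := by
      refine ⟨WithLp.toLp 2 fun k : s => d k, ?_⟩
      ext k
      simp only [ofCoeff, LinearMap.sum_apply, LinearMap.comp_apply, Finsupp.lsingle_apply,
        Finsupp.coe_finsetSum, Finset.sum_apply]
      by_cases hk : k ∈ s
      · rw [Finset.sum_eq_single ⟨k, hk⟩]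
        · simp
        · intro l _ hl
          exact Finsupp.single_eq_of_ne (fun h => hl (Subtype.ext h.symm))
        · simp
      · rw [Finset.sum_eq_zero, Finsupp.notMem_support_iff.1 fun h => hk (hd h)]
        intro l _
        exact Finsupp.single_eq_of_ne (fun h => hk (h ▸ l.2))
    rw [← hy, ← hΦ, ← hΓ, ← hT, hn]
    by_cases hy0 : y = 0
    · simp [hy0]
    have hyn : ‖y‖ ≠ 0 := norm_ne_zero_iff.2 hy0
    have h4 : ‖y‖⁻¹ • y ∈ Metric.sphere (0 : EuclideanSpace ℝ s) 1 := by
      rw [mem_sphere_zero_iff_norm, norm_smul, norm_inv, norm_norm, inv_mul_cancel₀ hyn]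
    have h5 : ⟪T (‖y‖⁻¹ • y), ‖y‖⁻¹ • y⟫ ≤ ⟪T x, x⟫ := hmax h4
    rw [hEq, map_smul, inner_smul_left, inner_smul_right, conj_trivial, ← mul_assoc,
      ← pow_two, inv_pow, inv_mul_le_iff₀ (by positivity)] at h5
    linarith

/-- Banach-Alaoglu and the Riesz representation; an ultrafilter takes the place of passing to
subsequences. -/
theorem exists_weak_limit {α : Type*} (F : Ultrafilter α) (x : α → H) (hx : ∀ᶠ s in F, ‖x s‖ ≤ 1) :
    ∃ h : H, ∀ y, Tendsto (fun s => ⟪x s, y⟫) F (𝓝 ⟪h, y⟫) := by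
  let φ : α → WeakDual ℝ H := fun s => StrongDual.toWeakDual (innerSL ℝ (x s))
  have hc := WeakDual.isCompact_closedBall (0 : StrongDual ℝ H) 1
  obtain ⟨ℓ, -, hℓ⟩ := hc.ultrafilter_le_nhds (F.map φ) (by
    rw [le_principal_iff, Ultrafilter.coe_map, mem_map]
    filter_upwards [hx] with s hs
    simp only [Set.mem_preimage, mem_closedBall_zero_iff]
    exact (innerSL_apply_norm ℝ (x s)).le.trans hs)
  refine ⟨(InnerProductSpace.toDual ℝ H).symm (WeakDual.toStrongDual ℓ), fun y => ?_⟩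
  rw [InnerProductSpace.toDual_symm_apply]
  have h1 : Tendsto φ F (𝓝 ℓ) := hℓ
  exact ((WeakDual.eval_continuous y).tendsto ℓ).comp h1

/-- A symmetric operator that is bounded above by `-A - δ` off a vector `u`, and whose upper bound
is at least `-A`, has an eigenvector that is not orthogonal to `u`. -/
theorem exists_weak_eigenvector (hb : Orthonormal ℝ b) (hsymm : ∀ k l, ⟪g k, b l⟫ = ⟪b k, g l⟫)
    {u : H} {A δ C : ℝ} (hδ : 0 < δ) (hC : 0 ≤ C)
    (hupper : ∀ c : ι →₀ ℝ, ⟪Finsupp.linearCombination ℝ b c, Finsupp.linearCombination ℝ g c⟫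
      ≤ -(A + δ) * ‖Finsupp.linearCombination ℝ b c‖ ^ 2
        + C * ⟪Finsupp.linearCombination ℝ b c, u⟫ ^ 2)
    (hlower : ∀ η : ℝ, 0 < η → ∃ c : ι →₀ ℝ, Finsupp.linearCombination ℝ b c ≠ 0 ∧
      (-A - η) * ‖Finsupp.linearCombination ℝ b c‖ ^ 2
        ≤ ⟪Finsupp.linearCombination ℝ b c, Finsupp.linearCombination ℝ g c⟫) :
    ∃ h ∈ (Submodule.span ℝ (Set.range b)).topologicalClosure, ∃ E : ℝ, -A ≤ E ∧ ⟪h, u⟫ ≠ 0 ∧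
      ∀ k, ⟪h, g k⟫ = E * ⟪h, b k⟫ := by
  classical
  obtain ⟨c₁, hc₁, -⟩ := hlower 1 one_pos
  have hne : c₁.support.Nonempty := by
    rw [Finset.nonempty_iff_ne_empty, Ne, Finsupp.support_eq_empty]
    rintro rfl
    exact hc₁ (map_zero _)
  have hmax : ∀ s : Finset ι, ∃ c : ι →₀ ℝ, ∃ E : ℝ, s.Nonempty →
      ‖Finsupp.linearCombination ℝ b c‖ = 1 ∧
      (∀ k ∈ s, ⟪Finsupp.linearCombination ℝ b c, g k⟫
        = E * ⟪Finsupp.linearCombination ℝ b c, b k⟫) ∧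
      ⟪Finsupp.linearCombination ℝ b c, Finsupp.linearCombination ℝ g c⟫ = E ∧
      ∀ d : ι →₀ ℝ, d.support ⊆ s →
        ⟪Finsupp.linearCombination ℝ b d, Finsupp.linearCombination ℝ g d⟫
          ≤ E * ‖Finsupp.linearCombination ℝ b d‖ ^ 2 := fun s => by
    by_cases hs : s.Nonempty
    · obtain ⟨c, E, h⟩ := exists_maximizer hb hsymm s hs
      exact ⟨c, E, fun _ => h⟩
    · exact ⟨0, 0, fun h => absurd h hs⟩
  choose c E hcE using hmax
  set x : Finset ι → H := fun s => Finsupp.linearCombination ℝ b (c s) with hx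
  -- Refining the directed set of finite index sets lets both the maximizers and their Rayleigh
  -- values converge.
  let F : Ultrafilter (Finset ι) := Ultrafilter.of atTop
  have hF : (F : Filter (Finset ι)) ≤ atTop := Ultrafilter.of_le atTop
  have hge : ∀ s₀ : Finset ι, ∀ᶠ s in F, s₀ ≤ s := fun s₀ => hF (eventually_ge_atTop s₀)
  have hnon : ∀ᶠ s : Finset ι in F, s.Nonempty := by
    filter_upwards [hge c₁.support] with s hs
    exact hne.mono hs
  have hlow : ∀ η : ℝ, 0 < η → ∀ᶠ s in F, -A - η ≤ E s := fun η hη => by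
    obtain ⟨d, hd0, hd⟩ := hlower η hη
    filter_upwards [hge d.support, hnon] with s hs hsn
    have h1 := hd.trans ((hcE s hsn).2.2.2 d hs)
    exact le_of_mul_le_mul_right h1 (by positivity)
  have hup : ∀ s : Finset ι, s.Nonempty → E s ≤ -(A + δ) + C * ⟪x s, u⟫ ^ 2 := fun s hs => by
    have h1 := hupper (c s)
    rw [(hcE s hs).2.2.1, (hcE s hs).1, one_pow, mul_one] at h1
    exact h1
  obtain ⟨h, hh⟩ := exists_weak_limit F x (by
    filter_upwards [hnon] with s hs
    exact (hcE s hs).1.le)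
  have hbd : ∀ᶠ s in F, E s ∈ Set.Icc (-A - 1) (-(A + δ) + C * ‖u‖ ^ 2) := by
    filter_upwards [hlow 1 one_pos, hnon] with s h1 hs
    refine ⟨h1, (hup s hs).trans ?_⟩
    have h2 : ⟪x s, u⟫ ^ 2 ≤ ‖u‖ ^ 2 := by
      have h3 := abs_real_inner_le_norm (x s) u
      rw [(hcE s hs).1, one_mul] at h3
      exact sq_le_sq.2 (by rwa [abs_of_nonneg (norm_nonneg u)])
    have := mul_le_mul_of_nonneg_left h2 hC
    linarith
  obtain ⟨e, -, he⟩ := isCompact_Icc.ultrafilter_le_nhds (F.map E) (by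
    rwa [le_principal_iff, Ultrafilter.coe_map, mem_map])
  have he' : Tendsto E F (𝓝 e) := he
  have hAe : -A ≤ e := by
    refine le_of_forall_pos_sub_le fun η hη => ge_of_tendsto he' (hlow η hη)
  refine ⟨h, ?_, e, hAe, fun h0 => ?_, fun k => ?_⟩
  · rw [← Submodule.orthogonal_orthogonal_eq_closure, Submodule.mem_orthogonal']
    intro y hy
    refine tendsto_nhds_unique (hh y) ?_
    have h1 : ∀ s, ⟪x s, y⟫ = 0 := fun s => (Submodule.mem_orthogonal _ _).1 hy _ (by
      rw [← Finsupp.range_linearCombination]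
      exact ⟨c s, rfl⟩)
    simp only [h1]
    exact tendsto_const_nhds
  -- The rank-one term is weakly continuous, so the upper bound survives the limit. With ⟨h, u⟩ = 0
  -- it would contradict e ≥ -A; in particular the weak limit is not zero.
  · have h1 : e ≤ -(A + δ) + C * ⟪h, u⟫ ^ 2 :=
      le_of_tendsto_of_tendsto he' ((((hh u).pow 2).const_mul C).const_add (-(A + δ)))
        (hnon.mono hup)
    rw [h0] at h1
    linarith
  -- For fixed `k` the tested equation holds for every finite set containing `k`, and both of its
  -- sides converge.
  · refine tendsto_nhds_unique (hh (g k)) ((he'.mul (hh (b k))).congr' ?_)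
    filter_upwards [hge {k}, hnon] with s hs hsn
    exact ((hcE s hsn).2.1 k (hs (Finset.mem_singleton_self k))).symm

end WeakLimit

/-! ### The sector of quartic states -/

variable {lam μ ρ : ℝ} {N : ℕ}

theorem genSeq_add (h j : ∀ N, X (Fin N)) (N : ℕ) :
    genSeq lam μ ρ (h + j) N = genSeq lam μ ρ h N + genSeq lam μ ρ j N := by
  have h1 : createSeq (h + j) N = createSeq h N + createSeq j N := by
    cases N with
    | zero => exact (add_zero _).symm
    | succ n => exact map_add _ _ _
  simp only [genSeq, h1, Pi.add_apply, map_add]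
  module

theorem genSeq_smul (c : ℝ) (h : ∀ N, X (Fin N)) (N : ℕ) :
    genSeq lam μ ρ (c • h) N = c • genSeq lam μ ρ h N := by
  have h1 : createSeq (c • h) N = c • createSeq h N := by
    cases N with
    | zero => exact (smul_zero _).symm
    | succ n => exact (createOp n).map_smul _ _
  simp only [genSeq, h1, Pi.smul_apply, map_smul]
  module

/-- The states spanned by `∑ i, H₄(v_i)` and `∑ i < j, H₂(v_i) H₂(v_j)`. -/
def quarticBlock (N : ℕ) : Submodule ℝ (X (Fin N)) :=
  Submodule.span ℝ {quarticState N, pairState N}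

theorem quarticState_mem : quarticState N ∈ quarticBlock N :=
  Submodule.subset_span (Set.mem_insert _ _)

theorem pairState_mem : pairState N ∈ quarticBlock N :=
  Submodule.subset_span (Set.mem_insert_of_mem _ rfl)

theorem quarticState_zero : quarticState 0 = 0 := by
  have h := norm_quarticState_sq (N := 0)
  simpa using h

theorem pairState_zero : pairState 0 = 0 := by
  have h := norm_pairState_sq (N := 0)
  simpa using h

theorem createSeq_mem_quarticBlock {h : ∀ N, X (Fin N)} (hh : ∀ N, h N ∈ quarticBlock N) (N : ℕ) :
    createSeq h N ∈ quarticBlock N := by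
  cases N with
  | zero => exact Submodule.zero_mem _
  | succ n =>
    obtain ⟨a, b, hab⟩ := Submodule.mem_span_pair.1 (hh n)
    change createOp n (h n) ∈ _
    rw [← hab, map_add, map_smul, map_smul, createOp_quarticState, createOp_pairState]
    exact add_mem (Submodule.smul_mem _ _ (Submodule.smul_mem _ _ quarticState_mem))
      (Submodule.smul_mem _ _ (Submodule.smul_mem _ _ pairState_mem))

theorem annihOp_mem_quarticBlock {z : X (Fin (N + 1))} (hz : z ∈ quarticBlock (N + 1)) :
    annihOp N z ∈ quarticBlock N := by
  obtain ⟨a, b, rfl⟩ := Submodule.mem_span_pair.1 hz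
  rw [map_add, map_smul, map_smul, annihOp_quarticState, annihOp_pairState]
  exact add_mem (Submodule.smul_mem _ _ quarticState_mem) (Submodule.smul_mem _ _ pairState_mem)

theorem kacOp_mem_quarticBlock {z : X (Fin N)} (hz : z ∈ quarticBlock N) :
    kacOp N z ∈ quarticBlock N := by
  have h1 : kacOp N (quarticState N) ∈ quarticBlock N := by
    rw [kacOp_quarticState]
    exact add_mem (Submodule.smul_mem _ _ quarticState_mem) pairState_mem
  obtain ⟨a, b, rfl⟩ := Submodule.mem_span_pair.1 hz
  rw [map_add, map_smul, map_smul, kacOp_pairState]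
  exact add_mem (Submodule.smul_mem _ _ h1) (Submodule.smul_mem _ _ (Submodule.smul_mem _ _ h1))

theorem genSeq_mem_quarticBlock {h : ∀ N, X (Fin N)} (hh : ∀ N, h N ∈ quarticBlock N) (N : ℕ) :
    genSeq lam μ ρ h N ∈ quarticBlock N :=
  add_mem (add_mem
    (Submodule.smul_mem _ _ (sub_mem (createSeq_mem_quarticBlock hh N)
      (Submodule.smul_mem _ _ (hh N))))
    (Submodule.smul_mem _ _ (sub_mem (annihOp_mem_quarticBlock (hh (N + 1))) (hh N))))
    (Submodule.smul_mem _ _ (kacOp_mem_quarticBlock (hh N)))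

theorem coeFn_of_mem_quarticBlock {z : X (Fin N)} (hz : z ∈ quarticBlock N) :
    ∃ a b : ℝ, z =ᵐ[gauss (Fin N)] fun v => a * quarticFun ⟨N, v⟩ + b * pairFun ⟨N, v⟩ := by
  obtain ⟨a, b, rfl⟩ := Submodule.mem_span_pair.1 hz
  refine ⟨a, b, ?_⟩
  filter_upwards [Lp.coeFn_add (a • quarticState N) (b • pairState N),
    Lp.coeFn_smul a (quarticState N), Lp.coeFn_smul b (pairState N), coeFn_quarticState (N := N),
    coeFn_pairState (N := N)] with v h1 h2 h3 h4 h5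
  rw [h1, Pi.add_apply, h2, h3, Pi.smul_apply, Pi.smul_apply, h4, h5, smul_eq_mul, smul_eq_mul]

theorem isSymmetric_of_mem_quarticBlock (hμ : 0 < μ) (hρ : 0 < ρ) {x : L2 μ ρ}
    (hx : ∀ N, comp hμ hρ x N ∈ quarticBlock N) : IsSymmetric x := by
  intro N σ
  obtain ⟨a, b, hab⟩ := coeFn_of_mem_quarticBlock (hx N)
  have h1 := (coeFn_comp hμ hρ x N).symm.trans hab
  rw [ae_volume_iff]
  filter_upwards [h1, (measurePreserving_comp σ.injective).quasiMeasurePreserving.ae h1]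
    with v h2 h3
  rw [h2, h3]
  simp only [quarticFun, pairFun]
  rw [Equiv.sum_comp σ fun i =>
      ((2 * Real.pi * v i ^ 2) ^ 2 - 6 * (2 * Real.pi * v i ^ 2) + 3),
    Equiv.sum_comp σ fun i => quad (v i), Equiv.sum_comp σ fun i => quad (v i) ^ 2]

theorem sumSingle_const (c : X (Fin 0)) : sumSingle N (const 1 c) = (N : ℝ) • const N c := by
  simp only [sumSingle_apply, single_const, Finset.sum_const, Finset.card_univ, Fintype.card_fin,
    Nat.cast_smul_eq_nsmul]

theorem inner_sumSingle_of_mem_quarticBlock {f : X (Fin 1)} (hf : mean f = 0)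
    (h4 : ⟪f, hermFour⟫ = 0) {z : X (Fin N)} (hz : z ∈ quarticBlock N) :
    ⟪sumSingle N f, z⟫ = 0 := by
  obtain ⟨a, b, rfl⟩ := Submodule.mem_span_pair.1 hz
  rw [inner_add_right, inner_smul_right, inner_smul_right, quarticState,
    inner_sumSingle_sumSingle hf mean_hermFour, h4, pairState, real_inner_comm,
    inner_sumPair_sumSingle (adjoint_single_zero_doubleKacCentred _)
      (adjoint_single_one_doubleKacCentred _)]
  ring

theorem inner_const_of_mem_quarticBlock (c : X (Fin 0)) {z : X (Fin N)}
    (hz : z ∈ quarticBlock N) : ⟪const N c, z⟫ = 0 := by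
  obtain ⟨a, b, rfl⟩ := Submodule.mem_span_pair.1 hz
  have h1 : ⟪const N c, quarticState N⟫ = 0 := by
    rw [inner_const_left, quarticState, sumSingle_apply, map_sum]
    simp only [mean_single, mean_hermFour, Finset.sum_const_zero, inner_zero_right]
  have h2 : ⟪const N c, pairState N⟫ = 0 := by
    rcases N.eq_zero_or_pos with rfl | hN
    · rw [pairState_zero, inner_zero_right]
    -- For N > 0 a constant is, up to the factor N, a sum of constant one-particle functions.
    · have h3 := inner_sumPair_sumSingle (N := N) (adjoint_single_zero_doubleKacCentred hermFour)
        (adjoint_single_one_doubleKacCentred hermFour) (const 1 c)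
      rw [sumSingle_const, inner_smul_right] at h3
      rw [real_inner_comm]
      exact (mul_eq_zero.1 h3).resolve_left (Nat.cast_ne_zero.2 hN.ne')
  rw [inner_add_right, inner_smul_right, inner_smul_right, h1, h2]
  ring

theorem mem_orthogonal_of_mem_quarticBlock (hμ : 0 < μ) (hρ : 0 < ρ) {x : L2 μ ρ}
    (hx : ∀ N, comp hμ hρ x N ∈ quarticBlock N) : x ∈ (E0 μ ρ ⊔ E1 μ ρ)ᗮ := by
  refine mem_orthogonal_iff.2 ⟨?_, ?_, ?_⟩
  · refine (hasSum_inner_comp hμ hρ _ x).unique (hasSum_zero.congr_fun fun N => ?_)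
    rw [comp_e0, inner_const_of_mem_quarticBlock _ (hx N), mul_zero]
  · refine (hasSum_inner_comp hμ hρ _ x).unique (hasSum_zero.congr_fun fun N => ?_)
    rw [comp_e1, inner_smul_left, inner_const_of_mem_quarticBlock _ (hx N), mul_zero, mul_zero]
  · refine (hasSum_inner_comp hμ hρ _ x).unique (hasSum_zero.congr_fun fun N => ?_)
    rw [comp_e2, inner_smul_left, inner_sumSingle_of_mem_quarticBlock mean_hermTwo
      inner_hermTwo_hermFour (hx N), mul_zero, mul_zero]

/-! ### The quartic reference state and the upper bounds -/

theorem exists_quartic (hμ : 0 < μ) (hρ : 0 < ρ) :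
    ∃ u : L2 μ ρ, ∀ N, comp hμ hρ u N = quarticState N := by
  refine exists_comp_eq hμ hρ (((hasSum_weight_mul_id μ ρ).mul_left 24).summable.congr fun N => ?_)
  rw [norm_quarticState_sq]
  ring

/-- The two upper bounds for the quadratic form off `E₀ ⊕ E₁`. -/
theorem form_bounds (hlam : 0 < lam) (hμ : 0 < μ) (hρ : 0 < ρ)
    (hcond : ρ > lam / 4 + 2 * lam * Real.sqrt (ρ / μ)) (ht : μ / ρ > 256)
    {x u : L2 μ ρ} (hu : ∀ N, comp hμ hρ u N = quarticState N) (hs : IsSymmetric x)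
    (hx : x ∈ (E0 μ ρ ⊔ E1 μ ρ)ᗮ) {q : ℝ}
    (hq : HasSum (fun N => weight μ ρ N *
      ⟪comp hμ hρ x N, genSeq lam μ ρ (comp hμ hρ x) N⟫) q) :
    q ≤ (-ρ - lam / 4 + lam * Real.sqrt (ρ / μ)) * ‖x‖ ^ 2 ∧
    q ≤ -(ρ + lam / 4 + lam * Real.sqrt (ρ / μ) / 2) * ‖x‖ ^ 2
      + lam / (256 * (μ / ρ)) * ⟪x, u⟫ ^ 2 := by
  obtain ⟨f, hr⟩ := exists_reduced hμ hρ hs hx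
  refine ⟨hr.form_le hlam hμ hρ hcond hq ht, ?_⟩
  have h1 : ⟪x, u⟫ = μ / ρ * ⟪f, hermFour⟫ :=
    (hasSum_inner_comp hμ hρ x u).unique
      ((hr.hasSum_inner_sumSingle mean_hermFour).congr_fun fun N => by rw [hu N, quarticState])
  have h2 := hr.form_le_add hlam hμ hρ hcond hq ht
  have h3 : 3 / 32 * lam * (μ / ρ * (⟪hermFour, f⟫ ^ 2 / 24))
      = lam / (256 * (μ / ρ)) * ⟪x, u⟫ ^ 2 := by
    rw [h1, real_inner_comm]
    field_simp
    ring
  linarith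

/-! ### Existence of a quartic eigenvector -/

variable {lam μ ρ : ℝ} {N : ℕ}

/-- The state with the single component `z` at level `N`. -/
def level (N : ℕ) (z : X (Fin N)) : ∀ M, X (Fin M) := Function.update 0 N z

theorem level_self (z : X (Fin N)) : level N z N = z := Function.update_self _ _ _

theorem level_of_ne {M : ℕ} (h : M ≠ N) (z : X (Fin N)) : level N z M = 0 :=
  Function.update_of_ne h _ _

theorem genSeq_eq_zero {h : ∀ N, X (Fin N)} {n : ℕ} (hh : ∀ N, n < N → h N = 0) {N : ℕ}
    (hN : n + 1 < N) : genSeq lam μ ρ h N = 0 := by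
  obtain ⟨M, rfl⟩ : ∃ M, N = M + 1 := ⟨N - 1, by omega⟩
  have h1 : createSeq h (M + 1) = createOp M (h M) := rfl
  rw [genSeq, h1, hh M (by omega), hh (M + 1) (by omega), hh (M + 1 + 1) (by omega)]
  simp

theorem summable_of_eventually_zero {h : ∀ N, X (Fin N)} {n : ℕ} (hh : ∀ N, n < N → h N = 0) :
    Summable fun N => weight μ ρ N * ‖h N‖ ^ 2 := by
  refine summable_of_ne_finset_zero (s := Finset.range (n + 1)) fun N hN => ?_
  rw [hh N (by simpa [Nat.lt_succ_iff] using hN)]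
  simp

theorem exists_level (hμ : 0 < μ) (hρ : 0 < ρ) (z : X (Fin N)) :
    ∃ y w : L2 μ ρ, (∀ M, comp hμ hρ y M = level N z M) ∧
      ∀ M, comp hμ hρ w M = genSeq lam μ ρ (level N z) M := by
  have h0 : ∀ M, N < M → level N z M = 0 := fun M hM => level_of_ne hM.ne' z
  obtain ⟨y, hy⟩ := exists_comp_eq hμ hρ (summable_of_eventually_zero h0)
  obtain ⟨w, hw⟩ := exists_comp_eq hμ hρ
    (summable_of_eventually_zero fun M hM => genSeq_eq_zero (lam := lam) h0 hM)
  exact ⟨y, w, hy, hw⟩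

theorem inner_level (hμ : 0 < μ) (hρ : 0 < ρ) {z : X (Fin N)} {y : L2 μ ρ}
    (hy : ∀ M, comp hμ hρ y M = level N z M) (x : L2 μ ρ) :
    ⟪x, y⟫ = weight μ ρ N * ⟪comp hμ hρ x N, z⟫ := by
  refine (hasSum_inner_comp hμ hρ x y).unique ?_
  have h := hasSum_single (f := fun M => weight μ ρ M * ⟪comp hμ hρ x M, comp hμ hρ y M⟫) N
    fun M hM => by simp only [hy, level_of_ne hM, inner_zero_right, mul_zero]
  simpa only [hy, level_self] using h

/-- Testing against the image of a single-level state reads off a component of the formal generator,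
for every x in L². This turns a weak eigenvalue equation into the pointwise one. -/
theorem inner_genSeq_level (hμ : 0 < μ) (hρ : 0 < ρ) {z : X (Fin N)} {w : L2 μ ρ}
    (hw : ∀ M, comp hμ hρ w M = genSeq lam μ ρ (level N z) M) (x : L2 μ ρ) :
    ⟪x, w⟫ = weight μ ρ N * ⟪genSeq lam μ ρ (comp hμ hρ x) N, z⟫ := by
  refine genSeq_symmetric (lam := lam) hμ hρ (hasSum_norm_comp hμ hρ x).summable
    (summable_of_eventually_zero (h := level N z) fun M hM => level_of_ne hM.ne' z)
    ((hasSum_inner_comp hμ hρ x w).congr_fun fun M => by rw [hw]) ?_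
  have h := hasSum_single (f := fun M => weight μ ρ M *
    ⟪level N z M, genSeq lam μ ρ (comp hμ hρ x) M⟫) N
    fun M hM => by simp only [level_of_ne hM, inner_zero_left, mul_zero]
  rw [real_inner_comm]
  simpa only [level_self] using h

/-- The two kinds of quartic states. -/
def quarticVec (k : ℕ × Bool) : X (Fin k.1) :=
  if k.2 then pairState k.1 else quarticState k.1

theorem quarticVec_mem (k : ℕ × Bool) : quarticVec k ∈ quarticBlock k.1 := by
  rw [quarticVec]
  split_ifs
  · exact pairState_mem
  · exact quarticState_mem

theorem level_mem_quarticBlock {z : X (Fin N)} (hz : z ∈ quarticBlock N) (M : ℕ) :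
    level N z M ∈ quarticBlock M := by
  by_cases h : M = N
  · subst h
    rwa [level_self]
  · rw [level_of_ne h]
    exact Submodule.zero_mem _

theorem eq_zero_of_inner_quarticVec {z : X (Fin N)} (hz : z ∈ quarticBlock N)
    (h : ∀ s, ⟪z, quarticVec (N, s)⟫ = 0) : z = 0 := by
  obtain ⟨a, b, hab⟩ := Submodule.mem_span_pair.1 hz
  have h1 : ⟪z, z⟫ = 0 := by
    nth_rewrite 2 [← hab]
    have h2 := h true
    have h3 := h false
    simp only [quarticVec, if_true, Bool.false_eq_true, if_false] at h2 h3
    rw [inner_add_right, inner_smul_right, inner_smul_right, h2, h3]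
    ring
  exact inner_self_eq_zero.1 h1

theorem inner_quarticVec_level {k l : ℕ × Bool} (hkl : k ≠ l) :
    ⟪level k.1 (quarticVec k) l.1, quarticVec l⟫ = 0 := by
  obtain ⟨N, s⟩ := k
  obtain ⟨M, r⟩ := l
  by_cases h : M = N
  · subst h
    rw [level_self]
    have hsr : s ≠ r := fun h => hkl (by rw [h])
    rcases s <;> rcases r
    · exact absurd rfl hsr
    · simp only [quarticVec, if_true, Bool.false_eq_true, if_false]
      rw [real_inner_comm, inner_pairState_quarticState]
    · simp only [quarticVec, if_true, Bool.false_eq_true, if_false]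
      rw [inner_pairState_quarticState]
    · exact absurd rfl hsr
  · rw [level_of_ne h, inner_zero_left]

/-! ### The quartic sector and the graph of the generator. -/

/-- The component at level `N`, as a linear map. -/
def compLin (hμ : 0 < μ) (hρ : 0 < ρ) (N : ℕ) : L2 μ ρ →ₗ[ℝ] X (Fin N) where
  toFun x := comp hμ hρ x N
  map_add' x y := comp_add hμ hρ x y N
  map_smul' c x := comp_smul hμ hρ c x N

theorem compLin_apply (hμ : 0 < μ) (hρ : 0 < ρ) (N : ℕ) (x : L2 μ ρ) :
    compLin hμ hρ N x = comp hμ hρ x N := rfl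

/-- The states all of whose components are quartic. -/
def quarticSector (hμ : 0 < μ) (hρ : 0 < ρ) : Submodule ℝ (L2 μ ρ) :=
  ⨅ N, (quarticBlock N).comap (compLin hμ hρ N)

theorem mem_quarticSector {hμ : 0 < μ} {hρ : 0 < ρ} {x : L2 μ ρ} :
    x ∈ quarticSector hμ hρ ↔ ∀ N, comp hμ hρ x N ∈ quarticBlock N := by
  rw [quarticSector, Submodule.mem_iInf]
  rfl

/-- The pairs of a state with its image under the generator. -/
def graph (lam : ℝ) (hμ : 0 < μ) (hρ : 0 < ρ) : Submodule ℝ (L2 μ ρ × L2 μ ρ) where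
  carrier := {p | ∀ N, comp hμ hρ p.2 N = genSeq lam μ ρ (comp hμ hρ p.1) N}
  zero_mem' N := by
    have h0 : comp hμ hρ (0 : L2 μ ρ) = 0 := funext fun N => map_zero (compLin hμ hρ N)
    have h1 := genSeq_smul (lam := lam) (μ := μ) (ρ := ρ) 0 0 N
    rw [zero_smul, zero_smul] at h1
    simp only [Prod.fst_zero, Prod.snd_zero, h0, h1]
    rfl
  add_mem' := by
    rintro ⟨x, x'⟩ ⟨y, y'⟩ hx hy N
    have h0 : comp hμ hρ (x + y) = comp hμ hρ x + comp hμ hρ y :=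
      funext fun N => comp_add hμ hρ x y N
    simp only [Set.mem_ofPred_eq] at hx hy
    simp only [Prod.mk_add_mk, h0, genSeq_add, comp_add, hx, hy]
  smul_mem' := by
    rintro c ⟨x, x'⟩ hx N
    have h0 : comp hμ hρ (c • x) = c • comp hμ hρ x :=
      funext fun N => comp_smul hμ hρ c x N
    simp only [Set.mem_ofPred_eq] at hx
    simp only [Prod.smul_mk, h0, genSeq_smul, comp_smul, hx]

theorem mem_graph {hμ : 0 < μ} {hρ : 0 < ρ} {p : L2 μ ρ × L2 μ ρ} : p ∈ graph lam hμ hρ ↔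
    ∀ N, comp hμ hρ p.2 N = genSeq lam μ ρ (comp hμ hρ p.1) N := Iff.rfl

theorem hasSum_inner_graph {hμ : 0 < μ} {hρ : 0 < ρ} {p : L2 μ ρ × L2 μ ρ}
    (hp : p ∈ graph lam hμ hρ) (x : L2 μ ρ) :
    HasSum (fun N => weight μ ρ N * ⟪comp hμ hρ x N, genSeq lam μ ρ (comp hμ hρ p.1) N⟫)
      ⟪x, p.2⟫ :=
  (hasSum_inner_comp hμ hρ x p.2).congr_fun fun N => by rw [hp]

theorem graph_symmetric {hμ : 0 < μ} {hρ : 0 < ρ} {p r : L2 μ ρ × L2 μ ρ}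
    (hp : p ∈ graph lam hμ hρ) (hr : r ∈ graph lam hμ hρ) : ⟪p.2, r.1⟫ = ⟪p.1, r.2⟫ := by
  rw [real_inner_comm]
  exact genSeq_symmetric (lam := lam) hμ hρ (hasSum_norm_comp hμ hρ r.1).summable
    (hasSum_norm_comp hμ hρ p.1).summable (hasSum_inner_graph hp r.1) (hasSum_inner_graph hr p.1)

theorem linearCombination_mem_graph {ι : Type*} {hμ : 0 < μ} {hρ : 0 < ρ} {b g : ι → L2 μ ρ}
    (h : ∀ k, (b k, g k) ∈ graph lam hμ hρ) (c : ι →₀ ℝ) :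
    (Finsupp.linearCombination ℝ b c, Finsupp.linearCombination ℝ g c) ∈ graph lam hμ hρ := by
  have h1 : (Finsupp.linearCombination ℝ b c, Finsupp.linearCombination ℝ g c)
      = c.sum fun k a => a • (b k, g k) := by
    simp only [Finsupp.linearCombination_apply, Finsupp.sum, Prod.smul_mk]
    exact Prod.ext (by simp [Prod.fst_sum]) (by simp [Prod.snd_sum])
  rw [h1]
  exact Submodule.sum_mem _ fun k _ => Submodule.smul_mem _ _ (h k)

/-! ### Truncated trial states. -/

variable {lam μ ρ : ℝ} {N : ℕ}

/-- The quartic reference state, cut off above the level `n`. -/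
def truncated (n N : ℕ) : X (Fin N) := if N ≤ n then quarticState N else 0

theorem createSeq_truncated {n : ℕ} (hN : N ≤ n) :
    createSeq (truncated n) N = ((N : ℝ) - 1) • quarticState N := by
  cases N with
  | zero => rw [quarticState_zero, smul_zero]; rfl
  | succ M =>
    change createOp M (truncated n M) = _
    rw [truncated, if_pos (by omega), createOp_quarticState, Nat.cast_succ, add_sub_cancel_right]

theorem annihOp_truncated (n N : ℕ) :
    annihOp N (truncated n (N + 1)) = if N < n then quarticState N else 0 := by
  by_cases h : N < n
  · rw [truncated, if_pos (by omega), if_pos h, annihOp_quarticState]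
  · rw [truncated, if_neg (by omega), if_neg h, map_zero]

/-- The pair state produced by K is orthogonal to the quartic state, so it does not enter. The cut
matters only at N = n, where the gain from annihilation is lost. -/
theorem inner_genSeq_truncated {n : ℕ} (hN : N ≤ n) :
    ⟪truncated n N, genSeq lam μ ρ (truncated n) N⟫
      = 24 * (N * (-ρ - lam * ρ / μ / 4 * ((N : ℝ) - 1)))
        - if N < n then 0 else 24 * (μ * N) := by
  have h1 : truncated n N = quarticState N := if_pos hN
  have h2 : ⟪quarticState N, quarticState N⟫ = 24 * (N : ℝ) := by
    rw [real_inner_self_eq_norm_sq, norm_quarticState_sq]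
  have h3 : ⟪quarticState N, pairState N⟫ = 0 := by
    rw [real_inner_comm, inner_pairState_quarticState]
  rw [genSeq, createSeq_truncated hN, annihOp_truncated, h1, kacOp_quarticState]
  split_ifs
  · simp only [inner_add_right, inner_sub_right, inner_smul_right, h2, h3]
    ring
  · simp only [inner_add_right, inner_sub_right, inner_smul_right, h2, h3, inner_zero_right]
    ring

theorem sum_inner_genSeq_truncated (n : ℕ) :
    ∑ k ∈ Finset.range (n + 1), weight μ ρ k * ⟪truncated n k, genSeq lam μ ρ (truncated n) k⟫
      = ∑ k ∈ Finset.range (n + 1),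
          weight μ ρ k * (24 * (k * (-ρ - lam * ρ / μ / 4 * ((k : ℝ) - 1))))
        - 24 * μ * (weight μ ρ n * n) := by
  have h1 : ∀ k ∈ Finset.range n,
      weight μ ρ k * ⟪truncated n k, genSeq lam μ ρ (truncated n) k⟫
        = weight μ ρ k * (24 * (k * (-ρ - lam * ρ / μ / 4 * ((k : ℝ) - 1)))) := fun k hk => by
    rw [inner_genSeq_truncated (Finset.mem_range.1 hk).le, if_pos (Finset.mem_range.1 hk), sub_zero]
  rw [Finset.sum_range_succ, Finset.sum_congr rfl h1, inner_genSeq_truncated le_rfl,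
    if_neg (lt_irrefl n), Finset.sum_range_succ]
  ring

/-- By E N = t and E N(N-1) = t², the full sums have quotient exactly -ρ - λ/4, and the cost n a_n
of the cut tends to 0. -/
theorem exists_truncated (hμ : 0 < μ) (hρ : 0 < ρ) {η : ℝ} (hη : 0 < η) :
    ∃ n : ℕ, 0 < ∑ k ∈ Finset.range (n + 1), weight μ ρ k * ‖truncated n k‖ ^ 2 ∧
      (-(ρ + lam / 4) - η) * ∑ k ∈ Finset.range (n + 1), weight μ ρ k * ‖truncated n k‖ ^ 2
        ≤ ∑ k ∈ Finset.range (n + 1),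
          weight μ ρ k * ⟪truncated n k, genSeq lam μ ρ (truncated n) k⟫ := by
  have hr : 0 < μ / ρ := by positivity
  have hS : ∀ n, ∑ k ∈ Finset.range (n + 1), weight μ ρ k * ‖truncated n k‖ ^ 2
      = ∑ k ∈ Finset.range (n + 1), weight μ ρ k * (k : ℝ) * 24 := fun n => by
    refine Finset.sum_congr rfl fun k hk => ?_
    rw [truncated, if_pos (Nat.lt_succ_iff.1 (Finset.mem_range.1 hk)), norm_quarticState_sq]
    ring
  have h1 : HasSum (fun k : ℕ => weight μ ρ k * (24 * (k * (-ρ - lam * ρ / μ / 4 * ((k : ℝ) - 1)))))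
      (24 * (μ / ρ) * -(ρ + lam / 4)) := by
    have h := ((hasSum_weight_mul_id μ ρ).mul_right (-(24 * ρ))).add
      ((hasSum_weight_mul_factorial_two μ ρ).mul_right (-(6 * (lam * ρ / μ))))
    have e : μ / ρ * -(24 * ρ) + (μ / ρ) ^ 2 * -(6 * (lam * ρ / μ))
        = 24 * (μ / ρ) * -(ρ + lam / 4) := by
      field_simp
      ring
    rw [e] at h
    exact h.congr_fun fun k => by ring
  have h2 : HasSum (fun k : ℕ => weight μ ρ k * (k : ℝ) * 24) (μ / ρ * 24) :=
    (hasSum_weight_mul_id μ ρ).mul_right 24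
  have t0 := tendsto_add_atTop_nat 1
  have t1 := h1.tendsto_sum_nat.comp t0
  have t2 := h2.tendsto_sum_nat.comp t0
  have t3 := (hasSum_weight_mul_id μ ρ).summable.tendsto_atTop_zero.const_mul (24 * μ)
  have t4 := (t1.sub t3).sub (t2.const_mul (-(ρ + lam / 4) - η))
  have e1 := t2.eventually (lt_mem_nhds (show 0 < μ / ρ * 24 by positivity))
  have e2 := t4.eventually (lt_mem_nhds (show 0 < 24 * (μ / ρ) * -(ρ + lam / 4) - 24 * μ * 0
    - (-(ρ + lam / 4) - η) * (μ / ρ * 24) by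
      have : 0 < η * (μ / ρ) := by positivity
      linarith))
  obtain ⟨n, hn1, hn2⟩ := (e1.and e2).exists
  refine ⟨n, ?_, ?_⟩
  · rw [hS]
    exact hn1
  · rw [hS, sum_inner_genSeq_truncated]
    simp only [Function.comp_apply] at hn2
    linarith

instance : FiniteDimensional ℝ (quarticBlock N) :=
  FiniteDimensional.span_of_finite ℝ (Set.toFinite _)

/-- There is a quartic eigenvector, not orthogonal to the quartic reference state, for an
eigenvalue that is at least `-ρ - lam / 4`. -/
theorem exists_quartic_eigenvector (hlam : 0 < lam) (hμ : 0 < μ) (hρ : 0 < ρ)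
    (hcond : ρ > lam / 4 + 2 * lam * Real.sqrt (ρ / μ)) (ht : μ / ρ > 256)
    {u : L2 μ ρ} (hu : ∀ N, comp hμ hρ u N = quarticState N) :
    ∃ h : L2 μ ρ, (∀ N, comp hμ hρ h N ∈ quarticBlock N) ∧ ∃ E, -ρ - lam / 4 ≤ E ∧ ⟪h, u⟫ ≠ 0 ∧
      h ∈ eigenspace lam μ ρ E := by
  choose y w hy hw using fun k : ℕ × Bool => exists_level (lam := lam) hμ hρ (quarticVec k)
  have hyw : ∀ k, (y k, w k) ∈ graph lam hμ hρ := fun k => by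
    refine mem_graph.2 fun M => ?_
    rw [hw, show comp hμ hρ (y k) = level k.1 (quarticVec k) from funext (hy k)]
  have hsec : ∀ k, y k ∈ quarticSector hμ hρ := fun k => mem_quarticSector.2 fun M => by
    rw [hy]
    exact level_mem_quarticBlock (quarticVec_mem k) M
  have horth : ∀ k l, k ≠ l → ⟪y k, y l⟫ = 0 := fun k l hkl => by
    rw [inner_level hμ hρ (hy l), hy, inner_quarticVec_level hkl, mul_zero]
  -- Some basis states vanish, as there are no particles or no pairs at the lowest levels; they are
  -- discarded before normalizing.
  let b : {k // y k ≠ 0} → L2 μ ρ := fun k => ‖y k‖⁻¹ • y k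
  let g : {k // y k ≠ 0} → L2 μ ρ := fun k => ‖y k‖⁻¹ • w k
  have hbg : ∀ k, (b k, g k) ∈ graph lam hμ hρ := fun k => Submodule.smul_mem _ _ (hyw k)
  have hb : Orthonormal ℝ b := by
    refine ⟨fun k => ?_, fun k l hkl => ?_⟩
    · rw [norm_smul, norm_inv, norm_norm, inv_mul_cancel₀ (norm_ne_zero_iff.2 k.2)]
    · change ⟪b k, b l⟫ = 0
      rw [inner_smul_left, inner_smul_right, horth _ _ fun h => hkl (Subtype.ext h), mul_zero,
        mul_zero]
  have hspan : ∀ k, y k ∈ Submodule.span ℝ (Set.range b) := fun k => by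
    by_cases hk : y k = 0
    · rw [hk]
      exact Submodule.zero_mem _
    · have h1 : ‖y k‖ • b ⟨k, hk⟩ = y k := smul_inv_smul₀ (norm_ne_zero_iff.2 hk) _
      rw [← h1]
      exact Submodule.smul_mem _ _ (Submodule.subset_span ⟨_, rfl⟩)
  have hcomb := fun c => linearCombination_mem_graph hbg c
  have hcsec : ∀ c, ∀ N, comp hμ hρ (Finsupp.linearCombination ℝ b c) N ∈ quarticBlock N :=
    fun c => mem_quarticSector.1 (by
      rw [Finsupp.linearCombination_apply]
      exact Submodule.sum_mem _ fun k _ =>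
        Submodule.smul_mem _ _ (Submodule.smul_mem _ _ (hsec k)))
  obtain ⟨h, hh, E, hE, hne, hev⟩ := exists_weak_eigenvector (u := u) (A := ρ + lam / 4)
    (δ := lam * Real.sqrt (ρ / μ) / 2) (C := lam / (256 * (μ / ρ))) hb
    (fun k l => graph_symmetric (hbg k) (hbg l))
    (by have := sqrt_ratio_pos hμ hρ; positivity) (by positivity)
    (fun c => (form_bounds hlam hμ hρ hcond ht hu
      (isSymmetric_of_mem_quarticBlock hμ hρ (hcsec c))
      (mem_orthogonal_of_mem_quarticBlock hμ hρ (hcsec c)) (hasSum_inner_graph (hcomb c) _)).2)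
    (fun η hη => by
      obtain ⟨n, hn1, hn2⟩ := exists_truncated (lam := lam) hμ hρ hη
      have h1 : ∑ k ∈ Finset.range (n + 1), y (k, false) ∈ Submodule.span ℝ (Set.range b) :=
        Submodule.sum_mem _ fun k _ => hspan _
      rw [← Finsupp.range_linearCombination] at h1
      obtain ⟨c, hc⟩ := h1
      have h2 : comp hμ hρ (Finsupp.linearCombination ℝ b c) = truncated n := by
        funext N
        rw [hc, ← compLin_apply, map_sum]
        simp only [compLin_apply, hy]
        by_cases hN : N ≤ n
        · rw [Finset.sum_eq_single N (fun k _ hk => level_of_ne hk.symm _)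
            (fun hk => absurd (Finset.mem_range.2 (Nat.lt_succ_of_le hN)) hk), level_self,
            truncated, if_pos hN]
          rfl
        · rw [truncated, if_neg hN]
          refine Finset.sum_eq_zero fun k hk => level_of_ne (fun h => hN ?_) _
          rw [h]
          exact Nat.lt_succ_iff.1 (Finset.mem_range.1 hk)
      have h3 : ∀ k, k ∉ Finset.range (n + 1) → truncated n k = 0 := fun k hk =>
        if_neg fun h => hk (Finset.mem_range.2 (Nat.lt_succ_of_le h))
      have h4 := hasSum_norm_comp hμ hρ (Finsupp.linearCombination ℝ b c)
      have h5 := hasSum_inner_graph (hcomb c) (Finsupp.linearCombination ℝ b c)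
      simp only [h2] at h4 h5
      have h6 := h4.unique (hasSum_sum_of_ne_finset_zero fun k hk => by
        rw [h3 k hk, norm_zero]; simp)
      have h7 := h5.unique (hasSum_sum_of_ne_finset_zero fun k hk => by
        rw [h3 k hk, inner_zero_left, mul_zero])
      refine ⟨c, fun h0 => ?_, ?_⟩
      · rw [h0, norm_zero] at h6
        rw [← h6] at hn1
        norm_num at hn1
      · rw [h6, h7]
        exact hn2)
  -- The limit lies in the closed span of the basis. A vector orthogonal to the finite-dimensional
  -- block, placed at level N, is orthogonal to that closure.
  have hmem : ∀ N, comp hμ hρ h N ∈ quarticBlock N := fun N => by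
    rw [← Submodule.orthogonal_orthogonal (quarticBlock N), Submodule.mem_orthogonal']
    intro z hz
    obtain ⟨y', -, hy', -⟩ := exists_level (lam := lam) hμ hρ z
    have h1 : y' ∈ (Submodule.span ℝ (Set.range b))ᗮ := by
      rw [Submodule.mem_orthogonal]
      intro x hx
      rw [← Finsupp.range_linearCombination] at hx
      obtain ⟨c, rfl⟩ := hx
      rw [inner_level hμ hρ hy', (Submodule.mem_orthogonal _ _).1 hz _ (hcsec c N), mul_zero]
    rw [← Submodule.orthogonal_closure] at h1
    have h2 := (Submodule.mem_orthogonal _ _).1 h1 _ hh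
    rw [inner_level hμ hρ hy'] at h2
    exact (mul_eq_zero.1 h2).resolve_left (weight_pos hμ hρ N).ne'
  refine ⟨h, hmem, E, by linarith, hne, mem_eigenspace_of_genSeq_eq hμ hρ
    (isSymmetric_of_mem_quarticBlock hμ hρ hmem) fun N => ?_⟩
  rw [← sub_eq_zero]
  -- Invariance puts the defect of the eigenvalue equation back into the block, so it need only be
  -- tested against the two quartic states.
  refine eq_zero_of_inner_quarticVec (sub_mem (genSeq_mem_quarticBlock hmem N)
    (Submodule.smul_mem _ _ (hmem N))) fun s => ?_
  have h1 : ⟪h, w (N, s)⟫ = E * ⟪h, y (N, s)⟫ := by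
    by_cases hk : y (N, s) = 0
    · have h2 := inner_genSeq_level hμ hρ (hw (N, s)) h
      have h3 := inner_level hμ hρ (hy (N, s)) (y (N, s))
      rw [hk, inner_zero_right, ← hk, hy, level_self, zero_eq_mul, inner_self_eq_zero] at h3
      rw [h2, h3.resolve_left (weight_pos hμ hρ N).ne', hk, inner_zero_right, inner_zero_right,
        mul_zero, mul_zero]
    · have h2 := hev ⟨(N, s), hk⟩
      simp only [b, g, inner_smul_right] at h2
      have h3 : ‖y (N, s)‖⁻¹ ≠ 0 := inv_ne_zero (norm_ne_zero_iff.2 hk)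
      exact mul_left_cancel₀ h3 (by rw [h2]; ring)
  rw [inner_genSeq_level hμ hρ (hw (N, s)), inner_level hμ hρ (hy (N, s))] at h1
  rw [inner_sub_left, inner_smul_left, conj_trivial, sub_eq_zero]
  refine mul_left_cancel₀ (weight_pos hμ hρ N).ne' ?_
  rw [h1]
  ring

/-! ### Quartic states are even quartic polynomials -/

variable {lam μ ρ : ℝ} {N : ℕ}

/-- `2π v_i² - 1` as a polynomial. -/
def quadPoly (i : Fin N) : MvPolynomial (Fin N) ℝ :=
  MvPolynomial.C (2 * Real.pi) * MvPolynomial.X i ^ 2 - 1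

/-- The polynomial of a quartic state. -/
def quarticPoly (N : ℕ) (a b : ℝ) : MvPolynomial (Fin N) ℝ :=
  MvPolynomial.C a * ∑ i, (quadPoly i ^ 2 - MvPolynomial.C 4 * quadPoly i - MvPolynomial.C 2)
    + MvPolynomial.C (b * (3 / 4)) * ((∑ i, quadPoly i) ^ 2 - ∑ i, quadPoly i ^ 2)

theorem eval_quadPoly (v : Fin N → ℝ) (i : Fin N) :
    MvPolynomial.eval v (quadPoly i) = quad (v i) := by
  simp [quadPoly, quad]

theorem eval_quarticPoly (a b : ℝ) (v : Fin N → ℝ) :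
    MvPolynomial.eval v (quarticPoly N a b)
      = a * ∑ i, (quad (v i) ^ 2 - 4 * quad (v i) - 2)
        + b * (3 / 4) * ((∑ i, quad (v i)) ^ 2 - ∑ i, quad (v i) ^ 2) := by
  simp [quarticPoly, eval_quadPoly]

theorem eval_quarticPoly_eq (a b : ℝ) (v : Fin N → ℝ) :
    MvPolynomial.eval v (quarticPoly N a b) = a * quarticFun ⟨N, v⟩ + b * pairFun ⟨N, v⟩ := by
  rw [eval_quarticPoly, quarticFun, pairFun, ← mul_assoc]
  congr 2
  refine Finset.sum_congr rfl fun i _ => ?_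
  rw [quad]
  ring

theorem totalDegree_quadPoly_le (i : Fin N) : (quadPoly i).totalDegree ≤ 2 := by
  refine (MvPolynomial.totalDegree_sub _ _).trans (max_le ?_ ?_)
  · refine (MvPolynomial.totalDegree_mul _ _).trans ?_
    rw [MvPolynomial.totalDegree_C, MvPolynomial.totalDegree_X_pow]
  · rw [MvPolynomial.totalDegree_one]
    exact Nat.zero_le 2

theorem totalDegree_quarticPoly_le (a b : ℝ) : (quarticPoly N a b).totalDegree ≤ 4 := by
  have hC : ∀ (c : ℝ) (p : MvPolynomial (Fin N) ℝ), p.totalDegree ≤ 4 →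
      (MvPolynomial.C c * p).totalDegree ≤ 4 := fun c p hp => by
    refine (MvPolynomial.totalDegree_mul _ _).trans ?_
    rw [MvPolynomial.totalDegree_C]
    omega
  have hsq : ∀ p : MvPolynomial (Fin N) ℝ, p.totalDegree ≤ 2 → (p ^ 2).totalDegree ≤ 4 :=
    fun p hp => (MvPolynomial.totalDegree_pow _ _).trans (by omega)
  have hs : ∀ F : Fin N → MvPolynomial (Fin N) ℝ, ∀ d, (∀ i, (F i).totalDegree ≤ d) →
      (∑ i, F i).totalDegree ≤ d := fun F d hF =>
    (MvPolynomial.totalDegree_finsetSum _ _).trans (Finset.sup_le fun i _ => hF i)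
  refine (MvPolynomial.totalDegree_add _ _).trans (max_le (hC _ _ (hs _ _ fun i => ?_)) (hC _ _ ?_))
  · refine (MvPolynomial.totalDegree_sub _ _).trans (max_le
      ((MvPolynomial.totalDegree_sub _ _).trans (max_le (hsq _ (totalDegree_quadPoly_le i))
        (hC _ _ ((totalDegree_quadPoly_le i).trans (by norm_num))))) ?_)
    rw [MvPolynomial.totalDegree_C]
    exact Nat.zero_le 4
  · exact (MvPolynomial.totalDegree_sub _ _).trans (max_le
      (hsq _ (hs _ _ totalDegree_quadPoly_le)) (hs _ _ fun i => hsq _ (totalDegree_quadPoly_le i)))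

theorem sum_indicator (s : Finset (Fin N)) (F : ℝ → ℝ) (t : ℝ) :
    ∑ i, F (if i ∈ s then t else 0) = s.card * F t + ((N : ℝ) - s.card) * F 0 := by
  have h : ∀ i, F (if i ∈ s then t else 0) = F 0 + if i ∈ s then F t - F 0 else 0 := fun i => by
    split_ifs <;> ring
  simp only [h, Finset.sum_add_distrib, Finset.sum_const, Finset.card_univ, Fintype.card_fin,
    Finset.sum_ite_mem, Finset.univ_inter, nsmul_eq_mul]
  ring

/-- Restrict the polynomial to the line spanned by the indicator of s: the result is a polynomial in
one variable of degree below 4, whose t⁴ coefficient is 4π² times the left side. -/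
theorem coeff_eq_zero_of_totalDegree_lt {a b : ℝ} (h : (quarticPoly N a b).totalDegree < 4)
    (s : Finset (Fin N)) :
    a * s.card + b * (3 / 4) * ((s.card : ℝ) ^ 2 - s.card) = 0 := by
  have h1 : (MvPolynomial.aeval (fun i : Fin N => if i ∈ s then (Polynomial.X : Polynomial ℝ) else 0)
      (quarticPoly N a b)).natDegree < 4 := by
    refine lt_of_le_of_lt (MvPolynomial.aeval_natDegree_le (n := 1) _ le_rfl _ fun i => ?_)
      (by rwa [mul_one])
    split_ifs
    · exact Polynomial.natDegree_X_le
    · simp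
  obtain ⟨c, d, hcd⟩ : ∃ c d : ℝ, ∀ t : ℝ,
      MvPolynomial.eval (fun i : Fin N => if i ∈ s then t else 0) (quarticPoly N a b)
        = 4 * Real.pi ^ 2 * (a * s.card + b * (3 / 4) * ((s.card : ℝ) ^ 2 - s.card)) * t ^ 4
          + c * t ^ 2 + d := by
    refine ⟨a * s.card * (-12 * Real.pi)
        + b * (3 / 4) * (4 * Real.pi * (s.card - s.card * N)),
      a * N * 3 + b * (3 / 4) * (N ^ 2 - N), fun t => ?_⟩
    rw [eval_quarticPoly, sum_indicator s fun x => quad x ^ 2 - 4 * quad x - 2,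
      sum_indicator s quad, sum_indicator s fun x => quad x ^ 2]
    simp only [quad]
    ring
  have h2 : MvPolynomial.aeval
      (fun i : Fin N => if i ∈ s then (Polynomial.X : Polynomial ℝ) else 0) (quarticPoly N a b)
      = Polynomial.C (4 * Real.pi ^ 2 * (a * s.card + b * (3 / 4) * ((s.card : ℝ) ^ 2 - s.card)))
          * Polynomial.X ^ 4 + Polynomial.C c * Polynomial.X ^ 2 + Polynomial.C d := by
    refine Polynomial.funext fun t => ?_
    have h3 := hcd t
    rw [← Polynomial.coe_evalRingHom, MvPolynomial.aeval_def, MvPolynomial.hom_eval₂]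
    have h4 : ((Polynomial.evalRingHom t).comp (algebraMap ℝ (Polynomial ℝ))) = RingHom.id ℝ := by
      ext x
      simp
    have h5 : (fun i : Fin N => Polynomial.evalRingHom t
        (if i ∈ s then (Polynomial.X : Polynomial ℝ) else 0)) = fun i => if i ∈ s then t else 0 := by
      funext i
      split_ifs <;> simp
    rw [h4, h5]
    refine h3.trans ?_
    simp
  have h6 := Polynomial.coeff_eq_zero_of_natDegree_lt h1
  rw [h2] at h6
  simp only [Polynomial.coeff_add, Polynomial.coeff_C_mul_X_pow, Polynomial.coeff_C,
    OfNat.ofNat_ne_zero, if_true, if_false, Nat.reduceEqDiff, add_zero] at h6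
  exact (mul_eq_zero.1 h6).resolve_left (by positivity)

/-- Sets of one and of two particles force a = 0 and then b = 0. With a single particle b is
undetermined, but the pair polynomial vanishes. -/
theorem quarticPoly_eq_zero {a b : ℝ} (h : (quarticPoly N a b).totalDegree < 4) :
    quarticPoly N a b = 0 := by
  have h1 : ∀ n : ℕ, n ≤ N → a * n + b * (3 / 4) * ((n : ℝ) ^ 2 - n) = 0 := fun n hn => by
    obtain ⟨s, -, hs⟩ := Finset.exists_subset_card_eq
      (s := (Finset.univ : Finset (Fin N))) (n := n) (by simpa using hn)
    rw [← hs]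
    exact coeff_eq_zero_of_totalDegree_lt h s
  rcases N.eq_zero_or_pos with rfl | hN
  · simp [quarticPoly]
  have ha : a = 0 := by
    have h2 := h1 1 hN
    norm_num at h2
    exact h2
  rcases (show 1 ≤ N from hN).lt_or_eq with hN2 | rfl
  · have hb : b = 0 := by
      have h2 := h1 2 hN2
      rw [ha] at h2
      norm_num at h2
      exact h2
    simp [quarticPoly, ha, hb]
  · simp [quarticPoly, ha]

theorem isEvenQuartic_of_mem_quarticBlock (hμ : 0 < μ) (hρ : 0 < ρ) {x : L2 μ ρ}
    (hx : comp hμ hρ x N ∈ quarticBlock N) : IsEvenQuartic fun v : Fin N → ℝ => x ⟨N, v⟩ := by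
  obtain ⟨a, b, hab⟩ := coeFn_of_mem_quarticBlock hx
  refine ⟨quarticPoly N a b, ?_, fun v i => ?_, ?_⟩
  · rcases (totalDegree_quarticPoly_le (N := N) a b).lt_or_eq with h | h
    · exact Or.inl (quarticPoly_eq_zero h)
    · exact Or.inr h
  · have h1 : ∀ j, quad (Function.update v i (-v i) j) = quad (v j) := fun j => by
      by_cases hj : j = i
      · subst hj
        rw [Function.update_self, quad, quad, neg_sq]
      · rw [Function.update_of_ne hj]
    simp only [eval_quarticPoly, h1]
  · rw [ae_volume_iff]
    filter_upwards [coeFn_comp hμ hρ x N, hab] with v h1 h2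
    rw [← h1, h2, eval_quarticPoly_eq]

/-! ### The second gap -/

variable {lam μ ρ : ℝ}

theorem isSymmetric_iff (hμ : 0 < μ) (hρ : 0 < ρ) {x : L2 μ ρ} : IsSymmetric x ↔
    ∀ N (σ : Equiv.Perm (Fin N)), lift σ.injective (comp hμ hρ x N) = comp hμ hρ x N := by
  refine ⟨fun h N σ => lift_perm_eq hμ hρ h σ, fun h N σ => ae_volume_iff.2 ?_⟩
  have h1 := coeFn_lift σ.injective (comp hμ hρ x N)
  rw [h N σ] at h1
  filter_upwards [h1, coeFn_comp hμ hρ x N,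
    (measurePreserving_comp σ.injective).quasiMeasurePreserving.ae (coeFn_comp hμ hρ x N)]
    with v h2 h3 h4
  rw [← h3, h2, h4]

/-- The symmetric states. -/
def symmetricStates (hμ : 0 < μ) (hρ : 0 < ρ) : Submodule ℝ (L2 μ ρ) :=
  ⨅ N, ⨅ σ : Equiv.Perm (Fin N),
    (LinearMap.eqLocus ((lift σ.injective).toLinearMap) LinearMap.id).comap (compLin hμ hρ N)

theorem mem_symmetricStates {hμ : 0 < μ} {hρ : 0 < ρ} {x : L2 μ ρ} :
    x ∈ symmetricStates hμ hρ ↔ IsSymmetric x := by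
  rw [isSymmetric_iff hμ hρ, symmetricStates]
  simp only [Submodule.mem_iInf]
  rfl

theorem mem_domain_iff (hμ : 0 < μ) (hρ : 0 < ρ) {x : L2 μ ρ} : x ∈ domain lam μ ρ ↔
    IsSymmetric x ∧ ∃ y, (x, y) ∈ graph lam hμ hρ := by
  refine ⟨fun h => ⟨h.1, _, (hasSum_norm_genSeq hμ hρ h.2).1⟩, ?_⟩
  rintro ⟨hs, y, hy⟩
  refine ⟨hs, memLp_of_components hμ hρ (g := fun N => comp hμ hρ y N)
    (hasSum_norm_comp hμ hρ y).summable fun N => ?_⟩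
  rw [mem_graph.1 hy N]
  exact coeFn_genSeq_comp hμ hρ x N

theorem form_eq_inner (hμ : 0 < μ) (hρ : 0 < ρ) {x y : L2 μ ρ} (hs : IsSymmetric x)
    (h : (x, y) ∈ graph lam hμ hρ) : form lam μ ρ x = ⟪x, y⟫ :=
  (hasSum_form hμ hρ ((mem_domain_iff hμ hρ).2 ⟨hs, y, h⟩)).unique (hasSum_inner_graph h x)

theorem mem_eigenspace_iff (hμ : 0 < μ) (hρ : 0 < ρ) {x : L2 μ ρ} {c : ℝ} :
    x ∈ eigenspace lam μ ρ c ↔ IsSymmetric x ∧ (x, c • x) ∈ graph lam hμ hρ := by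
  refine ⟨fun h => ⟨h.1.1, fun N => ?_⟩, fun h => mem_eigenspace_of_genSeq_eq hμ hρ h.1 fun N => ?_⟩
  · exact (comp_smul hμ hρ c x N).trans (genSeq_eq_of_mem_eigenspace hμ hρ h N).symm
  · exact (mem_graph.1 h.2 N).symm.trans (comp_smul hμ hρ c x N)

theorem e0_mem_graph (hμ : 0 < μ) (hρ : 0 < ρ) :
    (e0 μ ρ, (0 : ℝ) • e0 μ ρ) ∈ graph lam hμ hρ := by
  refine mem_graph.2 fun N => ?_
  have h1 : createSeq (comp hμ hρ (e0 μ ρ)) N = (N : ℝ) • const N one := by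
    cases N with
    | zero => rw [Nat.cast_zero, zero_smul]; rfl
    | succ n =>
      change createOp n (comp hμ hρ (e0 μ ρ) n) = _
      rw [comp_e0, createOp_const, Nat.cast_succ]
  rw [genSeq, h1, comp_smul, comp_e0, comp_e0, annihOp_const, kacOp_const]
  module

theorem e1_mem_graph (hμ : 0 < μ) (hρ : 0 < ρ) :
    (e1 μ ρ, (-ρ) • e1 μ ρ) ∈ graph lam hμ hρ := by
  refine mem_graph.2 fun N => ?_
  have hs : μ * Real.sqrt (ρ / μ) = ρ * Real.sqrt (μ / ρ) := by
    have h : Real.sqrt (μ / ρ) = μ / ρ * Real.sqrt (ρ / μ) := by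
      have h1 : μ / ρ = (μ / ρ) ^ 2 * (ρ / μ) := by field_simp
      rw [h1, Real.sqrt_mul (by positivity), Real.sqrt_sq (by positivity), ← h1]
    rw [h]
    field_simp
  have h1 : createSeq (comp hμ hρ (e1 μ ρ)) N
      = ((N : ℝ) * (Real.sqrt (ρ / μ) * ((N : ℝ) - 1) - Real.sqrt (μ / ρ))) • const N one := by
    cases N with
    | zero => rw [Nat.cast_zero, zero_mul, zero_smul]; rfl
    | succ n =>
      change createOp n (comp hμ hρ (e1 μ ρ) n) = _
      rw [comp_e1, map_smul, createOp_const, smul_smul, Nat.cast_succ, add_sub_cancel_right,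
        mul_comm]
  rw [genSeq, h1, comp_smul, comp_e1, comp_e1, map_smul, map_smul, annihOp_const, kacOp_const,
    Nat.cast_succ, smul_zero, smul_zero, add_zero, ← sub_smul, smul_smul, smul_smul, smul_smul,
    ← sub_smul, smul_smul, ← add_smul]
  congr 1
  linear_combination -hs

theorem e2_mem_graph (hμ : 0 < μ) (hρ : 0 < ρ) :
    (e2 μ ρ, (-ρ) • e2 μ ρ) ∈ graph lam hμ hρ := by
  refine mem_graph.2 fun N => ?_
  have h1 : createSeq (comp hμ hρ (e2 μ ρ)) N
      = (Real.sqrt (ρ / (2 * μ)) * ((N : ℝ) - 1)) • sumSingle N hermTwo := by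
    cases N with
    | zero =>
      rw [sumSingle_apply, Finset.univ_eq_empty, Finset.sum_empty, smul_zero]
      rfl
    | succ n =>
      change createOp n (comp hμ hρ (e2 μ ρ) n) = _
      rw [comp_e2, map_smul, createOp_sumSingle, smul_smul, Nat.cast_succ, add_sub_cancel_right]
  rw [genSeq, h1, comp_smul, comp_e2, comp_e2, map_smul, map_smul, annihOp_sumSingle mean_hermTwo,
    kacOp_sumSingle_hermTwo]
  module

theorem inner_eq_zero_of_graph {hμ : 0 < μ} {hρ : 0 < ρ} {x y : L2 μ ρ} {c d : ℝ}
    (hx : (x, c • x) ∈ graph lam hμ hρ) (hy : (y, d • y) ∈ graph lam hμ hρ) (hcd : c ≠ d) :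
    ⟪x, y⟫ = 0 := by
  have h := graph_symmetric hx hy
  simp only [inner_smul_left, inner_smul_right, conj_trivial] at h
  exact (mul_eq_zero.1 (show (c - d) * ⟪x, y⟫ = 0 by linarith)).resolve_left (sub_ne_zero.2 hcd)

/-- The spanning states of E₀ and E₁ are eigenvectors for 0 and -ρ, and eigenvectors of a symmetric
operator for different eigenvalues are orthogonal. -/
theorem mem_orthogonal_of_graph {hμ : 0 < μ} {hρ : 0 < ρ} {x : L2 μ ρ} {c : ℝ} (hc : c < -ρ)
    (hx : (x, c • x) ∈ graph lam hμ hρ) : x ∈ (E0 μ ρ ⊔ E1 μ ρ)ᗮ :=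
  mem_orthogonal_iff.2
    ⟨inner_eq_zero_of_graph (e0_mem_graph hμ hρ) hx (by linarith),
      inner_eq_zero_of_graph (e1_mem_graph hμ hρ) hx hc.ne',
      inner_eq_zero_of_graph (e2_mem_graph hμ hρ) hx hc.ne'⟩

/-- The maximum of the quadratic form off `E₀ ⊕ E₁` is attained exactly at the multiples of a
quartic eigenvector. -/
theorem exists_isGreatest (hlam : 0 < lam) (hμ : 0 < μ) (hρ : 0 < ρ)
    (hcond : ρ > lam / 4 + 2 * lam * Real.sqrt (ρ / μ)) (ht : μ / ρ > 256) :
    ∃ E, IsGreatest (gapSet lam μ ρ) E ∧ -ρ - lam / 4 ≤ E ∧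
      E ≤ -ρ - lam / 4 + lam * Real.sqrt (ρ / μ) ∧ (∃ h ∈ eigenspace lam μ ρ E, h ≠ 0) ∧
      ∀ x ∈ eigenspace lam μ ρ E, ∀ N, comp hμ hρ x N ∈ quarticBlock N := by
  obtain ⟨u, hu⟩ := exists_quartic hμ hρ
  obtain ⟨h, hquart, E, hE, hne, heig⟩ := exists_quartic_eigenvector hlam hμ hρ hcond ht hu
  have hbounds := fun (x y : L2 μ ρ) (hs : IsSymmetric x) (hx : x ∈ (E0 μ ρ ⊔ E1 μ ρ)ᗮ)
    (hxy : (x, y) ∈ graph lam hμ hρ) =>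
    form_bounds hlam hμ hρ hcond ht hu hs hx (hasSum_inner_graph hxy x)
  have hε := sqrt_ratio_pos hμ hρ
  have hε1 := sqrt_ratio_lt hμ hρ ht
  obtain ⟨hsym, hgr⟩ := (mem_eigenspace_iff hμ hρ).1 heig
  have hh0 : h ≠ 0 := fun h0 => hne (by rw [h0, inner_zero_left])
  have horth : h ∈ (E0 μ ρ ⊔ E1 μ ρ)ᗮ := mem_orthogonal_of_mem_quarticBlock hμ hρ hquart
  have hE2 : E ≤ -ρ - lam / 4 + lam * Real.sqrt (ρ / μ) := by
    have h1 := (hbounds h _ hsym horth hgr).1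
    simp only [inner_smul_right, real_inner_self_eq_norm_sq] at h1
    exact le_of_mul_le_mul_right h1 (by positivity)
  -- Because ε < 1/16, the bound on E lies below -ρ; eigenvectors for E are then automatically
  -- orthogonal to E₀ ⊕ E₁.
  have hEρ : E < -ρ := by nlinarith
  have hgap : ∀ w W : L2 μ ρ, IsSymmetric w → w ∈ (E0 μ ρ ⊔ E1 μ ρ)ᗮ → ⟪w, u⟫ = 0 →
      (w, W) ∈ graph lam hμ hρ →
      ⟪w, W⟫ ≤ (E - lam * Real.sqrt (ρ / μ) / 2) * ‖w‖ ^ 2 := fun w W hs ho hwu hwW => by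
    have h1 := (hbounds w W hs ho hwW).2
    rw [hwu] at h1
    refine h1.trans ?_
    nlinarith [sq_nonneg ‖w‖]
  -- An oblique splitting: w is made orthogonal to u, where the form has a gap, and not to h. This
  -- is possible because ⟨h, u⟩ ≠ 0.
  have hsplit : ∀ x y : L2 μ ρ, IsSymmetric x → x ∈ (E0 μ ρ ⊔ E1 μ ρ)ᗮ →
      (x, y) ∈ graph lam hμ hρ → ∃ (c : ℝ) (w : L2 μ ρ), x = w + c • h ∧ IsSymmetric w ∧
        w ∈ (E0 μ ρ ⊔ E1 μ ρ)ᗮ ∧ ⟪w, u⟫ = 0 ∧ (w, y - c • E • h) ∈ graph lam hμ hρ :=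
    fun x y hs ho hxy => by
      refine ⟨⟪x, u⟫ / ⟪h, u⟫, x - (⟪x, u⟫ / ⟪h, u⟫) • h, (sub_add_cancel _ _).symm, ?_, ?_, ?_, ?_⟩
      · exact mem_symmetricStates.1 (sub_mem (mem_symmetricStates.2 hs)
          (Submodule.smul_mem _ _ ((mem_symmetricStates (hμ := hμ) (hρ := hρ)).2 hsym)))
      · exact sub_mem ho (Submodule.smul_mem _ _ horth)
      · rw [inner_sub_left, inner_smul_left, conj_trivial, div_mul_cancel₀ _ hne, sub_self]
      · exact sub_mem hxy (Submodule.smul_mem _ (⟪x, u⟫ / ⟪h, u⟫) hgr)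
  refine ⟨E, ⟨?_, ?_⟩, hE, hE2, ⟨h, heig, hh0⟩, fun x hx => ?_⟩
  · have h1 : ‖h‖⁻¹ • h ∈ eigenspace lam μ ρ E := by
      refine (mem_eigenspace_iff hμ hρ).2 ⟨mem_symmetricStates.1 (Submodule.smul_mem _ _
        ((mem_symmetricStates (hμ := hμ) (hρ := hρ)).2 hsym)), ?_⟩
      rw [smul_comm]
      exact Submodule.smul_mem _ ‖h‖⁻¹ hgr
    have h2 : ‖‖h‖⁻¹ • h‖ = 1 := by
      rw [norm_smul, norm_inv, norm_norm, inv_mul_cancel₀ (norm_ne_zero_iff.2 hh0)]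
    refine ⟨_, h1.1, h2, Submodule.smul_mem _ _ horth, ?_⟩
    rw [form_of_mem_eigenspace hμ hρ h1, h2]
    ring
  · rintro q ⟨x, hx, hx1, ho, rfl⟩
    obtain ⟨hs, y, hxy⟩ := (mem_domain_iff hμ hρ).1 hx
    rw [form_eq_inner hμ hρ hs hxy]
    obtain ⟨c, w, rfl, hws, hwo, hwu, hwg⟩ := hsplit x y hs ho hxy
    have h1 := hgap w _ hws hwo hwu hwg
    have h2 := graph_symmetric hgr hwg
    have h3 : ‖w + c • h‖ ^ 2 = 1 := by rw [hx1, one_pow]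
    rw [← real_inner_self_eq_norm_sq] at h3
    simp only [inner_add_left, inner_add_right, inner_sub_right, inner_smul_left, inner_smul_right,
      conj_trivial, real_inner_self_eq_norm_sq, real_inner_comm h w] at h1 h2 h3 ⊢
    have h4 : 0 ≤ lam * Real.sqrt (ρ / μ) / 2 * ‖w‖ ^ 2 := by positivity
    -- As h is an eigenvector, the cross terms of the form are E times those of the squared norm, so
    -- the loss of orthogonality between w and h is harmless.
    linear_combination h1 + h4 - c * h2 + E * h3
  · obtain ⟨hs, hxg⟩ := (mem_eigenspace_iff hμ hρ).1 hx
    obtain ⟨c, w, hxw, hws, hwo, hwu, hwg⟩ :=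
      hsplit x _ hs (mem_orthogonal_of_graph hEρ hxg) hxg
    have h1 := hgap w _ hws hwo hwu hwg
    -- For an eigenvector x the remainder w satisfies the same eigenvalue equation, so the gap on
    -- vectors orthogonal to u forces w = 0 and x is a multiple of h.
    have h2 : E • x - c • E • h = E • w := by
      rw [hxw]
      module
    rw [h2, inner_smul_right, real_inner_self_eq_norm_sq] at h1
    have h3 : 0 < lam * Real.sqrt (ρ / μ) / 2 := by positivity
    have h4 : ‖w‖ ^ 2 ≤ 0 := by nlinarith [sq_nonneg ‖w‖]
    have h5 : w = 0 := norm_eq_zero.1 (pow_eq_zero_iff two_ne_zero |>.1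
      (le_antisymm h4 (sq_nonneg _)))
    intro N
    rw [hxw, h5, zero_add, comp_smul]
    exact Submodule.smul_mem _ _ (hquart N)

end

end KacReservoir

/-! ### The theorem on the second gap. -/

theorem theorem2 (lam μ ρ : ℝ) (hlam : 0 < lam) (hμ : 0 < μ) (hρ : 0 < ρ)
    (hcond : ρ > lam / 4 + 2 * lam * Real.sqrt (ρ / μ)) (hcond' : μ / ρ > 256) :
    IsLUB (KacReservoir.gapSet lam μ ρ) (KacReservoir.secondGap lam μ ρ) ∧
    -ρ - lam / 4 ≤ KacReservoir.secondGap lam μ ρ ∧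
    KacReservoir.secondGap lam μ ρ < -ρ - lam / 4 + 2 * lam * Real.sqrt (ρ / μ) ∧
    (∃ h ∈ KacReservoir.eigenspace lam μ ρ (KacReservoir.secondGap lam μ ρ), h ≠ 0) ∧
    (∀ h ∈ KacReservoir.eigenspace lam μ ρ (KacReservoir.secondGap lam μ ρ),
      ∀ N : ℕ, KacReservoir.IsEvenQuartic (fun v : Fin N → ℝ => h ⟨N, v⟩)) := by
  obtain ⟨E, hE, hlow, hup, hex, hquart⟩ :=
    KacReservoir.exists_isGreatest hlam hμ hρ hcond hcond'
  have hgap : KacReservoir.secondGap lam μ ρ = E := hE.csSup_eq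
  rw [hgap]
  refine ⟨hE.isLUB, hlow, hup.trans_lt ?_, hex, fun h hh N =>
    KacReservoir.isEvenQuartic_of_mem_quarticBlock hμ hρ (hquart h hh N)⟩
  have := mul_pos hlam (KacReservoir.sqrt_ratio_pos hμ hρ)
  linarith
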